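/- **Setting.** Let $V$ be a vertex operator algebra over $\mathbb{C}$ ($\mathbb{Z}$-graded by finite-dimensional weight spaces that vanish in sufficiently negative weight), $G$ a group of automorphisms of $V$, and $z\in\mathbb{C}^\times$. For $p\in\mathbb{Z}$ put $l_p(\zeta)=\log|\zeta|+i\arg \zeta+2\pi p i$ with $0\le\arg\zeta<2\pi$; the $p$-th branch of a formal series in complex powers of $x$ and powers of $\log x$ is obtained by substituting $x^n\mapsto e^{n l_p(\zeta)}$, $\log x\mapsto l_p(\zeta)$; if no branch is indicated, $p=0$. For $g\in G$, a *$g$-twisted $V$-module* is a $\mathbb{C}$-graded space $W=\coprod_n W_{[n]}$ with a linear map $Y_W:V\otimes W\to W\{x\}[\log x]$, $Y_W(v,x)w=\sum_{k=0}^{K}\sum_{n\in\mathbb C} Y_{n,k}(v)w\,x^{-n-1}(\log x)^k$, where $Y_{n,k}(v)$ shifts weights by $\mathrm{wt}\,v-n-1$, satisfying: equivariance $Y_W^{p+1}(gv,\zeta)=Y_W^{p}(v,\zeta)$; $Y_W(\mathbf 1,x)=1$; duality (the products $\langle w',Y_W^p(u,z_1)Y_W^p(v,z_2)w\rangle$,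 $\langle w',Y_W^p(v,z_2)Y_W^p(u,z_1)w\rangle$ and the iterate $\langle w',Y_W^p(Y_V(u,z_1-z_2)v,z_2)w\rangle$ converge absolutely for $|z_1|>|z_2|>0$, $|z_2|>|z_1|>0$, $|z_2|>|z_1-z_2|>0$ to the branch $\sum a_{ijkl}e^{m_il_p(z_1)}e^{n_jl_p(z_2)}l_p(z_1)^kl_p(z_2)^l(z_1-z_2)^{-t}$ of one function, a finite sum independent of $p$, the last equality being required where $|\arg z_1-\arg z_2|<\frac{\pi}{2}$); $L(0)-n$ is locally nilpotent on $W_{[n]}$; $\frac{d}{dx}Y_W(v,x)=Y_W(L(-1)v,x)$; and, for each $n\in\mathbb C$, $W_{[n+l]}=0$ for sufficiently negative real $l$. A *module map* is a linear map that commutes with the vertex operators. $\overline W=\prod_n W_{[n]}$ is the completion, and the contragredient $W'=\coprod_n W_{[n]}^*$ has the vertex operators $\langle Y'(v,x)w',w\rangle=\langle w',Y_W(e^{xL(1)}(-x^{-2})^{L(0)}v,x^{-1})w\rangle$. For $g_i$-twisted modules $W_i$ ($i=1,2,3$), a *twisted intertwining operator* of type $\binom{W_3}{W_1W_2}$ is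 a linear map $w_1\otimes w_2\mapsto\mathcal Y(w_1,x)w_2=\sum_{n\in\mathbb{C}}\sum_{k}\mathcal Y_{n,k}(w_1)w_2\,x^{-n-1}(\log x)^k$, in which the coefficient of each power of $x$ is a polynomial in $\log x$ and $\mathcal Y_{n,k}(w_1)w_2\in (W_3)_{[m_1+m_2-n-1]}$ for $w_i\in (W_i)_{[m_i]}$, such that: 1. $\mathcal Y_{n+l,k}(w_1)w_2=0$ for all sufficiently large $l\in\mathbb N$; 2. for $u\in V$, $w_1$, $w_2$, $w_3'\in W_3'$ there is a multivalued analytic function $f$ on $M^2=\{z_1,z_2\ne0,\ z_1\neq z_2\}$, with a preferred branch $f^e$ on $M^2$ cut along $z_1,z_2,z_1-z_2\in\mathbb R_+$ (cuts attached to the upper half planes), such that $\langle w_3',Y_{W_3}(u,z_1)\mathcal Y(w_1,z_2)w_2\rangle$, $\langle w_3',\mathcal Y(w_1,z_2)Y_{W_2}(u,z_1)w_2\rangle$, $\langle w_3',\mathcal Y(Y_{W_1}(u,z_1-z_2)w_1,z_2)w_2\rangle$ converge absolutely for $|z_1|>|z_2|>0$, $|z_2|>|z_1|>0$, $|z_2|>|z_1-z_2|>0$,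 with sum $f^e$ where moreover $|\arg(z_1-z_2)-\arg z_1|<\frac\pi2$, respectively $-\frac{3\pi}2<\arg(z_1-z_2)-\arg z_2<-\frac\pi2$, respectively $|\arg z_1-\arg z_2|<\frac\pi2$; 3. for $k\ge3$ the products $\langle w_3',Y_{W_3}(u_1,z_1)\cdots Y_{W_3}(u_{k-1},z_{k-1})\mathcal Y(w_1,z_k)w_2\rangle$ converge absolutely for $|z_1|>\dots>|z_k|>0$ and extend to a multivalued analytic function on $M^k=\{z_i\neq0,\ z_i\ne z_j\ (i\neq j)\}$ all of whose component-isolated singularities are regular. Here, for $A\in GL(k,\mathbb C)$, $\beta\in\mathbb C^k$, $\delta\in\{0,\infty\}^k$, the singularity $\zeta=(z_1,\dots,z_k)A-\beta=\delta$ is component-isolated if $M^k$ contains a punctured polydisc ($0<|\zeta_i|<r_i$ if $\delta_i=0$, $|\zeta_i|>r_i$ if $\delta_i=\infty$), and it is regular if there are $K\in\mathbb N$ and sets $D_i$ of exponents, each a finite union of sets $r+\mathbb N$ (if $\delta_i=0$) or $r-\mathbb N$ (if $\delta_i=\infty$), such that every single-valued branch near $\delta$ with cuts at $\zeta_i\in\mathbb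 R_+$ is, on some punctured polydisc, the sum of an absolutely convergent series in the monomials $\prod_i\zeta_i^{a_i}(\log\zeta_i)^{j_i}$ with $a_i\in D_i$, $0\le j_i\le K$; 4. $\frac{d}{dx}\mathcal Y(w_1,x)=\mathcal Y(L(-1)w_1,x)$. Let $\mathcal C$ be a category whose objects are either $g$-twisted $V$-modules, $g\in G$, or $g$-twisted $V$-modules, $g\in G$, with an action of $G$ (a left $G$-module structure on $W$ such that, for some $\Lambda\ge1$, each $W_{[n]}$ is the direct sum over $\alpha\in\mathbb C/\mathbb Z$ of its intersections with $\ker(g-e^{2\pi i\alpha})^\Lambda$, and $gY_W(u,x)w=Y_W(gu,x)gw$), and whose morphisms are all module maps. Let $W_1,W_2$ be $g_1$- and $g_2$-twisted modules in $\mathcal C$. A *$P(z)$-product* of $W_1,W_2$ in $\mathcal C$ is a pair $(W_3,I)$ of a $g_1g_2$-twisted module $W_3$ in $\mathcal C$ and a *twisted $P(z)$-intertwining map* $I:W_1\otimes W_2\to\overline{W_3}$, i.e. $I(w_1\otimes w_2)=\mathcal Y(w_1,z)w_2$ for a twisted intertwining operator $\mathcal Y$ of type $\binom{W_3}{W_1W_2}$.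 A *$P(z)$-tensor product* is a $P(z)$-product $(P,B)$ such that for every $P(z)$-product $(W_3,I)$ there is a unique module map $f:P\to W_3$ with $\bar f\circ B=I$, where $\bar f:\overline P\to\overline{W_3}$ is the natural extension of $f$. For a $P(z)$-product $(W_3,I)$ and $w_3'\in W_3'$ let $\lambda_{I,w_3'}(w_1\otimes w_2)=\langle w_3',I(w_1\otimes w_2)\rangle$. Let $W_1\widetilde\boxtimes_{P(z)}W_2\subset(W_1\otimes W_2)^*$ be the span of all $\lambda_{I,w_3'}$, with $Y(v,x)\lambda_{I,w_3'}=\lambda_{I,Y'(v,x)w_3'}$, its weight-$n$ subspace being spanned by the $\lambda_{I,w_3'}$ with $w_3'$ of weight $n$. **Theorem.** Assume that (1) for all $g_1,g_2\in G$ and all $g_1$-, $g_2$-twisted modules $W_1,W_2$ in $\mathcal C$, $W_1\widetilde\boxtimes_{P(z)}W_2$ is a $(g_1g_2)^{-1}$-twisted module in $\mathcal C$ (in the case with $G$-actions: with some action of $G$); (2) the contragredient of a $g$-twisted module in $\mathcal C$ is a $g^{-1}$-twisted module in $\mathcal C$ (in the case with $G$-actions: with some action of $G$); (3) every object of $\mathcal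 C$ is equivalent, as a twisted module, to its double contragredient. Then for all $g_1$- and $g_2$-twisted modules $W_1,W_2$ in $\mathcal C$, the contragredient $W_1\boxtimes_{P(z)}W_2=(W_1\widetilde\boxtimes_{P(z)}W_2)'$, with the map $\boxtimes_{P(z)}:W_1\otimes W_2\to\overline{W_1\boxtimes_{P(z)}W_2}$ determined by $\langle\lambda,\boxtimes_{P(z)}(w_1\otimes w_2)\rangle=\lambda(w_1\otimes w_2)$ for $\lambda\in W_1\widetilde\boxtimes_{P(z)}W_2$, is a $P(z)$-tensor product of $W_1$ and $W_2$ in $\mathcal C$. -/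

import Mathlib

open scoped TensorProduct DirectSum Topology

universe u w

noncomputable section

/-! ## Vertex operator algebras and their automorphisms -/

/-- A vertex operator algebra over `ℂ`. `Y v` is the vertex operator
`Y(v, x) = ∑ n, v_n x ^ (-n - 1)`, and `v_n` is `VertexOperator.ncoeff (Y v) n`.
The Jacobi identity is written in components (Borcherds' identity). -/
structure VOA (V : Type u) [AddCommGroup V] [Module ℂ V] where
  /-- the homogeneous subspace `V_(n)` -/
  wt : ℤ → Submodule ℂ V
  internal : DirectSum.IsInternal wt
  finiteDimensional : ∀ n, FiniteDimensional ℂ (wt n)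
  lower_bounded : ∃ N : ℤ, ∀ n < N, wt n = ⊥
  Y : V →ₗ[ℂ] VertexOperator ℂ V
  /-- the vacuum -/
  vac : V
  /-- the conformal element -/
  ω : V
  /-- the central charge -/
  c : ℂ
  vac_mem : vac ∈ wt 0
  ω_mem : ω ∈ wt 2
  vac_left : ∀ (v : V) (n : ℤ), (Y vac).ncoeff n v = if n = -1 then v else 0
  creation : ∀ (v : V) (n : ℤ), 0 ≤ n → (Y v).ncoeff n vac = 0
  creation' : ∀ v : V, (Y v).ncoeff (-1) vac = v
  jacobi : ∀ (a b v : V) (l m n : ℤ),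
    ∑ᶠ i : ℕ, ((Ring.choose m i : ℤ) : ℂ) •
        (Y ((Y a).ncoeff (l + i) b)).ncoeff (m + n - i) v =
      ∑ᶠ i : ℕ, ((-1 : ℂ) ^ i * ((Ring.choose l i : ℤ) : ℂ)) •
        ((Y a).ncoeff (m + l - i) ((Y b).ncoeff (n + i) v) -
          (-1 : ℂ) ^ l • (Y b).ncoeff (n + l - i) ((Y a).ncoeff (m + i) v))
  /-- the Virasoro relations for `L(n) = ω_{n+1}` -/
  virasoro : ∀ (m n : ℤ) (v : V),
    (Y ω).ncoeff (m + 1) ((Y ω).ncoeff (n + 1) v) -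
        (Y ω).ncoeff (n + 1) ((Y ω).ncoeff (m + 1) v) =
      ((m : ℂ) - n) • (Y ω).ncoeff (m + n + 1) v +
        if m + n = 0 then (((m : ℂ) ^ 3 - m) / 12 * c) • v else 0
  L_zero : ∀ (n : ℤ), ∀ v ∈ wt n, (Y ω).ncoeff 1 v = (n : ℂ) • v
  L_neg_one : ∀ (v b : V) (n : ℤ),
    (Y ((Y ω).ncoeff 0 v)).ncoeff n b = -(n : ℂ) • (Y v).ncoeff (n - 1) b

namespace VOA

variable {V : Type u} [AddCommGroup V] [Module ℂ V] (𝒱 : VOA V)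

/-- The Virasoro operator `L(n)` on `V`. -/
def L (n : ℤ) : Module.End ℂ V := (𝒱.Y 𝒱.ω).ncoeff (n + 1)

theorem bijective_coe : Function.Bijective (DirectSum.coeLinearMap 𝒱.wt) := 𝒱.internal

/-- The decomposition `V = ∐ n, V_(n)`. -/
def decomp : V ≃ₗ[ℂ] ⨁ n, 𝒱.wt n :=
  (LinearEquiv.ofBijective (DirectSum.coeLinearMap 𝒱.wt) 𝒱.bijective_coe).symm

/-- The projection `π_n : V → V_(n)`. -/
def proj (n : ℤ) : V →ₗ[ℂ] 𝒱.wt n :=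
  (DirectSum.component ℂ ℤ (fun n => 𝒱.wt n) n).comp 𝒱.decomp.toLinearMap

/-- The group of automorphisms of the vertex operator algebra. -/
def Aut : Subgroup (V ≃ₗ[ℂ] V) where
  carrier := {g | g 𝒱.vac = 𝒱.vac ∧ g 𝒱.ω = 𝒱.ω ∧
    ∀ (a b : V) (n : ℤ), g ((𝒱.Y a).ncoeff n b) = (𝒱.Y (g a)).ncoeff n (g b)}
  mul_mem' := by
    rintro g h ⟨g1, g2, g3⟩ ⟨h1, h2, h3⟩
    refine ⟨?_, ?_, fun a b n => ?_⟩
    · rw [LinearEquiv.mul_apply, h1, g1]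
    · rw [LinearEquiv.mul_apply, h2, g2]
    · simp only [LinearEquiv.mul_apply, h3, g3]
  one_mem' := ⟨rfl, rfl, fun _ _ _ => rfl⟩
  inv_mem' := by
    rintro g ⟨g1, g2, g3⟩
    have key : ∀ x, g⁻¹ (g x) = x := fun x => g.symm_apply_apply x
    have key' : ∀ x, g (g⁻¹ x) = x := fun x => g.apply_symm_apply x
    refine ⟨?_, ?_, fun a b n => ?_⟩
    · conv_lhs => rw [← g1]
      exact key _
    · conv_lhs => rw [← g2]
      exact key _
    · apply g.injective
      rw [key', g3, key', key']

/-- The component of weight `n` of `Y(a, ζ) b`. -/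
def evalComp (a b : V) (ζ : ℂ) (n : ℤ) : V :=
  ∑ᶠ m : ℤ, ζ ^ (-m - 1) • (𝒱.proj n ((𝒱.Y a).ncoeff m b) : V)

theorem decomp_coe (n : ℤ) (v : 𝒱.wt n) :
    𝒱.decomp (v : V) = DirectSum.of (fun n => 𝒱.wt n) n v := by
  rw [decomp, LinearEquiv.symm_apply_eq, LinearEquiv.ofBijective_apply]
  exact (DirectSum.coeLinearMap_of 𝒱.wt n v).symm

theorem mem_wt_of_L_zero (e : ℤ) (v : V) (hv : 𝒱.L 0 v = (e : ℂ) • v) : v ∈ 𝒱.wt e := by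
  obtain ⟨x, rfl⟩ := 𝒱.decomp.symm.surjective v
  have h1 : ∀ y : ⨁ n, 𝒱.wt n, ∀ n : ℤ,
      (𝒱.decomp (𝒱.L 0 (𝒱.decomp.symm y))) n = (n : ℂ) • y n := by
    intro y n
    induction y using DirectSum.induction_on with
    | zero => simp
    | of i a =>
      have ha : 𝒱.decomp.symm (DirectSum.of (fun n => 𝒱.wt n) i a) = (a : V) := by
        rw [LinearEquiv.symm_apply_eq, decomp_coe]
      have hL : 𝒱.L 0 (a : V) = (i : ℂ) • (a : V) := 𝒱.L_zero i a a.2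
      rw [ha, hL, map_smul, decomp_coe]
      by_cases hin : i = n
      · subst hin; rw [DirectSum.smul_apply]
      · rw [DirectSum.smul_apply, DirectSum.of_eq_of_ne _ _ _ (Ne.symm hin)]; simp
    | add a b ha hb => simp only [map_add, DirectSum.add_apply, ha, hb, smul_add]
  have h2 : ∀ n : ℤ, n ≠ e → x n = 0 := by
    intro n hn
    have h3 := h1 x n
    rw [hv, map_smul, LinearEquiv.apply_symm_apply, DirectSum.smul_apply] at h3
    have h4 : ((e : ℂ) - n) • x n = 0 := by rw [sub_smul, h3, sub_self]
    rcases smul_eq_zero.mp h4 with h5 | h5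
    · exact absurd (by exact_mod_cast (sub_eq_zero.mp h5).symm) hn
    · exact h5
  have h6 : x = DirectSum.of (fun n => 𝒱.wt n) e (x e) := by
    ext n
    by_cases hn : n = e
    · subst hn; simp
    · rw [h2 n hn, DirectSum.of_eq_of_ne _ _ _ hn]
  have h7 : 𝒱.decomp.symm x = (x e : V) := by
    conv_lhs => rw [h6]
    rw [LinearEquiv.symm_apply_eq, decomp_coe]
  rw [h7]; exact (x e).2

theorem L_one_pow_mem (h : ℤ) (v : V) (hv : v ∈ 𝒱.wt h) (j : ℕ) :
    ((𝒱.L 1) ^ j) v ∈ 𝒱.wt (h - j) := by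
  induction j with
  | zero => simpa using hv
  | succ j ih =>
    rw [pow_succ', Module.End.mul_apply]
    set x := ((𝒱.L 1) ^ j) v
    apply mem_wt_of_L_zero
    have h1 := 𝒱.virasoro 0 1 x
    have h2 : 𝒱.L 0 x = ((h - j : ℤ) : ℂ) • x := 𝒱.L_zero _ x ih
    simp only [L] at h2 ⊢
    norm_num at h1 h2 ⊢
    rw [h2, map_smul] at h1
    rw [sub_eq_iff_eq_add] at h1
    rw [h1]
    module

/-- A weight below which all `V_(n)` vanish. -/
def lowest : ℤ := Classical.choose 𝒱.lower_bounded

end VOA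

/-! ## Branches of logarithms and formal series -/

/-- The argument normalised by `0 ≤ arg z < 2π`. -/
def argPos (z : ℂ) : ℝ := if 0 ≤ z.arg then z.arg else z.arg + 2 * Real.pi

/-- `l_p(z) = log |z| + i arg z + 2π p i`. -/
def lBranch (p : ℤ) (z : ℂ) : ℂ :=
  (Real.log ‖z‖ : ℂ) + argPos z * Complex.I + 2 * Real.pi * p * Complex.I

/-- Formal series in complex powers of `x` and powers of `log x`: `f n k` is the coefficient of
`x ^ (-n - 1) (log x) ^ k`. -/
abbrev LogSeries (W : Type w) := ℂ → ℕ → W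

/-! ## Graded spaces with a vertex operator map -/

/-- A vector space with subspaces `W_[n]`, `n ∈ ℂ`, and a linear map `Y` from `V ⊗ W` to formal
series; `Y v w n k` is the coefficient of `x ^ (-n - 1) (log x) ^ k` in `Y(v, x) w`. The weights of
the coefficients are the ones that make `Y(v, z) w` an element of the algebraic completion. The
axioms of a twisted module are imposed in `IsTwistedModule`. -/
structure VData {V : Type u} [AddCommGroup V] [Module ℂ V] (𝒱 : VOA V) where
  carrier : Type w
  [addCommGroup : AddCommGroup carrier]
  [module : Module ℂ carrier]
  wt : ℂ → Submodule ℂ carrier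
  Y : V →ₗ[ℂ] carrier →ₗ[ℂ] LogSeries carrier
  homog : ∀ (h : ℤ), ∀ v ∈ 𝒱.wt h, ∀ (m : ℂ), ∀ x ∈ wt m, ∀ (n : ℂ) (k : ℕ),
    Y v x n k ∈ wt (m + h - n - 1)

namespace VData

variable {V : Type u} [AddCommGroup V] [Module ℂ V] {𝒱 : VOA V}

instance : CoeSort (VData.{u, w} 𝒱) (Type w) := ⟨VData.carrier⟩
instance (W : VData.{u, w} 𝒱) : AddCommGroup W := W.addCommGroup
instance (W : VData.{u, w} 𝒱) : Module ℂ W := W.module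

variable (W : VData.{u, w} 𝒱)

/-- The algebraic completion `∏ n, W_[n]`. -/
abbrev Completion : Type w := ∀ n : ℂ, W.wt n

open Classical in
/-- The projection `π_n : W → W_[n]` for `W = ∐ n, W_[n]` (the bijectivity says that `W` is the direct
sum of the `W_[n]`). -/
def proj (n : ℂ) : W →ₗ[ℂ] W.wt n :=
  if h : Function.Bijective (DirectSum.coeLinearMap W.wt) then
    (DirectSum.component ℂ ℂ (fun n => W.wt n) n).comp
      (LinearEquiv.ofBijective (DirectSum.coeLinearMap W.wt) h).symm.toLinearMap
  else 0

theorem proj_of_ne {m n : ℂ} (hmn : m ≠ n) (x : W) (hx : x ∈ W.wt m) : W.proj n x = 0 := by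
  unfold proj
  split_ifs with h
  · have : (LinearEquiv.ofBijective (DirectSum.coeLinearMap W.wt) h).symm x =
        DirectSum.of (fun n => W.wt n) m ⟨x, hx⟩ := by
      rw [LinearEquiv.symm_apply_eq, LinearEquiv.ofBijective_apply]
      exact (DirectSum.coeLinearMap_of W.wt m ⟨x, hx⟩).symm
    rw [LinearMap.comp_apply, LinearEquiv.coe_coe, this]
    exact DirectSum.of_eq_of_ne _ _ _ hmn.symm
  · rfl

/-- The element of the completion obtained from a formal series by substituting `exp (n ℓ)` for
`x ^ n` and `ℓ` for `log x`. For `ℓ = l_p(z)` this is the `p`-th branch at `z`. -/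
def eval (ℓ : ℂ) (f : LogSeries W) : W.Completion := fun m =>
  ∑ᶠ p : ℂ × ℕ, (Complex.exp ((-p.1 - 1) * ℓ) * ℓ ^ p.2) • W.proj m (f p.1 p.2)

/-- The Virasoro operator `L(j) = Res_x x ^ (j + 1) Y(ω, x)`. -/
def L (j : ℤ) : Module.End ℂ W where
  toFun x := W.Y 𝒱.ω x (j + 1) 0
  map_add' x y := by simp
  map_smul' a x := by simp

/-! ### Graded duals and contragredients -/

/-- `(W_[n])^*`, as the functionals on `W` that vanish on all other weight spaces. -/
def dualWt (n : ℂ) : Submodule ℂ (Module.Dual ℂ W) where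
  carrier := {φ | ∀ m, m ≠ n → ∀ x ∈ W.wt m, φ x = 0}
  add_mem' := by
    intro a b ha hb m hm x hx
    rw [LinearMap.add_apply, ha m hm x hx, hb m hm x hx, add_zero]
  zero_mem' := fun _ _ _ _ => rfl
  smul_mem' := by
    intro c a ha m hm x hx
    rw [LinearMap.smul_apply, ha m hm x hx, smul_zero]

/-- The graded dual `W' = ∐ n, (W_[n])^*`. -/
def gdual : Submodule ℂ (Module.Dual ℂ W) := ⨆ n, W.dualWt n

theorem support_finite (φ : Module.Dual ℂ W) (hφ : φ ∈ W.gdual) :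
    {n : ℂ | ∃ x ∈ W.wt n, φ x ≠ 0}.Finite := by
  unfold gdual at hφ
  induction hφ using Submodule.iSup_induction' with
  | mem i x hx =>
    refine (Set.finite_singleton i).subset ?_
    rintro n ⟨y, hy, hne⟩
    by_contra hn
    exact hne (hx n hn y hy)
  | zero =>
    refine Set.finite_empty.subset ?_
    rintro n ⟨y, _, hne⟩
    exact hne rfl
  | add x y _ _ hx hy =>
    refine (hx.union hy).subset ?_
    rintro n ⟨a, ha, hne⟩
    by_contra hn
    simp only [Set.mem_union, Set.mem_ofPred_eq, not_or, not_exists, not_and, not_not] at hn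
    exact hne (by rw [LinearMap.add_apply, hn.1 a ha, hn.2 a ha, add_zero])

theorem pairing_finite (φ : W.gdual) (y : W.Completion) :
    (Function.support fun n => (φ : Module.Dual ℂ W) (y n : W)).Finite :=
  (W.support_finite φ φ.2).subset fun n hn => ⟨y n, (y n).2, hn⟩

/-- The pairing of an element of `W'` with the algebraic completion of `W`. -/
def pairing (φ : W.gdual) : W.Completion →ₗ[ℂ] ℂ where
  toFun y := ∑ᶠ n, (φ : Module.Dual ℂ W) (y n : W)
  map_add' x y := by
    rw [← finsum_add_distrib (W.pairing_finite φ x) (W.pairing_finite φ y)]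
    simp
  map_smul' c x := by
    simp only [Pi.smul_apply, Submodule.coe_smul, map_smul, RingHom.id_apply]
    rw [smul_finsum' c (W.pairing_finite φ x)]

theorem comp_mem_dualWt (h : ℤ) (a : V) (ha : a ∈ 𝒱.wt h) (r : ℂ) (φ : Module.Dual ℂ W)
    (hφ : φ ∈ W.dualWt r) (n : ℂ) (k : ℕ) (ψ : Module.Dual ℂ W)
    (hψ : ∀ x, ψ x = φ (W.Y a x n k)) : ψ ∈ W.dualWt (r - h + n + 1) := by
  intro m hm x hx
  rw [hψ]
  refine hφ _ (fun he => hm ?_) _ (W.homog h a ha m x hx n k)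
  rw [← he]; ring

/-- The functional `w' ∘ Y_{n, k}(a)`. -/
def adjFun (a : V) (φ : Module.Dual ℂ W) (n : ℂ) (k : ℕ) : Module.Dual ℂ W where
  toFun x := φ (W.Y a x n k)
  map_add' x y := by simp
  map_smul' c x := by simp

theorem adjFun_mem (a : V) (φ : Module.Dual ℂ W) (hφ : φ ∈ W.gdual) (n : ℂ) (k : ℕ) :
    W.adjFun a φ n k ∈ W.gdual := by
  unfold gdual at hφ
  induction hφ using Submodule.iSup_induction' with
  | mem r φ hφ =>
    have ha : a ∈ ⨆ h, 𝒱.wt h := by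
      rw [𝒱.internal.submodule_iSup_eq_top]; trivial
    induction ha using Submodule.iSup_induction' with
    | mem h a ha =>
      exact Submodule.mem_iSup_of_mem _
        (W.comp_mem_dualWt h a ha r φ hφ n k _ fun _ => rfl)
    | zero =>
      have : W.adjFun 0 φ n k = 0 := by ext x; simp [adjFun]
      rw [this]; exact zero_mem _
    | add a b _ _ ha hb =>
      have : W.adjFun (a + b) φ n k = W.adjFun a φ n k + W.adjFun b φ n k := by
        ext x; simp [adjFun]
      rw [this]; exact add_mem ha hb
  | zero =>
    have : W.adjFun a 0 n k = 0 := by ext x; simp [adjFun]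
    rw [this]; exact zero_mem _
  | add φ ψ _ _ hφ hψ =>
    have : W.adjFun a (φ + ψ) n k = W.adjFun a φ n k + W.adjFun a ψ n k := by
      ext x; simp [adjFun]
    rw [this]; exact add_mem hφ hψ

/-- `w' ∘ Y_{n, k}(a)` as an element of `W'`. -/
def adj (a : V) (φ : W.gdual) (n : ℂ) (k : ℕ) : W.gdual :=
  ⟨W.adjFun a φ n k, W.adjFun_mem a φ φ.2 n k⟩

/-- For `v` of weight `h`, the coefficients of `w' ∘ Y(e^{x L(1)} (-x^{-2})^{L(0)} v, x^{-1})`.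
Here `e^{x L(1)} (-x^{-2})^{L(0)} v = ∑ j, (-1) ^ h / j! x ^ (j - 2h) L(1) ^ j v`, where
`L(1) ^ j v` has weight `h - j`, so that the sum is finite. -/
def contraAux (h : ℤ) : V →ₗ[ℂ] W.gdual →ₗ[ℂ] LogSeries W.gdual where
  toFun v :=
    { toFun := fun φ n k => ∑ j ∈ Finset.range ((h - 𝒱.lowest).toNat + 1),
        ((-1 : ℂ) ^ h * (-1 : ℂ) ^ k / (j.factorial : ℂ)) •
          W.adj (((𝒱.L 1) ^ j) v) φ (2 * h - n - 2 - j) k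
      map_add' := by
        intro φ ψ
        ext n k x
        simp [adj, adjFun, Finset.sum_add_distrib, mul_add]
      map_smul' := by
        intro c φ
        ext n k x
        simp [adj, adjFun, Finset.mul_sum, mul_left_comm] }
  map_add' := by
    intro v v'
    ext φ n k x
    simp [adj, adjFun, Finset.sum_add_distrib, mul_add]
  map_smul' := by
    intro c v
    ext φ n k x
    simp [adj, adjFun, Finset.mul_sum, mul_left_comm]

/-- The vertex operator map of the contragredient, given by
`⟨Y'(v, x) w', w⟩ = ⟨w', Y(e^{x L(1)} (-x^{-2})^{L(0)} v, x^{-1}) w⟩`. -/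
def contraY : V →ₗ[ℂ] W.gdual →ₗ[ℂ] LogSeries W.gdual :=
  (DirectSum.toModule ℂ ℤ (W.gdual →ₗ[ℂ] LogSeries W.gdual)
    fun h => (W.contraAux h).comp (𝒱.wt h).subtype).comp 𝒱.decomp.toLinearMap

theorem contraY_of_mem (h : ℤ) (v : V) (hv : v ∈ 𝒱.wt h) : W.contraY v = W.contraAux h v := by
  have h1 : 𝒱.decomp v = DirectSum.lof ℂ ℤ (fun n => 𝒱.wt n) h ⟨v, hv⟩ :=
    𝒱.decomp_coe h ⟨v, hv⟩
  rw [contraY, LinearMap.comp_apply, LinearEquiv.coe_coe, h1, DirectSum.toModule_lof]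
  rfl

/-- The contragredient `W'`. -/
def contra : VData.{u, w} 𝒱 where
  carrier := W.gdual
  wt n := (W.dualWt n).comap W.gdual.subtype
  Y := W.contraY
  homog := by
    intro h v hv r φ hφ n k
    rw [W.contraY_of_mem h v hv]
    change (∑ j ∈ Finset.range ((h - 𝒱.lowest).toNat + 1),
        ((-1 : ℂ) ^ h * (-1 : ℂ) ^ k / (j.factorial : ℂ)) •
          W.adj (((𝒱.L 1) ^ j) v) φ (2 * h - n - 2 - j) k) ∈ (W.dualWt _).comap W.gdual.subtype
    refine Submodule.sum_mem _ fun j _ => Submodule.smul_mem _ _ ?_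
    have h1 := W.comp_mem_dualWt (h - j) _ (𝒱.L_one_pow_mem h v hv j) r φ hφ
      (2 * h - n - 2 - j) k (W.adjFun (((𝒱.L 1) ^ j) v) φ (2 * h - n - 2 - j) k) fun _ => rfl
    have h2 : r - ((h - j : ℤ) : ℂ) + (2 * h - n - 2 - j) + 1 = r + h - n - 1 := by
      push_cast
      ring
    rw [h2] at h1
    exact h1

end VData

/-! ## Twisted modules -/

section TwistedModules

variable {V : Type u} [AddCommGroup V] [Module ℂ V] {𝒱 : VOA V}

/-- The function `∑ a_{ijkl} e^{m_i l_p(z₁)} e^{n_j l_p(z₂)} l_p(z₁)^k l_p(z₂)^l (z₁ - z₂)^{-t}`. -/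
def corrFun {N : ℕ} (a : Fin (N + 1) → Fin (N + 1) → Fin (N + 1) → Fin (N + 1) → ℂ)
    (m n : Fin (N + 1) → ℂ) (t : ℕ) (p : ℤ) (z₁ z₂ : ℂ) : ℂ :=
  ∑ i, ∑ j, ∑ k, ∑ l, a i j k l * Complex.exp (m i * lBranch p z₁) *
    Complex.exp (n j * lBranch p z₂) * lBranch p z₁ ^ (k : ℕ) * lBranch p z₂ ^ (l : ℕ) *
    (z₁ - z₂) ^ (-(t : ℤ))

/-- `W` is a generalized `g`-twisted `V`-module (without a `g`-action). -/
structure IsGeneralizedTwistedModule (g : V ≃ₗ[ℂ] V) (W : VData.{u, w} 𝒱) : Prop where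
  internal : DirectSum.IsInternal W.wt
  log_bounded : ∀ (v : V) (x : W), ∃ K : ℕ, ∀ (n : ℂ) (k : ℕ), K < k → W.Y v x n k = 0
  equivariance : ∀ (p : ℤ) (z : ℂ), z ≠ 0 → ∀ (v : V) (x : W),
    W.eval (lBranch (p + 1) z) (W.Y (g v) x) = W.eval (lBranch p z) (W.Y v x)
  identity : ∀ (x : W) (n : ℂ) (k : ℕ), W.Y 𝒱.vac x n k = if n = -1 ∧ k = 0 then x else 0
  duality : ∀ (a b : V) (x : W) (φ : W.gdual),
    ∃ (N : ℕ) (α : Fin (N + 1) → Fin (N + 1) → Fin (N + 1) → Fin (N + 1) → ℂ)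
      (m n : Fin (N + 1) → ℂ) (t : ℕ), 0 < t ∧ ∀ (p : ℤ) (z₁ z₂ : ℂ),
      (‖z₂‖ < ‖z₁‖ → 0 < ‖z₂‖ → HasSum (fun r : ℂ => W.pairing φ
          (W.eval (lBranch p z₁) (W.Y a (W.eval (lBranch p z₂) (W.Y b x) r))))
          (corrFun α m n t p z₁ z₂)) ∧
      (‖z₁‖ < ‖z₂‖ → 0 < ‖z₁‖ → HasSum (fun r : ℂ => W.pairing φ
          (W.eval (lBranch p z₂) (W.Y b (W.eval (lBranch p z₁) (W.Y a x) r))))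
          (corrFun α m n t p z₁ z₂)) ∧
      (‖z₁ - z₂‖ < ‖z₂‖ → 0 < ‖z₁ - z₂‖ →
        Summable (fun r : ℤ => W.pairing φ
          (W.eval (lBranch p z₂) (W.Y (𝒱.evalComp a b (z₁ - z₂) r) x))) ∧
        (|argPos z₁ - argPos z₂| < Real.pi / 2 →
          ∑' r : ℤ, W.pairing φ
            (W.eval (lBranch p z₂) (W.Y (𝒱.evalComp a b (z₁ - z₂) r) x)) =
          corrFun α m n t p z₁ z₂))
  L_zero_grading : ∀ (n : ℂ), ∀ x ∈ W.wt n, ∃ K : ℕ, 0 < K ∧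
    ((W.L 0 - n • (1 : Module.End ℂ W)) ^ K) x = 0
  L_neg_one_derivative : ∀ (v : V) (x : W) (n : ℂ) (k : ℕ),
    W.Y (𝒱.L (-1) v) x n k = -n • W.Y v x (n - 1) k + ((k : ℂ) + 1) • W.Y v x (n - 1) (k + 1)

/-- `W` is a `g`-twisted `V`-module, i.e. a lower-bounded generalized `g`-twisted `V`-module. -/
structure IsTwistedModule (g : V ≃ₗ[ℂ] V) (W : VData.{u, w} 𝒱) : Prop
    extends IsGeneralizedTwistedModule g W where
  lower_bounded : ∀ n : ℂ, ∃ R : ℝ, ∀ l : ℝ, l < R → W.wt (n + l) = ⊥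

/-- The left `G`-module structure `ρ` makes the `g`-twisted module `W` a module with a `g`-action
and a `G`-action. The `g`-grading condition is stated through the generalized eigenspaces
`ker (g - e^{2πiα}) ^ Λ`, which are independent for distinct classes `α ∈ ℂ/ℤ`; it says that
`W_[n]` is the direct sum of the spaces `W_[n]^[α] = W_[n] ⊓ ker (g - e^{2πiα}) ^ Λ`. -/
structure IsGAction {G : Subgroup (V ≃ₗ[ℂ] V)} (g : G) (W : VData.{u, w} 𝒱)
    (ρ : Representation ℂ G W) : Prop where
  g_grading : ∃ Λ : ℕ, 0 < Λ ∧ ∀ n : ℂ, W.wt n ≤ ⨆ α : ℂ, W.wt n ⊓ LinearMap.ker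
    ((ρ g - Complex.exp (2 * Real.pi * α * Complex.I) • (1 : Module.End ℂ W)) ^ Λ)
  compat : ∀ (a : V) (x : W) (n : ℂ) (k : ℕ),
    ρ g (W.Y a x n k) = W.Y ((g : V ≃ₗ[ℂ] V) a) (ρ g x) n k

/-- `f` is a module map. -/
def IsModuleMap (W W' : VData.{u, w} 𝒱) (f : W →ₗ[ℂ] W') : Prop :=
  ∀ (v : V) (x : W) (n : ℂ) (k : ℕ), f (W.Y v x n k) = W'.Y v (f x) n k

/-- Equivalence of twisted modules. -/
def IsEquivalent (W W' : VData.{u, w} 𝒱) : Prop :=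
  ∃ e : W ≃ₗ[ℂ] W', IsModuleMap W W' e.toLinearMap

end TwistedModules

/-! ## Multivalued analytic functions -/

/-- `ψ` is the result of analytic continuation of the germ `φ` along the path `γ`. -/
def IsContinuationAlong {n : ℕ} (γ : C(unitInterval, Fin n → ℂ)) (φ ψ : (Fin n → ℂ) → ℂ) : Prop :=
  ∃ Φ : unitInterval → (Fin n → ℂ) → ℂ,
    (∀ t, AnalyticAt ℂ (Φ t) (γ t)) ∧
    (∀ t, ∀ᶠ s in 𝓝 t, Φ s =ᶠ[𝓝 (γ s)] Φ t) ∧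
    Φ 0 =ᶠ[𝓝 (γ 0)] φ ∧ Φ 1 =ᶠ[𝓝 (γ 1)] ψ

/-- A (maximally extended) multivalued analytic function on `Ω`: a germ at a point of `Ω` that can
be continued analytically along every path in `Ω`. -/
structure MultiFun (n : ℕ) (Ω : Set (Fin n → ℂ)) where
  base : Fin n → ℂ
  base_mem : base ∈ Ω
  germ : (Fin n → ℂ) → ℂ
  analyticAt : AnalyticAt ℂ germ base
  continuable : ∀ γ : C(unitInterval, Fin n → ℂ), γ 0 = base → (∀ t, γ t ∈ Ω) →
    ∃ ψ, IsContinuationAlong γ germ ψ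

namespace MultiFun

variable {n : ℕ} {Ω : Set (Fin n → ℂ)} (f : MultiFun n Ω)

/-- `ψ` is one of the germs of the multivalued function `f` at the point `z`. -/
def IsGermAt (z : Fin n → ℂ) (ψ : (Fin n → ℂ) → ℂ) : Prop :=
  ∃ γ : C(unitInterval, Fin n → ℂ), γ 0 = f.base ∧ γ 1 = z ∧ (∀ t, γ t ∈ Ω) ∧
    IsContinuationAlong γ f.germ ψ

/-- `F` is a single-valued branch of `f` on the region `R` cut along `c i ∈ ℝ_+`, the cuts being
attached to the upper half `c i`-planes: near each point of `R`, the function `F` agrees with a germ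
of `f` on the points at which no `arg (c i)` has jumped. -/
def IsBranchOn {ι : Type*} (R : Set (Fin n → ℂ)) (c : ι → (Fin n → ℂ) → ℂ)
    (F : (Fin n → ℂ) → ℂ) : Prop :=
  ∀ z ∈ R, ∃ ψ, f.IsGermAt z ψ ∧
    ∀ᶠ z' in 𝓝 z, (∀ i, |argPos (c i z') - argPos (c i z)| < Real.pi) → F z' = ψ z'

/-- The new variables `ζ = z A - β`. -/
def newVar (A : GL (Fin n) ℂ) (β : Fin n → ℂ) (z : Fin n → ℂ) : Fin n → ℂ :=
  Matrix.vecMul z (A : Matrix (Fin n) (Fin n) ℂ) - β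

/-- The points `z` with `ζ = z A - β` in the punctured polydisc `Δ^×(δ, r)`; `δ i = true` stands for
`δ_i = ∞` and `δ i = false` for `δ_i = 0`. -/
def puncturedPolydisc (A : GL (Fin n) ℂ) (β : Fin n → ℂ) (δ : Fin n → Bool) (r : Fin n → ℝ) :
    Set (Fin n → ℂ) :=
  {z | ∀ i, if δ i then r i < ‖newVar A β z i‖
    else 0 < ‖newVar A β z i‖ ∧ ‖newVar A β z i‖ < r i}

/-- `ζ = z A - β = δ` is a component-isolated singularity of functions on `Ω`. -/
def IsComponentIsolated (Ω : Set (Fin n → ℂ)) (A : GL (Fin n) ℂ) (β : Fin n → ℂ)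
    (δ : Fin n → Bool) : Prop :=
  ∃ r : Fin n → ℝ, (∀ i, 0 < r i) ∧ puncturedPolydisc A β δ r ⊆ Ω

/-- The exponents `E + ℕ` (at `0`) or `E - ℕ` (at `∞`). -/
def exponents (E : Finset ℂ) (atInfty : Bool) : Set ℂ :=
  {a | ∃ e ∈ E, ∃ m : ℕ, a = if atInfty then e - m else e + m}

/-- `ζ = z A - β = δ` is a regular singularity of `f`: with a common bound `K` for the powers of
logarithms and common finitely generated sets of exponents, each single-valued branch of `f` near
`δ`, with cuts at `ζ_i ∈ ℝ_+`, is the sum of an absolutely convergent series in the powers and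
logarithms of the `ζ_i`. -/
def IsRegularSingularity (A : GL (Fin n) ℂ) (β : Fin n → ℂ) (δ : Fin n → Bool) : Prop :=
  ∃ (K : ℕ) (E : Fin n → Finset ℂ), ∀ F : (Fin n → ℂ) → ℂ,
    (∃ r : Fin n → ℝ, (∀ i, 0 < r i) ∧
      f.IsBranchOn (puncturedPolydisc A β δ r) (fun i z => newVar A β z i) F) →
    ∃ (r : Fin n → ℝ) (α : (∀ i, exponents (E i) (δ i)) × (Fin n → Fin (K + 1)) → ℂ),
      (∀ i, 0 < r i) ∧ ∀ z ∈ puncturedPolydisc A β δ r,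
        HasSum (fun q : (∀ i, exponents (E i) (δ i)) × (Fin n → Fin (K + 1)) =>
          α q * ∏ i, (Complex.exp ((q.1 i : ℂ) * lBranch 0 (newVar A β z i)) *
            lBranch 0 (newVar A β z i) ^ (q.2 i : ℕ))) (F z)

end MultiFun

/-- `M^n`: the points of `ℂ^n` with nonzero and pairwise distinct coordinates. -/
def Mspace (n : ℕ) : Set (Fin n → ℂ) :=
  {z | (∀ i, z i ≠ 0) ∧ ∀ i j, i ≠ j → z i ≠ z j}

/-- The functions `z₁`, `z₂`, `z₁ - z₂` defining the cuts of `M^2_0`. -/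
def cutsM2 : Fin 3 → (Fin 2 → ℂ) → ℂ :=
  ![fun z => z 0, fun z => z 1, fun z => z 0 - z 1]

/-! ## Twisted intertwining operators -/

section Intertwining

variable {V : Type u} [AddCommGroup V] [Module ℂ V] {𝒱 : VOA V}

/-- `Y(u₁, z₁) π_{n₁} Y(u₂, z₂) π_{n₂} ⋯ Y(u_r, z_r) π_{n_r} y` for `y` in the completion. -/
def nestedProd (W : VData.{u, w} 𝒱) : (r : ℕ) → (Fin r → V) → (Fin r → ℂ) → (Fin r → ℂ) →
    W.Completion → W.Completion
  | 0, _, _, _, y => y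
  | r + 1, a, z, n, y => W.eval (lBranch 0 (z 0)) (W.Y (a 0)
      (nestedProd W r (Fin.tail a) (Fin.tail z) (Fin.tail n) y (n 0)))

/-- `𝒴` is a twisted intertwining operator of type `(W₃; W₁ W₂)`; `𝒴 x₁ x₂ n k` is the coefficient
of `x ^ (-n - 1) (log x) ^ k` in `𝒴(x₁, x) x₂`. -/
structure IsTwistedIntertwiningOperator (W₁ W₂ W₃ : VData.{u, w} 𝒱)
    (𝒴 : W₁ →ₗ[ℂ] W₂ →ₗ[ℂ] LogSeries W₃) : Prop where
  /-- the weights of the coefficients, by which `𝒴(x₁, z) x₂` lies in the completion of `W₃` -/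
  homog : ∀ (m₁ m₂ : ℂ), ∀ x₁ ∈ W₁.wt m₁, ∀ x₂ ∈ W₂.wt m₂, ∀ (n : ℂ) (k : ℕ),
    𝒴 x₁ x₂ n k ∈ W₃.wt (m₁ + m₂ - n - 1)
  /-- the coefficient of each power of `x` is a polynomial in `log x` -/
  log_finite : ∀ (x₁ : W₁) (x₂ : W₂) (n : ℂ), ∃ K : ℕ, ∀ k : ℕ, K < k → 𝒴 x₁ x₂ n k = 0
  lower_truncation : ∀ (x₁ : W₁) (x₂ : W₂) (n : ℂ) (k : ℕ),
    ∃ N : ℕ, ∀ l : ℕ, N ≤ l → 𝒴 x₁ x₂ (n + l) k = 0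
  duality : ∀ (a : V) (x₁ : W₁) (x₂ : W₂) (φ : W₃.gdual),
    ∃ (f : MultiFun 2 (Mspace 2)) (F : (Fin 2 → ℂ) → ℂ),
      f.IsBranchOn (Mspace 2) cutsM2 F ∧ ∀ z₁ z₂ : ℂ,
      (‖z₂‖ < ‖z₁‖ → 0 < ‖z₂‖ →
        Summable (fun r : ℂ => W₃.pairing φ (W₃.eval (lBranch 0 z₁)
          (W₃.Y a (W₃.eval (lBranch 0 z₂) (𝒴 x₁ x₂) r)))) ∧
        (|argPos (z₁ - z₂) - argPos z₁| < Real.pi / 2 →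
          ∑' r : ℂ, W₃.pairing φ (W₃.eval (lBranch 0 z₁)
            (W₃.Y a (W₃.eval (lBranch 0 z₂) (𝒴 x₁ x₂) r))) = F ![z₁, z₂])) ∧
      (‖z₁‖ < ‖z₂‖ → 0 < ‖z₁‖ →
        Summable (fun r : ℂ => W₃.pairing φ (W₃.eval (lBranch 0 z₂)
          (𝒴 x₁ (W₂.eval (lBranch 0 z₁) (W₂.Y a x₂) r)))) ∧
        (-(3 * Real.pi / 2) < argPos (z₁ - z₂) - argPos z₂ →
          argPos (z₁ - z₂) - argPos z₂ < -(Real.pi / 2) →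
          ∑' r : ℂ, W₃.pairing φ (W₃.eval (lBranch 0 z₂)
            (𝒴 x₁ (W₂.eval (lBranch 0 z₁) (W₂.Y a x₂) r))) = F ![z₁, z₂])) ∧
      (‖z₁ - z₂‖ < ‖z₂‖ → 0 < ‖z₁ - z₂‖ →
        Summable (fun r : ℂ => W₃.pairing φ (W₃.eval (lBranch 0 z₂)
          (𝒴 (W₁.eval (lBranch 0 (z₁ - z₂)) (W₁.Y a x₁) r) x₂))) ∧
        (|argPos z₁ - argPos z₂| < Real.pi / 2 →
          ∑' r : ℂ, W₃.pairing φ (W₃.eval (lBranch 0 z₂)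
            (𝒴 (W₁.eval (lBranch 0 (z₁ - z₂)) (W₁.Y a x₁) r) x₂)) = F ![z₁, z₂]))
  products : ∀ (r : ℕ), 2 ≤ r → ∀ (a : Fin r → V) (x₁ : W₁) (x₂ : W₂) (φ : W₃.gdual),
    (∀ z : Fin (r + 1) → ℂ, StrictAnti (fun i => ‖z i‖) → 0 < ‖z (Fin.last r)‖ →
      Summable fun n : Fin r → ℂ => W₃.pairing φ
        (nestedProd W₃ r a (Fin.init z) n (W₃.eval (lBranch 0 (z (Fin.last r))) (𝒴 x₁ x₂)))) ∧
    ∃ f : MultiFun (r + 1) (Mspace (r + 1)),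
      f.IsBranchOn {z | StrictAnti (fun i => ‖z i‖) ∧ 0 < ‖z (Fin.last r)‖} (fun i z => z i)
        (fun z => ∑' n : Fin r → ℂ, W₃.pairing φ (nestedProd W₃ r a (Fin.init z) n
          (W₃.eval (lBranch 0 (z (Fin.last r))) (𝒴 x₁ x₂)))) ∧
      ∀ (A : GL (Fin (r + 1)) ℂ) (β : Fin (r + 1) → ℂ) (δ : Fin (r + 1) → Bool),
        MultiFun.IsComponentIsolated (Mspace (r + 1)) A β δ → f.IsRegularSingularity A β δ
  L_neg_one_derivative : ∀ (x₁ : W₁) (x₂ : W₂) (n : ℂ) (k : ℕ),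
    𝒴 (W₁.L (-1) x₁) x₂ n k =
      -n • 𝒴 x₁ x₂ (n - 1) k + ((k : ℂ) + 1) • 𝒴 x₁ x₂ (n - 1) (k + 1)

/-- `I` is a twisted `P(z)`-intertwining map of type `(W₃; W₁ W₂)`. -/
def IsPzIntertwiningMap (z : ℂ) (W₁ W₂ W₃ : VData.{u, w} 𝒱)
    (I : W₁ ⊗[ℂ] W₂ →ₗ[ℂ] W₃.Completion) : Prop :=
  ∃ 𝒴 : W₁ →ₗ[ℂ] W₂ →ₗ[ℂ] LogSeries W₃, IsTwistedIntertwiningOperator W₁ W₂ W₃ 𝒴 ∧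
    ∀ (x₁ : W₁) (x₂ : W₂), I (x₁ ⊗ₜ[ℂ] x₂) = W₃.eval (lBranch 0 z) (𝒴 x₁ x₂)

end Intertwining

/-! ## Categories of twisted modules and tensor products -/

section Categories

variable {V : Type u} [AddCommGroup V] [Module ℂ V] {𝒱 : VOA V}

/-- A full category of twisted modules, given by its objects: `C g W` means that `W` is a
`g`-twisted module in the category. -/
abbrev TwClass (𝒱 : VOA V) := (V ≃ₗ[ℂ] V) → VData.{u, w} 𝒱 → Prop

/-- A category of twisted modules with `G`-actions, given by its objects. -/
abbrev TwClassWithAction (𝒱 : VOA V) (G : Subgroup (V ≃ₗ[ℂ] V)) :=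
  (g : G) → (W : VData.{u, w} 𝒱) → Representation ℂ G W → Prop

/-- `C` is a category of `g`-twisted `V`-modules without `g`-actions for `g ∈ G`. -/
def IsCategoryWithoutAction (G : Subgroup (V ≃ₗ[ℂ] V)) (C : TwClass.{u, w} 𝒱) : Prop :=
  ∀ g W, C g W → g ∈ G ∧ IsTwistedModule g W

/-- `C` is a category of `g`-twisted `V`-modules with actions of `G` for `g ∈ G`. -/
def IsCategoryWithAction (G : Subgroup (V ≃ₗ[ℂ] V)) (C : TwClassWithAction.{u, w} 𝒱 G) : Prop :=
  ∀ g W ρ, C g W ρ → IsTwistedModule (g : V ≃ₗ[ℂ] V) W ∧ IsGAction g W ρ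

/-- The underlying modules of the objects of a category of modules with `G`-actions: those that
carry an action with which they are objects. Module maps and intertwining maps only involve these
underlying modules. -/
def TwClassWithAction.underlying {G : Subgroup (V ≃ₗ[ℂ] V)} (C : TwClassWithAction.{u, w} 𝒱 G) :
    TwClass.{u, w} 𝒱 :=
  fun g W => ∃ (hg : g ∈ G) (ρ : Representation ℂ G W), C ⟨g, hg⟩ W ρ

/-- `(P, B)` is a `P(z)`-product of `W₁` and `W₂` in `C`. -/
def IsPzProduct (C : TwClass.{u, w} 𝒱) (z : ℂ) (g₁ g₂ : V ≃ₗ[ℂ] V) (W₁ W₂ P : VData.{u, w} 𝒱)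
    (B : W₁ ⊗[ℂ] W₂ →ₗ[ℂ] P.Completion) : Prop :=
  C (g₁ * g₂) P ∧ IsPzIntertwiningMap z W₁ W₂ P B

/-- `(P, B)` is a `P(z)`-tensor product of `W₁` and `W₂` in `C`. The natural extension of `f` to the
completions sends `(y_n)` to `(f y_n)`. -/
def IsPzTensorProduct (C : TwClass.{u, w} 𝒱) (z : ℂ) (g₁ g₂ : V ≃ₗ[ℂ] V)
    (W₁ W₂ P : VData.{u, w} 𝒱) (B : W₁ ⊗[ℂ] W₂ →ₗ[ℂ] P.Completion) : Prop :=
  IsPzProduct C z g₁ g₂ W₁ W₂ P B ∧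
  ∀ (W₃ : VData.{u, w} 𝒱) (I : W₁ ⊗[ℂ] W₂ →ₗ[ℂ] W₃.Completion),
    IsPzProduct C z g₁ g₂ W₁ W₂ W₃ I →
    ∃! f : P →ₗ[ℂ] W₃, IsModuleMap P W₃ f ∧
      ∀ (t : W₁ ⊗[ℂ] W₂) (n : ℂ), f (B t n : P) = (I t n : W₃)

/-- `λ_{I, w₃'}`, the functional `t ↦ ⟨w₃', I(t)⟩`. -/
def lamFun {W₁ W₂ W₃ : VData.{u, w} 𝒱} (I : W₁ ⊗[ℂ] W₂ →ₗ[ℂ] W₃.Completion) (φ : W₃.gdual) :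
    Module.Dual ℂ (W₁ ⊗[ℂ] W₂) :=
  (W₃.pairing φ).comp I

variable (C : TwClass.{u, w} 𝒱) (z : ℂ) (g₁ g₂ : V ≃ₗ[ℂ] V) (W₁ W₂ : VData.{u, w} 𝒱)

/-- The underlying space of `W₁ ⊠̃ W₂`: the span of all `λ_{I, w₃'}`. -/
def hboxSpace : Submodule ℂ (Module.Dual ℂ (W₁ ⊗[ℂ] W₂)) :=
  Submodule.span ℂ {y | ∃ (W₃ : VData.{u, w} 𝒱) (I : W₁ ⊗[ℂ] W₂ →ₗ[ℂ] W₃.Completion)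
    (φ : W₃.gdual), IsPzProduct C z g₁ g₂ W₁ W₂ W₃ I ∧ y = lamFun I φ}

/-- The span of all `λ_{I, w₃'}` with `w₃'` of weight `n`. -/
def hboxWtSpan (n : ℂ) : Submodule ℂ (Module.Dual ℂ (W₁ ⊗[ℂ] W₂)) :=
  Submodule.span ℂ {y | ∃ (W₃ : VData.{u, w} 𝒱) (I : W₁ ⊗[ℂ] W₂ →ₗ[ℂ] W₃.Completion)
    (φ : W₃.gdual), IsPzProduct C z g₁ g₂ W₁ W₂ W₃ I ∧ φ ∈ W₃.contra.wt n ∧ y = lamFun I φ}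

theorem hboxWtSpan_le (n : ℂ) : hboxWtSpan C z g₁ g₂ W₁ W₂ n ≤ hboxSpace C z g₁ g₂ W₁ W₂ := by
  refine Submodule.span_mono ?_
  rintro y ⟨W₃, I, φ, h, _, rfl⟩
  exact ⟨W₃, I, φ, h, rfl⟩

/-- The defining property `Y(v, x) λ_{I, w₃'} = λ_{I, Y'(v, x) w₃'}` of the vertex operator map of
`W₁ ⊠̃ W₂`. It determines the map, since the `λ_{I, w₃'}` span. -/
def IsHboxY (T : V →ₗ[ℂ] hboxSpace C z g₁ g₂ W₁ W₂ →ₗ[ℂ]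
    LogSeries (hboxSpace C z g₁ g₂ W₁ W₂)) : Prop :=
  ∀ (W₃ : VData.{u, w} 𝒱) (I : W₁ ⊗[ℂ] W₂ →ₗ[ℂ] W₃.Completion) (φ : W₃.gdual),
    IsPzProduct C z g₁ g₂ W₁ W₂ W₃ I →
    ∀ y : hboxSpace C z g₁ g₂ W₁ W₂, (y : Module.Dual ℂ (W₁ ⊗[ℂ] W₂)) = lamFun I φ →
    ∀ (v : V) (n : ℂ) (k : ℕ),
      (T v y n k : Module.Dual ℂ (W₁ ⊗[ℂ] W₂)) = lamFun I (W₃.contraY v φ n k)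

open Classical in
/-- The vertex operator map of `W₁ ⊠̃ W₂`. (The value `0` where no map has the defining property is
never that of a nonzero twisted module, by the identity property.) -/
def hboxY : V →ₗ[ℂ] hboxSpace C z g₁ g₂ W₁ W₂ →ₗ[ℂ] LogSeries (hboxSpace C z g₁ g₂ W₁ W₂) :=
  if h : ∃ T, IsHboxY C z g₁ g₂ W₁ W₂ T then Classical.choose h else 0

/-- `W₁ ⊠̃_{P(z)} W₂`. -/
def hbox : VData.{u, w} 𝒱 where
  carrier := hboxSpace C z g₁ g₂ W₁ W₂
  wt n := (hboxWtSpan C z g₁ g₂ W₁ W₂ n).comap (hboxSpace C z g₁ g₂ W₁ W₂).subtype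
  Y := hboxY C z g₁ g₂ W₁ W₂
  homog := by
    intro h v hv m x hx n k
    unfold hboxY
    split_ifs with hT
    · have hT' := Classical.choose_spec hT
      set T := Classical.choose hT
      have key : ∀ y (hy : y ∈ hboxWtSpan C z g₁ g₂ W₁ W₂ m),
          (T v ⟨y, hboxWtSpan_le C z g₁ g₂ W₁ W₂ m hy⟩ n k : Module.Dual ℂ (W₁ ⊗[ℂ] W₂)) ∈
            hboxWtSpan C z g₁ g₂ W₁ W₂ (m + h - n - 1) := by
        intro y hy
        induction hy using Submodule.span_induction with
        | mem y hy =>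
          obtain ⟨W₃, I, φ, hI, hφ, rfl⟩ := hy
          rw [hT' W₃ I φ hI _ rfl v n k]
          exact Submodule.subset_span
            ⟨W₃, I, _, hI, W₃.contra.homog h v hv m φ hφ n k, rfl⟩
        | zero =>
          have : (T v ⟨0, hboxWtSpan_le C z g₁ g₂ W₁ W₂ m (zero_mem _)⟩ n k) = 0 := by
            change T v 0 n k = 0
            simp
          rw [this]; exact zero_mem _
        | add a b ha hb iha ihb =>
          have : T v ⟨a + b, hboxWtSpan_le C z g₁ g₂ W₁ W₂ m (add_mem ha hb)⟩ n k =
              T v ⟨a, hboxWtSpan_le C z g₁ g₂ W₁ W₂ m ha⟩ n k +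
              T v ⟨b, hboxWtSpan_le C z g₁ g₂ W₁ W₂ m hb⟩ n k := by
            rw [← Pi.add_apply, ← Pi.add_apply, ← map_add]; rfl
          rw [this]; exact add_mem iha ihb
        | smul c a ha iha =>
          have : T v ⟨c • a, hboxWtSpan_le C z g₁ g₂ W₁ W₂ m (Submodule.smul_mem _ c ha)⟩ n k =
              c • T v ⟨a, hboxWtSpan_le C z g₁ g₂ W₁ W₂ m ha⟩ n k := by
            rw [← Pi.smul_apply, ← Pi.smul_apply, ← map_smul]; rfl
          rw [this]; exact Submodule.smul_mem _ c iha
      exact key x hx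
    · exact zero_mem _

/-- The assumption on the category `C`: closure under `⊠̃_{P(z)}`, closure under contragredients, and
equivalence of each object with its double contragredient. -/
structure TensorAssumption (C : TwClass.{u, w} 𝒱) (z : ℂ) : Prop where
  hbox_mem : ∀ (g₁ g₂ : V ≃ₗ[ℂ] V) (W₁ W₂ : VData.{u, w} 𝒱), C g₁ W₁ → C g₂ W₂ →
    C (g₁ * g₂)⁻¹ (hbox C z g₁ g₂ W₁ W₂)
  contra_mem : ∀ (g : V ≃ₗ[ℂ] V) (W : VData.{u, w} 𝒱), C g W → C g⁻¹ W.contra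
  double_contra : ∀ (g : V ≃ₗ[ℂ] V) (W : VData.{u, w} 𝒱), C g W →
    IsEquivalent W W.contra.contra

/-- `W₁ ⊠_{P(z)} W₂`, the contragredient of `W₁ ⊠̃_{P(z)} W₂`. -/
def boxProd : VData.{u, w} 𝒱 := (hbox C z g₁ g₂ W₁ W₂).contra

/-- The functional `λ ↦ (π_n λ)(t)` on `W₁ ⊠̃ W₂`. -/
def boxFun (n : ℂ) (t : W₁ ⊗[ℂ] W₂) : Module.Dual ℂ (hbox C z g₁ g₂ W₁ W₂) :=
  ((Module.Dual.eval ℂ (W₁ ⊗[ℂ] W₂) t).comp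
    ((hboxSpace C z g₁ g₂ W₁ W₂).subtype.comp ((hbox C z g₁ g₂ W₁ W₂).wt n).subtype)).comp
      ((hbox C z g₁ g₂ W₁ W₂).proj n)

theorem boxFun_mem (n : ℂ) (t : W₁ ⊗[ℂ] W₂) :
    boxFun C z g₁ g₂ W₁ W₂ n t ∈ (hbox C z g₁ g₂ W₁ W₂).dualWt n := by
  intro m hm x hx
  have := (hbox C z g₁ g₂ W₁ W₂).proj_of_ne hm x hx
  rw [boxFun, LinearMap.comp_apply, this, map_zero]

/-- The canonical map `⊠_{P(z)}` from `W₁ ⊗ W₂` to the completion of `W₁ ⊠_{P(z)} W₂`: its component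
of weight `n` is the functional `λ ↦ λ(t)` on the weight space of `W₁ ⊠̃_{P(z)} W₂` of weight `n`, so
that `⟨λ, ⊠_{P(z)}(t)⟩ = λ(t)` for all `λ`. -/
def boxMap : W₁ ⊗[ℂ] W₂ →ₗ[ℂ] (boxProd C z g₁ g₂ W₁ W₂).Completion where
  toFun t n := ⟨⟨boxFun C z g₁ g₂ W₁ W₂ n t,
    Submodule.mem_iSup_of_mem n (boxFun_mem C z g₁ g₂ W₁ W₂ n t)⟩,
    boxFun_mem C z g₁ g₂ W₁ W₂ n t⟩
  map_add' s t := by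
    funext n
    apply Subtype.ext
    apply Subtype.ext
    apply LinearMap.ext
    intro x
    simp only [boxFun, map_add]
    rfl
  map_smul' c t := by
    funext n
    apply Subtype.ext
    apply Subtype.ext
    apply LinearMap.ext
    intro x
    simp only [boxFun, map_smul]
    rfl

end Categories

end

/-!
Write `X` for `W₁ ⊠̃ W₂`. A `P(z)`-product `(W₃, I)` gives the graded module map `w₃' ↦ λ_{I, w₃'}`
from `W₃'` to `X`. Weight spaces of objects of `C` are finite-dimensional, because the objects are
equivalent to their double contragredients, so this map is the transpose of a module map from
`X' = W₁ ⊠ W₂` to `W₃`, through which `I` factors. It is unique because `W₁ ⊗ W₂` separates the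
points of each weight space of `X`.

The main point is that the canonical map to the completion of `X'` is itself an intertwining map. A
polynomial in `log x` times a power of `x` is determined by its derivatives at `z`, and the
`L(-1)`-derivative property expresses the derivatives of an intertwining operator through its values
at `z`. Hence the coefficients of the required operator with values in `X'` are determined by `X` as
a space of functionals on `W₁ ⊗ W₂`. Every functional on `X'` is a sum of functionals pulled back
from the `W₃`. Duality and the convergence of products pass to pullbacks. They pass to sums because
two multivalued functions can be continued simultaneously from a common base point. On the regions
in question every point is reached from the base point by paths that avoid the cuts, and by the
monodromy principle the sum of the preferred branches is a branch of the sum.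
-/

section Continuation

variable {T S E F : Type*} [TopologicalSpace T] [TopologicalSpace S]
  [NormedAddCommGroup E] [NormedSpace ℂ E] [NormedAddCommGroup F] [NormedSpace ℂ F]

/-- A locally constant family of analytic germs over the points `γ t`. Over `unitInterval` this is
an analytic continuation along the path `γ`; other parameter spaces serve to vary the path. -/
structure IsGermFamily (γ : C(T, E)) (Φ : T → E → F) : Prop where
  analyticAt : ∀ t, AnalyticAt ℂ (Φ t) (γ t)
  locally_const : ∀ t, ∀ᶠ s in 𝓝 t, Φ s =ᶠ[𝓝 (γ s)] Φ t

theorem isContinuationAlong_iff {n : ℕ} {γ : C(unitInterval, Fin n → ℂ)}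
    {φ ψ : (Fin n → ℂ) → ℂ} :
    IsContinuationAlong γ φ ψ ↔
      ∃ Φ, IsGermFamily γ Φ ∧ Φ 0 =ᶠ[𝓝 (γ 0)] φ ∧ Φ 1 =ᶠ[𝓝 (γ 1)] ψ :=
  ⟨fun ⟨Φ, analytic, const, h₀, h₁⟩ => ⟨Φ, ⟨analytic, const⟩, h₀, h₁⟩,
    fun ⟨Φ, hΦ, h₀, h₁⟩ => ⟨Φ, hΦ.analyticAt, hΦ.locally_const, h₀, h₁⟩⟩

theorem eventually_eventuallyEq_iff_of_analyticAt [CompleteSpace F] {φ ψ : E → F} {z : E}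
    (hφ : AnalyticAt ℂ φ z) (hψ : AnalyticAt ℂ ψ z) :
    ∀ᶠ y in 𝓝 z, (φ =ᶠ[𝓝 y] ψ ↔ φ =ᶠ[𝓝 z] ψ) := by
  obtain ⟨r, hr, analytic⟩ := Metric.eventually_nhds_iff_ball.mp
    (hφ.eventually_analyticAt.and hψ.eventually_analyticAt)
  have eqOn_ball {y : E} (hy : y ∈ Metric.ball z r) (h : φ =ᶠ[𝓝 y] ψ) :
      Set.EqOn φ ψ (Metric.ball z r) :=
    AnalyticOnNhd.eqOn_of_preconnected_of_eventuallyEq (fun x hx => (analytic x hx).1)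
      (fun x hx => (analytic x hx).2) (Metric.isPreconnected_ball) hy h
  filter_upwards [Metric.ball_mem_nhds z hr] with y hy
  exact ⟨fun h => (eqOn_ball hy h).eventuallyEq_of_mem (Metric.ball_mem_nhds z hr),
    fun h => (eqOn_ball (Metric.mem_ball_self hr) h).eventuallyEq_of_mem
      (Metric.isOpen_ball.mem_nhds hy)⟩

namespace IsGermFamily

variable {γ γ' δ : C(T, E)} {Φ Ψ : T → E → F}

theorem comp (hΦ : IsGermFamily γ Φ) (h : C(S, T)) : IsGermFamily (γ.comp h) (Φ ∘ h) where
  analyticAt s := hΦ.analyticAt (h s)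
  locally_const s := h.continuous.continuousAt.eventually (hΦ.locally_const (h s))

theorem const {φ : E → F} (hφ : ∀ t, AnalyticAt ℂ φ (γ t)) : IsGermFamily γ fun _ => φ where
  analyticAt := hφ
  locally_const _ := .of_forall fun _ => .rfl

theorem congr (hΦ : IsGermFamily γ Φ) (h : ∀ t, Φ t =ᶠ[𝓝 (γ t)] Ψ t) : IsGermFamily γ Ψ where
  analyticAt t := (hΦ.analyticAt t).congr (h t)
  locally_const t := by
    filter_upwards [hΦ.locally_const t,
      γ.continuous.continuousAt.eventually (h t).eventuallyEq_nhds] with s hs hs'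
    exact (h s).symm.trans (hs.trans hs')

theorem add (hΦ : IsGermFamily γ Φ) (hΨ : IsGermFamily γ Ψ) : IsGermFamily γ (Φ + Ψ) where
  analyticAt t := (hΦ.analyticAt t).add (hΨ.analyticAt t)
  locally_const t := by
    filter_upwards [hΦ.locally_const t, hΨ.locally_const t] with s hs hs' using hs.add hs'

theorem if_le {f g : T → ℝ} (hf : Continuous f) (hg : Continuous g) (hΦ : IsGermFamily γ Φ)
    (hΨ : IsGermFamily γ' Ψ) (hle : ∀ t, f t ≤ g t → δ t = γ t)
    (hge : ∀ t, g t ≤ f t → δ t = γ' t) (heq : ∀ t, f t = g t → Φ t =ᶠ[𝓝 (δ t)] Ψ t) :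
    IsGermFamily δ fun t => if f t ≤ g t then Φ t else Ψ t where
  analyticAt t := by
    split_ifs with h
    · exact hle t h ▸ hΦ.analyticAt t
    · exact hge t (not_le.mp h).le ▸ hΨ.analyticAt t
  locally_const t := by
    have constΦ := hΦ.locally_const t
    have constΨ := hΨ.locally_const t
    rcases lt_trichotomy (f t) (g t) with ht | ht | ht
    · filter_upwards [constΦ, hf.continuousAt.eventually_lt hg.continuousAt ht] with s hs hs'
      rwa [if_pos ht.le, if_pos hs'.le, hle s hs'.le]
    · filter_upwards [constΦ, constΨ,
        δ.continuous.continuousAt.eventually (heq t ht).eventuallyEq_nhds] with s hsΦ hsΨ hs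
      rw [if_pos ht.le]
      split_ifs with h
      · rwa [hle s h]
      · exact (hge s (not_le.mp h).le ▸ hsΨ).trans hs.symm
    · filter_upwards [constΨ, hg.continuousAt.eventually_lt hf.continuousAt ht] with s hs hs'
      rwa [if_neg ht.not_ge, if_neg hs'.not_ge, hge s hs'.le]

variable [CompleteSpace F]

theorem eventuallyEq [PreconnectedSpace T] (hΦ : IsGermFamily γ Φ) (hΨ : IsGermFamily γ Ψ) {t₀ : T}
    (h₀ : Φ t₀ =ᶠ[𝓝 (γ t₀)] Ψ t₀) (t : T) : Φ t =ᶠ[𝓝 (γ t)] Ψ t := by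
  have locallyConstant : IsLocallyConstant fun t => Φ t =ᶠ[𝓝 (γ t)] Ψ t := by
    rw [IsLocallyConstant.iff_eventually_eq]
    intro t
    filter_upwards [hΦ.locally_const t, hΨ.locally_const t, γ.continuous.continuousAt.eventually
      (eventually_eventuallyEq_iff_of_analyticAt (hΦ.analyticAt t) (hΨ.analyticAt t))]
      with s hsΦ hsΨ hs
    exact propext ⟨fun h => hs.mp (hsΦ.symm.trans (h.trans hsΨ)),
      fun h => hsΦ.trans ((hs.mpr h).trans hsΨ.symm)⟩
  exact (locallyConstant.apply_eq_of_preconnectedSpace t t₀).mpr h₀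

theorem eventuallyEq_of_isPreconnected (hΦ : IsGermFamily γ Φ) {φ : E → F} {J : Set T}
    (hJ : IsPreconnected J) (hφ : ∀ t ∈ J, AnalyticAt ℂ φ (γ t)) {s t : T} (hs : s ∈ J)
    (ht : t ∈ J) (h : Φ s =ᶠ[𝓝 (γ s)] φ) : Φ t =ᶠ[𝓝 (γ t)] φ := by
  have := isPreconnected_iff_preconnectedSpace.mp hJ
  let incl : C(J, T) := ⟨Subtype.val, continuous_subtype_val⟩
  exact (hΦ.comp incl).eventuallyEq (const (γ := γ.comp incl) fun t => hφ t t.2)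
    (t₀ := ⟨s, hs⟩) h ⟨t, ht⟩

theorem exists_isPreconnected_eventually [LocallyConnectedSpace T] {Γ : C(S × T, E)}
    {Φ : S × T → E → F} (hΦ : ∀ s, IsGermFamily (Γ.comp (.prodMk (.const T s) (.id T)))
      fun t => Φ (s, t))
    (s₀ : S) (t₀ : T) :
    ∃ J ∈ 𝓝 t₀, ∀ᶠ s in 𝓝 s₀, ∀ t ∈ J, ∀ t' ∈ J,
      Φ (s, t) =ᶠ[𝓝 (Γ (s, t))] Φ (s₀, t₀) → Φ (s, t') =ᶠ[𝓝 (Γ (s, t'))] Φ (s₀, t₀) := by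
  have analytic : ∀ᶠ p in 𝓝 s₀ ×ˢ 𝓝 t₀, AnalyticAt ℂ (Φ (s₀, t₀)) (Γ p) := by
    rw [← nhds_prod_eq]
    exact Γ.continuous.continuousAt.eventually ((hΦ s₀).analyticAt t₀).eventually_analyticAt
  obtain ⟨N, hN, P, hP, hNP⟩ := Filter.mem_prod_iff.mp analytic
  obtain ⟨J, hJ, hJconn, hJP⟩ := locallyConnectedSpace_iff_connected_subsets.mp ‹_› t₀ P hP
  refine ⟨J, hJ, ?_⟩
  filter_upwards [hN] with s hs t ht t' ht'
  exact (hΦ s).eventuallyEq_of_isPreconnected hJconn (fun r hr => hNP ⟨hs, hJP hr⟩) ht ht'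

/-- The monodromy principle: since continuation is locally constant and unique, the parameters `t`
near which the family is locally constant transversally to the slices form a clopen set. -/
theorem of_slices [PreconnectedSpace T] [LocallyConnectedSpace T] {Γ : C(S × T, E)}
    {Φ : S × T → E → F} (t₀ : T)
    (h₀ : IsGermFamily (Γ.comp (.prodMk (.id S) (.const S t₀))) fun s => Φ (s, t₀))
    (hΦ : ∀ s, IsGermFamily (Γ.comp (.prodMk (.const T s) (.id T))) fun t => Φ (s, t)) :
    IsGermFamily Γ Φ where
  analyticAt p := (hΦ p.1).analyticAt p.2
  locally_const := by
    rintro ⟨s₀, t⟩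
    let ConstAt (t : T) : Prop := ∀ᶠ s in 𝓝 s₀, Φ (s, t) =ᶠ[𝓝 (Γ (s, t))] Φ (s₀, t)
    have locallyConstant : IsLocallyConstant ConstAt := by
      rw [IsLocallyConstant.iff_eventually_eq]
      intro t
      obtain ⟨J, hJ, transfer⟩ := exists_isPreconnected_eventually hΦ s₀ t
      filter_upwards [hJ, (hΦ s₀).locally_const t] with t' ht' hs₀
      have hs₀' : ∀ᶠ s in 𝓝 s₀, Φ (s₀, t') =ᶠ[𝓝 (Γ (s, t'))] Φ (s₀, t) :=
        (Γ.continuous.comp (.prodMk_left t')).continuousAt.eventually hs₀.eventuallyEq_nhds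
      refine propext ⟨fun h => ?_, fun h => ?_⟩
      · filter_upwards [transfer, h, hs₀'] with s hs h h'
        exact hs t' ht' t (mem_of_mem_nhds hJ) (h.trans h')
      · filter_upwards [transfer, h, hs₀'] with s hs h h'
        exact (hs t (mem_of_mem_nhds hJ) t' ht' h).trans h'.symm
    have constAt : ConstAt t :=
      (locallyConstant.apply_eq_of_preconnectedSpace t t₀).mpr (h₀.locally_const s₀)
    obtain ⟨J, hJ, transfer⟩ := exists_isPreconnected_eventually hΦ s₀ t
    rw [nhds_prod_eq]
    filter_upwards [(transfer.and constAt).prod_mk hJ] with p hp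
    exact hp.1.1 t (mem_of_mem_nhds hJ) p.2 hp.2 hp.1.2

end IsGermFamily

theorem locallyConnectedSpace_unitInterval : LocallyConnectedSpace unitInterval :=
  (isQuotientMap_projIcc (h := zero_le_one)).isCoinducing.locallyConnectedSpace

namespace IsContinuationAlong

variable {n : ℕ} {γ : C(unitInterval, Fin n → ℂ)} {x y z : Fin n → ℂ} {p : Path x y} {q : Path y z}
  {φ φ' ψ ψ' χ : (Fin n → ℂ) → ℂ}

theorem analyticAt_right (h : IsContinuationAlong γ φ ψ) : AnalyticAt ℂ ψ (γ 1) := by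
  obtain ⟨Φ, analytic, -, -, h₁⟩ := h
  exact (analytic 1).congr h₁

theorem congr (h : IsContinuationAlong γ φ ψ) (hφ : φ =ᶠ[𝓝 (γ 0)] φ')
    (hψ : ψ =ᶠ[𝓝 (γ 1)] ψ') : IsContinuationAlong γ φ' ψ' := by
  obtain ⟨Φ, analytic, const, h₀, h₁⟩ := h
  exact ⟨Φ, analytic, const, h₀.trans hφ, h₁.trans hψ⟩

theorem unique (h : IsContinuationAlong γ φ ψ) (h' : IsContinuationAlong γ φ' ψ')
    (hφ : φ =ᶠ[𝓝 (γ 0)] φ') : ψ =ᶠ[𝓝 (γ 1)] ψ' := by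
  obtain ⟨Φ, hΦ, hΦ₀, hΦ₁⟩ := isContinuationAlong_iff.mp h
  obtain ⟨Ψ, hΨ, hΨ₀, hΨ₁⟩ := isContinuationAlong_iff.mp h'
  exact hΦ₁.symm.trans ((hΦ.eventuallyEq hΨ (hΦ₀.trans (hφ.trans hΨ₀.symm)) 1).trans hΨ₁)

theorem add (h : IsContinuationAlong γ φ ψ) (h' : IsContinuationAlong γ φ' ψ') :
    IsContinuationAlong γ (φ + φ') (ψ + ψ') := by
  obtain ⟨Φ, hΦ, hΦ₀, hΦ₁⟩ := isContinuationAlong_iff.mp h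
  obtain ⟨Ψ, hΨ, hΨ₀, hΨ₁⟩ := isContinuationAlong_iff.mp h'
  exact isContinuationAlong_iff.mpr ⟨_, hΦ.add hΨ, hΦ₀.add hΨ₀, hΦ₁.add hΨ₁⟩

theorem zero (γ : C(unitInterval, Fin n → ℂ)) : IsContinuationAlong γ 0 0 :=
  isContinuationAlong_iff.mpr ⟨_, .const fun _ => analyticAt_const, .rfl, .rfl⟩

theorem symm (h : IsContinuationAlong p φ ψ) : IsContinuationAlong p.symm ψ φ := by
  obtain ⟨Φ, hΦ, h₀, h₁⟩ := isContinuationAlong_iff.mp h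
  refine isContinuationAlong_iff.mpr
    ⟨_, hΦ.comp ⟨unitInterval.symm, unitInterval.continuous_symm⟩, ?_, ?_⟩
  · simpa using h₁
  · simpa using h₀

theorem trans (hp : IsContinuationAlong p φ ψ) (hq : IsContinuationAlong q ψ χ) :
    IsContinuationAlong (p.trans q) φ χ := by
  obtain ⟨Φ, hΦ, hΦ₀, hΦ₁⟩ := isContinuationAlong_iff.mp hp
  obtain ⟨Ψ, hΨ, hΨ₀, hΨ₁⟩ := isContinuationAlong_iff.mp hq
  let double : C(unitInterval, unitInterval) :=
    ⟨fun t => Set.projIcc 0 1 zero_le_one (2 * (t : ℝ)), by fun_prop⟩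
  let doubleSubOne : C(unitInterval, unitInterval) :=
    ⟨fun t => Set.projIcc 0 1 zero_le_one (2 * (t : ℝ) - 1), by fun_prop⟩
  have double_zero : double 0 = 0 := Set.projIcc_of_le_left zero_le_one (by simp)
  have doubleSubOne_one : doubleSubOne 1 = 1 := Set.projIcc_of_right_le zero_le_one (by norm_num)
  have trans_of_le (t : unitInterval) (ht : (t : ℝ) ≤ 1 / 2) : p.trans q t = p (double t) := by
    rw [← Path.extend_extends' (p.trans q) t, Path.extend_trans_of_le_half _ _ ht]; rfl
  have trans_of_ge (t : unitInterval) (ht : 1 / 2 ≤ (t : ℝ)) :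
      p.trans q t = q (doubleSubOne t) := by
    rw [← Path.extend_extends' (p.trans q) t, Path.extend_trans_of_half_le _ _ ht]; rfl
  have agree (t : unitInterval) (ht : (t : ℝ) = 1 / 2) :
      Φ (double t) =ᶠ[𝓝 (p.trans q t)] Ψ (doubleSubOne t) := by
    have double_half : double t = 1 := Set.projIcc_of_right_le zero_le_one (by linarith)
    have doubleSubOne_half : doubleSubOne t = 0 := Set.projIcc_of_le_left zero_le_one (by linarith)
    rw [trans_of_le t ht.le, double_half, doubleSubOne_half, p.target]
    simp only [ContinuousMap.coe_coe, p.target, q.source] at hΦ₁ hΨ₀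
    exact hΦ₁.trans hΨ₀.symm
  refine isContinuationAlong_iff.mpr ⟨_, IsGermFamily.if_le (δ := (p.trans q).toContinuousMap)
    continuous_subtype_val continuous_const (hΦ.comp double) (hΨ.comp doubleSubOne)
    trans_of_le trans_of_ge agree, ?_, ?_⟩
  · simpa [double_zero] using hΦ₀
  · have : ¬ (1 : ℝ) ≤ 2⁻¹ := by norm_num
    simpa [doubleSubOne_one, this] using hΨ₁

theorem of_trans (hp : IsContinuationAlong p φ ψ) (h : IsContinuationAlong (p.trans q) φ χ) :
    IsContinuationAlong q ψ χ := by
  obtain ⟨Φ, hΦ, hΦ₀, hΦ₁⟩ := isContinuationAlong_iff.mp h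
  let half : C(unitInterval, unitInterval) :=
    ⟨fun t => ⟨(t : ℝ) / 2, by grind, by grind⟩, by fun_prop⟩
  let halfAdd : C(unitInterval, unitInterval) :=
    ⟨fun t => ⟨((t : ℝ) + 1) / 2, by grind, by grind⟩, by fun_prop⟩
  have half_zero : half 0 = 0 := Subtype.ext (zero_div 2)
  have half_one : half 1 = halfAdd 0 := Subtype.ext (by simp [half, halfAdd])
  have halfAdd_one : halfAdd 1 = 1 := Subtype.ext (by norm_num [halfAdd])
  have comp_half : (p.trans q).toContinuousMap.comp half = p.toContinuousMap := by
    ext1 t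
    have two_mul_half : 2 * (half t : ℝ) = t := mul_div_cancel₀ _ two_ne_zero
    change p.trans q (half t) = p t
    rw [← Path.extend_extends' (p.trans q),
      Path.extend_trans_of_le_half _ _ (by linarith [t.2.2]), two_mul_half, Path.extend_extends']
  have comp_halfAdd : (p.trans q).toContinuousMap.comp halfAdd = q.toContinuousMap := by
    ext1 t
    have two_mul_halfAdd : 2 * (halfAdd t : ℝ) = t + 1 := mul_div_cancel₀ _ two_ne_zero
    change p.trans q (halfAdd t) = q t
    rw [← Path.extend_extends' (p.trans q),
      Path.extend_trans_of_half_le _ _ (by linarith [t.2.1]), two_mul_halfAdd, add_sub_cancel_right,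
      Path.extend_extends']
  have hΦp := comp_half ▸ hΦ.comp half
  have hΦq := comp_halfAdd ▸ hΦ.comp halfAdd
  have middle : Φ (halfAdd 0) =ᶠ[𝓝 y] ψ := by
    have hp' : IsContinuationAlong p φ (Φ (halfAdd 0)) :=
      isContinuationAlong_iff.mpr ⟨_, hΦp, by simpa [half_zero] using hΦ₀, by simp [half_one]⟩
    simpa using hp'.unique hp .rfl
  refine isContinuationAlong_iff.mpr ⟨_, hΦq, by simpa using middle, ?_⟩
  simpa [halfAdd_one] using hΦ₁

end IsContinuationAlong

end Continuation

namespace MultiFun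

variable {n : ℕ} {Ω : Set (Fin n → ℂ)} {f : MultiFun n Ω} {b z : Fin n → ℂ}
  {φ ψ : (Fin n → ℂ) → ℂ} {ι : Type*} {R : Set (Fin n → ℂ)} {c : ι → (Fin n → ℂ) → ℂ}

theorem isGermAt_iff :
    f.IsGermAt z ψ ↔ ∃ γ : Path f.base z, (∀ t, γ t ∈ Ω) ∧ IsContinuationAlong γ f.germ ψ :=
  ⟨fun ⟨γ, h₀, h₁, mem, h⟩ => ⟨⟨γ, h₀, h₁⟩, mem, h⟩,
    fun ⟨γ, mem, h⟩ => ⟨γ, γ.source, γ.target, mem, h⟩⟩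

namespace IsGermAt

theorem mem (h : f.IsGermAt z ψ) : z ∈ Ω := by
  obtain ⟨γ, mem, -⟩ := isGermAt_iff.mp h
  simpa using mem 1

theorem analyticAt (h : f.IsGermAt z ψ) : AnalyticAt ℂ ψ z := by
  obtain ⟨γ, -, hγ⟩ := isGermAt_iff.mp h
  simpa using hγ.analyticAt_right

theorem congr (h : f.IsGermAt z φ) (hφ : φ =ᶠ[𝓝 z] ψ) : f.IsGermAt z ψ := by
  obtain ⟨γ, mem, hγ⟩ := isGermAt_iff.mp h
  exact isGermAt_iff.mpr ⟨γ, mem, hγ.congr .rfl (by simpa using hφ)⟩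

end IsGermAt

theorem path_trans_mem {x y : Fin n → ℂ} {p : Path x y} {q : Path y z} (hp : ∀ t, p t ∈ Ω)
    (hq : ∀ t, q t ∈ Ω) (t : unitInterval) : p.trans q t ∈ Ω := by
  have range_subset : Set.range (p.trans q) ⊆ Ω := by
    rw [Path.trans_range]
    exact Set.union_subset (Set.range_subset_iff.mpr hp) (Set.range_subset_iff.mpr hq)
  exact range_subset ⟨t, rfl⟩

/-- The multivalued function `f` with one of its germs at `b` as initial germ. -/
noncomputable def rebase (f : MultiFun n Ω) (b : Fin n → ℂ) (ψ : (Fin n → ℂ) → ℂ)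
    (h : f.IsGermAt b ψ) : MultiFun n Ω where
  base := b
  base_mem := h.mem
  germ := ψ
  analyticAt := h.analyticAt
  continuable := by
    intro γ' h₀ mem'
    obtain ⟨γ, mem, hγ⟩ := isGermAt_iff.mp h
    let q : Path b (γ' 1) := ⟨γ', h₀, rfl⟩
    obtain ⟨χ, hχ⟩ := f.continuable (γ.trans q) (γ.trans q).source (path_trans_mem mem mem')
    exact ⟨χ, hγ.of_trans hχ⟩

theorem isGermAt_rebase_iff {h : f.IsGermAt b φ} :
    (f.rebase b φ h).IsGermAt z ψ ↔ f.IsGermAt z ψ := by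
  obtain ⟨γ, mem, hγ⟩ := isGermAt_iff.mp h
  constructor
  · intro hψ
    obtain ⟨q, memq, hq⟩ := isGermAt_iff.mp hψ
    exact isGermAt_iff.mpr ⟨γ.trans q, path_trans_mem mem memq, hγ.trans hq⟩
  · intro hψ
    obtain ⟨q, memq, hq⟩ := isGermAt_iff.mp hψ
    exact isGermAt_iff.mpr ⟨γ.symm.trans q, path_trans_mem (fun t => mem _) memq, hγ.symm.trans hq⟩

theorem isBranchOn_rebase_iff {h : f.IsGermAt b φ} {F : (Fin n → ℂ) → ℂ} :
    (f.rebase b φ h).IsBranchOn R c F ↔ f.IsBranchOn R c F := by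
  simp only [IsBranchOn, isGermAt_rebase_iff]

theorem isRegularSingularity_rebase_iff {h : f.IsGermAt b φ} {A : GL (Fin n) ℂ} {β : Fin n → ℂ}
    {δ : Fin n → Bool} :
    (f.rebase b φ h).IsRegularSingularity A β δ ↔ f.IsRegularSingularity A β δ := by
  simp only [IsRegularSingularity, isBranchOn_rebase_iff]

/-- The sum of two multivalued functions with the same base point, continued simultaneously. -/
def sum (f g : MultiFun n Ω) (h : f.base = g.base) : MultiFun n Ω where
  base := f.base
  base_mem := f.base_mem
  germ := f.germ + g.germ
  analyticAt := f.analyticAt.add (h ▸ g.analyticAt)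
  continuable := by
    intro γ h₀ mem
    obtain ⟨ψ, hψ⟩ := f.continuable γ h₀ mem
    obtain ⟨χ, hχ⟩ := g.continuable γ (h₀.trans h) mem
    exact ⟨_, hψ.add hχ⟩

/-- The multivalued function `0` with base point `b`. -/
def zero (b : Fin n → ℂ) (hb : b ∈ Ω) : MultiFun n Ω where
  base := b
  base_mem := hb
  germ := 0
  analyticAt := analyticAt_const
  continuable γ _ _ := ⟨0, IsContinuationAlong.zero γ⟩

theorem isGermAt_zero_iff {hb : b ∈ Ω} {γ : Path b z} (mem : ∀ t, γ t ∈ Ω) :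
    (zero b hb).IsGermAt z ψ ↔ ψ =ᶠ[𝓝 z] 0 := by
  constructor
  · intro h
    obtain ⟨p, -, hp⟩ := isGermAt_iff.mp h
    simpa using hp.unique (IsContinuationAlong.zero (p : C(unitInterval, Fin n → ℂ))) .rfl
  · intro h
    exact isGermAt_iff.mpr
      ⟨γ, mem, (IsContinuationAlong.zero _).congr .rfl (γ.target.symm ▸ h.symm)⟩

theorem exists_isGermFamily {S : Type*} [TopologicalSpace S] {Γ : C(S × unitInterval, Fin n → ℂ)}
    (mem : ∀ p, Γ p ∈ Ω) (h₀ : ∀ s, Γ (s, 0) = f.base) :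
    ∃ Φ : S → (Fin n → ℂ) → ℂ, IsGermFamily (Γ.comp (.prodMk (.id S) (.const S 1))) Φ ∧
      ∀ s, IsContinuationAlong (Γ.comp (.prodMk (.const _ s) (.id _))) f.germ (Φ s) := by
  have := locallyConnectedSpace_unitInterval
  let slice (s : S) : C(unitInterval, Fin n → ℂ) := Γ.comp (.prodMk (.const _ s) (.id _))
  have continuable (s : S) : ∃ Φ, IsGermFamily (slice s) Φ ∧ Φ 0 =ᶠ[𝓝 f.base] f.germ := by
    obtain ⟨ψ, hψ⟩ := f.continuable (slice s) (h₀ s) fun t => mem (s, t)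
    obtain ⟨Φ, hΦ, hΦ₀, -⟩ := isContinuationAlong_iff.mp hψ
    exact ⟨Φ, hΦ, by simpa [slice, h₀] using hΦ₀⟩
  choose Φ hΦ hΦ₀ using continuable
  have initial : IsGermFamily (Γ.comp (.prodMk (.id S) (.const S 0))) fun s => Φ s 0 :=
    (IsGermFamily.const (φ := f.germ) fun s => by simpa [h₀] using f.analyticAt).congr
      fun s => by simpa [h₀] using (hΦ₀ s).symm
  have family : IsGermFamily Γ fun p => Φ p.1 p.2 := .of_slices 0 initial hΦ
  refine ⟨fun s => Φ s 1, family.comp (.prodMk (.id S) (.const S 1)), fun s => ?_⟩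
  exact isContinuationAlong_iff.mpr ⟨Φ s, hΦ s, by simpa [h₀] using hΦ₀ s, .rfl⟩

/-! ### Branches on cut regions -/

/-- A path in `R` that meets the cuts at most at its end point, which it approaches from the side to
which the cuts are attached. -/
structure IsApproach (R : Set (Fin n → ℂ)) (c : ι → (Fin n → ℂ) → ℂ)
    (γ : C(unitInterval, Fin n → ℂ)) : Prop where
  mem : ∀ t, γ t ∈ R
  continuousAt : ∀ t, t ≠ 1 → ∀ i, ContinuousAt (fun z => argPos (c i z)) (γ t)
  near : ∀ᶠ t in 𝓝 1, ∀ i, |argPos (c i (γ t)) - argPos (c i (γ 1))| < Real.pi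

/-- Each point of `R` is the end point of a path from `b` that approaches the cuts from the right
side. -/
def IsCutStar (R : Set (Fin n → ℂ)) (c : ι → (Fin n → ℂ) → ℂ) (b : Fin n → ℂ) : Prop :=
  ∀ z ∈ R, ∃ γ : Path b z, IsApproach R c γ

theorem IsCutStar.continuousAt (h : IsCutStar R c b) (hb : b ∈ R) (i : ι) :
    ContinuousAt (fun z => argPos (c i z)) b := by
  obtain ⟨γ, hγ⟩ := h b hb
  simpa using hγ.continuousAt 0 zero_ne_one i

theorem eventually_abs_argPos_sub_lt [Finite ι] {y : ι → ℝ}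
    (hc : ∀ i, ContinuousAt (fun z => argPos (c i z)) z)
    (hy : ∀ i, |argPos (c i z) - y i| < Real.pi) :
    ∀ᶠ z' in 𝓝 z, ∀ i, |argPos (c i z') - y i| < Real.pi :=
  Filter.eventually_all.mpr fun i =>
    ((hc i).sub continuousAt_const).abs.eventually_lt continuousAt_const (hy i)

theorem IsBranchOn.isGermAt [Finite ι] {F : (Fin n → ℂ) → ℂ} (hF : f.IsBranchOn R c F)
    (hz : z ∈ R) (hc : ∀ i, ContinuousAt (fun z => argPos (c i z)) z) : f.IsGermAt z F := by
  obtain ⟨ψ, hψ, agree⟩ := hF z hz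
  refine hψ.congr ?_
  filter_upwards [agree, eventually_abs_argPos_sub_lt (y := fun i => argPos (c i z)) hc
    (by simp [Real.pi_pos])] with z' h near using (h near).symm

theorem IsBranchOn.exists_isContinuationAlong [Finite ι] {F : (Fin n → ℂ) → ℂ}
    (hF : f.IsBranchOn R c F) {γ : C(unitInterval, Fin n → ℂ)} (hγ : IsApproach R c γ) :
    ∃ ψ, IsContinuationAlong γ F ψ ∧
      ∀ᶠ z in 𝓝 (γ 1), (∀ i, |argPos (c i z) - argPos (c i (γ 1))| < Real.pi) → F z = ψ z := by
  classical
  obtain ⟨ψ, hψ, agree⟩ := hF _ (hγ.mem 1)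
  refine ⟨ψ, isContinuationAlong_iff.mpr
    ⟨fun t => if t = 1 then ψ else F, ⟨fun t => ?_, fun t => ?_⟩, ?_, ?_⟩, agree⟩
  · by_cases ht : t = 1
    · subst ht
      simpa using hψ.analyticAt
    · simpa only [if_neg ht] using (hF.isGermAt (hγ.mem t) (hγ.continuousAt t ht)).analyticAt
  · by_cases ht : t = 1
    · subst ht
      filter_upwards [hγ.near, γ.continuous.continuousAt.eventually agree.eventually_nhds]
        with s near agree_s
      by_cases hs : s = 1
      · rw [hs]
      · rw [if_neg hs, if_pos rfl]
        filter_upwards [agree_s, eventually_abs_argPos_sub_lt (hγ.continuousAt s hs) near]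
          with z h near_z using h near_z
    · filter_upwards [isOpen_ne.mem_nhds ht] with s hs
      rw [if_neg hs, if_neg ht]
  · simp
  · simp

theorem isBranchOn_zero (h : IsCutStar R c b) (hR : R ⊆ Ω) (hb : b ∈ R) :
    (zero b (hR hb)).IsBranchOn R c 0 := by
  intro z hz
  obtain ⟨γ, hγ⟩ := h z hz
  exact ⟨0, (isGermAt_zero_iff fun t => hR (hγ.mem t)).mpr .rfl, .of_forall fun _ _ => rfl⟩

theorem isRegularSingularity_zero (hb : b ∈ Ω) (A : GL (Fin n) ℂ) (β : Fin n → ℂ)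
    (δ : Fin n → Bool) : (zero b hb).IsRegularSingularity A β δ := by
  refine ⟨0, fun _ => ∅, fun F ⟨r, hr, hF⟩ => ⟨r, 0, hr, fun z hz => ?_⟩⟩
  obtain ⟨ψ, hψ, agree⟩ := hF z hz
  obtain ⟨γ, mem, -⟩ := isGermAt_iff.mp hψ
  have ψ_eq_zero := ((isGermAt_zero_iff mem).mp hψ).self_of_nhds
  rw [agree.self_of_nhds (by simp [Real.pi_pos]), ψ_eq_zero]
  simp

theorem IsBranchOn.eqOn [Finite ι] (h : IsCutStar R c b) {f g : MultiFun n Ω}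
    {F G : (Fin n → ℂ) → ℂ} (hF : f.IsBranchOn R c F) (hG : g.IsBranchOn R c G)
    (hFG : F =ᶠ[𝓝 b] G) : Set.EqOn F G R := by
  intro z hz
  obtain ⟨γ, hγ⟩ := h z hz
  obtain ⟨ψ, hψ, F_eq⟩ := hF.exists_isContinuationAlong hγ
  obtain ⟨χ, hχ, G_eq⟩ := hG.exists_isContinuationAlong hγ
  have ψ_eq_χ := (hψ.unique hχ (by simpa using hFG)).self_of_nhds
  rw [ContinuousMap.coe_coe, γ.target] at F_eq G_eq ψ_eq_χ
  rw [F_eq.self_of_nhds (by simp [Real.pi_pos]), G_eq.self_of_nhds (by simp [Real.pi_pos]),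
    ψ_eq_χ]

theorem exists_isBranchOn_add [Finite ι] (h : IsCutStar R c b) (hR : R ⊆ Ω) (hb : b ∈ R)
    {f g : MultiFun n Ω} {F G : (Fin n → ℂ) → ℂ} (hF : f.IsBranchOn R c F)
    (hG : g.IsBranchOn R c G) :
    ∃ (hf : f.IsGermAt b F) (hg : g.IsGermAt b G),
      ((f.rebase b F hf).sum (g.rebase b G hg) rfl).IsBranchOn R c (F + G) := by
  refine ⟨hF.isGermAt hb (h.continuousAt hb), hG.isGermAt hb (h.continuousAt hb), fun z hz => ?_⟩
  obtain ⟨γ, hγ⟩ := h z hz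
  obtain ⟨ψ, hψ, F_eq⟩ := hF.exists_isContinuationAlong hγ
  obtain ⟨χ, hχ, G_eq⟩ := hG.exists_isContinuationAlong hγ
  rw [ContinuousMap.coe_coe, γ.target] at F_eq G_eq
  refine ⟨ψ + χ, isGermAt_iff.mpr ⟨γ, fun t => hR (hγ.mem t), hψ.add hχ⟩, ?_⟩
  filter_upwards [F_eq, G_eq] with z' hF' hG' near
  rw [Pi.add_apply, Pi.add_apply, hF' near, hG' near]

end MultiFun

section ArgPos

variable {ζ : ℂ}

theorem argPos_nonneg (ζ : ℂ) : 0 ≤ argPos ζ := by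
  unfold argPos
  split_ifs with h
  · exact h
  · linarith [Complex.neg_pi_lt_arg ζ, Real.pi_pos]

theorem argPos_lt (ζ : ℂ) : argPos ζ < 2 * Real.pi := by
  unfold argPos
  split_ifs with h
  · linarith [Complex.arg_le_pi ζ, Real.pi_pos]
  · linarith

theorem argPos_of_im_nonneg (h : 0 ≤ ζ.im) : argPos ζ = ζ.arg :=
  if_pos (Complex.arg_nonneg_iff.mpr h)

theorem argPos_of_im_neg (h : ζ.im < 0) : argPos ζ = ζ.arg + 2 * Real.pi :=
  if_neg (Complex.arg_nonneg_iff.not.mpr h.not_ge)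

theorem argPos_eq_arg_neg_add_pi (h : -ζ ∈ Complex.slitPlane) :
    argPos ζ = (-ζ).arg + Real.pi := by
  rcases lt_or_ge ζ.im 0 with him | him
  · rw [argPos_of_im_neg him, Complex.arg_neg_eq_arg_add_pi_of_im_neg him]
    ring
  · have upper : 0 < ζ.im ∨ ζ.im = 0 ∧ ζ.re < 0 := by
      rcases him.lt_or_eq with him | him
      · exact .inl him
      · exact .inr ⟨him.symm, by simpa [Complex.mem_slitPlane_iff, him.symm] using h⟩
    rw [argPos_of_im_nonneg him, Complex.arg_neg_eq_arg_sub_pi_iff.mpr upper, sub_add_cancel]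

theorem continuousAt_argPos (h : -ζ ∈ Complex.slitPlane) : ContinuousAt argPos ζ := by
  have arg_neg : ContinuousAt (fun ζ : ℂ => (-ζ).arg + Real.pi) ζ :=
    (ContinuousAt.comp (Complex.continuousAt_arg h) continuousAt_neg).add continuousAt_const
  refine arg_neg.congr ?_
  filter_upwards [continuousAt_neg.preimage_mem_nhds (Complex.isOpen_slitPlane.mem_nhds h)]
    with ζ' h' using (argPos_eq_arg_neg_add_pi h').symm

theorem argPos_eq_zero_of_neg_notMem_slitPlane (h : -ζ ∉ Complex.slitPlane) : argPos ζ = 0 := by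
  rw [Complex.mem_slitPlane_iff, Complex.neg_re, Complex.neg_im] at h
  push Not at h
  have im_eq : ζ.im = 0 := neg_eq_zero.mp h.2
  rw [argPos_of_im_nonneg im_eq.ge]
  exact Complex.arg_eq_zero_iff.mpr ⟨by linarith [h.1], im_eq⟩

theorem continuousAt_argPos_of_pos (h : 0 < argPos ζ) : ContinuousAt argPos ζ :=
  continuousAt_argPos (by_contra fun h' => h.ne' (argPos_eq_zero_of_neg_notMem_slitPlane h'))

theorem tendsto_argPos (hζ : ζ ≠ 0) :
    Filter.Tendsto argPos (𝓝[{ζ' | |argPos ζ' - argPos ζ| < Real.pi}] ζ) (𝓝 (argPos ζ)) := by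
  by_cases h : -ζ ∈ Complex.slitPlane
  · exact (continuousAt_argPos h).mono_left nhdsWithin_le_nhds
  have argPos_eq := argPos_eq_zero_of_neg_notMem_slitPlane h
  have mem_slitPlane : ζ ∈ Complex.slitPlane :=
    Complex.mem_slitPlane_or_neg_mem_slitPlane hζ |>.resolve_right h
  have arg_eq : argPos ζ = ζ.arg := by
    rw [argPos] at argPos_eq ⊢
    split_ifs at argPos_eq ⊢
    · rfl
    · linarith [Complex.neg_pi_lt_arg ζ, Real.pi_pos]
  rw [arg_eq]
  refine ((Complex.continuousAt_arg mem_slitPlane).mono_left nhdsWithin_le_nhds).congr' ?_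
  filter_upwards [self_mem_nhdsWithin] with ζ' near
  change |argPos ζ' - ζ.arg| < Real.pi at near
  rw [← arg_eq, argPos_eq, sub_zero, abs_of_nonneg (argPos_nonneg _)] at near
  refine (if_pos ?_).symm
  by_contra h_neg
  rw [argPos, if_neg h_neg] at near
  linarith [Complex.neg_pi_lt_arg ζ']

theorem lBranch_zero (ζ : ℂ) : lBranch 0 ζ = (Real.log ‖ζ‖ : ℂ) + argPos ζ * Complex.I := by
  simp [lBranch]

theorem lBranch_zero_im (ζ : ℂ) : (lBranch 0 ζ).im = argPos ζ := by
  simp [lBranch_zero]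

theorem exp_lBranch_zero (hζ : ζ ≠ 0) : Complex.exp (lBranch 0 ζ) = ζ := by
  have exp_argPos : Complex.exp ((argPos ζ : ℂ) * Complex.I) = Complex.exp (ζ.arg * Complex.I) := by
    unfold argPos
    split_ifs with h
    · rfl
    · push_cast
      rw [add_mul, Complex.exp_add, Complex.exp_two_pi_mul_I, mul_one]
  rw [lBranch_zero, Complex.exp_add, exp_argPos, ← Complex.ofReal_exp,
    Real.exp_log (norm_pos_iff.mpr hζ)]
  exact Complex.norm_mul_exp_arg_mul_I ζ

theorem argPos_exp {x : ℂ} (h₀ : 0 ≤ x.im) (h₁ : x.im < 2 * Real.pi) :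
    argPos (Complex.exp x) = x.im := by
  obtain ⟨k, hk⟩ := Complex.exp_eq_exp_iff_exists_int.mp (exp_lBranch_zero (Complex.exp_ne_zero x))
  have im_eq : argPos (Complex.exp x) = x.im + k * (2 * Real.pi) := by
    simpa [lBranch_zero_im] using congrArg Complex.im hk
  have k_eq_zero : k = 0 := by
    have lower : -1 < (k : ℝ) := by nlinarith [Real.two_pi_pos, argPos_nonneg (Complex.exp x)]
    have upper : (k : ℝ) < 1 := by nlinarith [Real.two_pi_pos, argPos_lt (Complex.exp x)]
    norm_cast at lower upper
    lia
  simpa [k_eq_zero] using im_eq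

theorem lBranch_zero_exp {x : ℂ} (h₀ : 0 ≤ x.im) (h₁ : x.im < 2 * Real.pi) :
    lBranch 0 (Complex.exp x) = x := by
  rw [lBranch_zero, argPos_exp h₀ h₁, Complex.norm_exp, Real.log_exp, Complex.re_add_im]

end ArgPos

namespace MultiFun

variable {n : ℕ} {Ω : Set (Fin n → ℂ)} {A : GL (Fin n) ℂ} {β b z : Fin n → ℂ}
  {T : Set (Fin n → ℂ)}

/-- The region `T`, which does not meet the coordinate hyperplanes, is convex in logarithmic
coordinates. -/
structure IsLogConvex (T : Set (Fin n → ℂ)) : Prop where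
  isOpen : IsOpen T
  ne_zero : ∀ ζ ∈ T, ∀ i, ζ i ≠ 0
  convex : Convex ℝ {x : Fin n → ℂ | (fun i => Complex.exp (x i)) ∈ T}

/-- The map `x ↦ z` determined by `ζ = exp x` and `ζ = z A - β`, which uniformizes the complement of
the hyperplanes `ζ_i = 0`. -/
noncomputable def expChart (A : GL (Fin n) ℂ) (β x : Fin n → ℂ) : Fin n → ℂ :=
  Matrix.vecMul ((fun i => Complex.exp (x i)) + β) ((A⁻¹ : GL (Fin n) ℂ) : Matrix (Fin n) (Fin n) ℂ)

/-- The section of `expChart A β` cut along the `ζ_i ∈ ℝ_+`. -/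
noncomputable def logChart (A : GL (Fin n) ℂ) (β z : Fin n → ℂ) : Fin n → ℂ :=
  fun i => lBranch 0 (newVar A β z i)

theorem newVar_expChart (x : Fin n → ℂ) :
    newVar A β (expChart A β x) = fun i => Complex.exp (x i) := by
  have inv_mul : ((A⁻¹ : GL (Fin n) ℂ) : Matrix (Fin n) (Fin n) ℂ) * A = 1 := A.inv_mul
  rw [newVar, expChart, Matrix.vecMul_vecMul, inv_mul, Matrix.vecMul_one, add_sub_cancel_right]

theorem exp_logChart (hz : ∀ i, newVar A β z i ≠ 0) :
    (fun i => Complex.exp (logChart A β z i)) = newVar A β z :=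
  funext fun i => exp_lBranch_zero (hz i)

theorem expChart_logChart (hz : ∀ i, newVar A β z i ≠ 0) : expChart A β (logChart A β z) = z := by
  have mul_inv : (A : Matrix (Fin n) (Fin n) ℂ) * (A⁻¹ : GL (Fin n) ℂ) = 1 := A.mul_inv
  rw [expChart, exp_logChart hz, newVar, sub_add_cancel, Matrix.vecMul_vecMul, mul_inv,
    Matrix.vecMul_one]

theorem continuous_newVar : Continuous (newVar A β) :=
  (Continuous.matrix_vecMul continuous_id continuous_const).sub continuous_const

theorem continuous_expChart : Continuous (expChart A β) := by
  unfold expChart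
  fun_prop

theorem tendsto_logChart (hz : ∀ i, newVar A β z i ≠ 0) :
    Filter.Tendsto (logChart A β)
      (𝓝[{z' | ∀ i, |argPos (newVar A β z' i) - argPos (newVar A β z i)| < Real.pi}] z)
      (𝓝 (logChart A β z)) := by
  refine tendsto_pi_nhds.mpr fun i => ?_
  simp only [logChart, lBranch_zero]
  have continuous_newVar_i : Continuous fun z => newVar A β z i :=
    (continuous_apply i).comp continuous_newVar
  have log_norm : ContinuousAt (fun z => Real.log ‖newVar A β z i‖) z :=
    continuous_newVar_i.norm.continuousAt.log (norm_ne_zero_iff.mpr (hz i))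
  refine Filter.Tendsto.add ?_ (Filter.Tendsto.mul ?_ tendsto_const_nhds)
  · exact (Complex.continuous_ofReal.tendsto _).comp (log_norm.mono_left nhdsWithin_le_nhds)
  · refine (Complex.continuous_ofReal.tendsto _).comp ((tendsto_argPos (hz i)).comp ?_)
    exact tendsto_nhdsWithin_iff.mpr ⟨continuous_newVar_i.continuousAt.mono_left nhdsWithin_le_nhds,
      eventually_nhdsWithin_of_forall fun z' near => near i⟩

theorem lineMap_pi_mem_Ico {θ t : ℝ} (hθ : θ ∈ Set.Ico 0 (2 * Real.pi)) (ht : t ∈ Set.Icc 0 1) :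
    AffineMap.lineMap Real.pi θ t ∈ Set.Ico 0 (2 * Real.pi) :=
  (convex_Ico 0 (2 * Real.pi)).lineMap_mem ⟨Real.pi_pos.le, by linarith [Real.pi_pos]⟩ hθ ht

theorem lineMap_pi_pos {θ t : ℝ} (hθ : 0 ≤ θ) (ht₀ : 0 ≤ t) (ht₁ : t < 1) :
    0 < AffineMap.lineMap Real.pi θ t := by
  rw [AffineMap.lineMap_apply_ring]
  nlinarith [mul_nonneg ht₀ hθ, mul_pos (sub_pos.mpr ht₁) Real.pi_pos]

/-- The segment from `b` to `z` in logarithmic coordinates. -/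
noncomputable def chartPath (b : Fin n → ℂ) (hz : ∀ i, newVar A β z i ≠ 0) :
    Path (expChart A β b) z :=
  ((Path.segment b (logChart A β z)).map continuous_expChart).cast rfl (expChart_logChart hz).symm

theorem segment_mem_of_isLogConvex (hT : IsLogConvex T) (hb : (fun i => Complex.exp (b i)) ∈ T)
    {x : Fin n → ℂ} (hx : (fun i => Complex.exp (x i)) ∈ T) (t : unitInterval) :
    newVar A β (expChart A β (Path.segment b x t)) ∈ T := by
  rw [newVar_expChart]
  exact hT.convex.lineMap_mem hb hx t.2

theorem argPos_newVar_chartPath (hbi : ∀ i, (b i).im = Real.pi) (hz : ∀ i, newVar A β z i ≠ 0)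
    (t : unitInterval) (i : Fin n) :
    argPos (newVar A β (chartPath b hz t) i) =
      AffineMap.lineMap Real.pi (argPos (newVar A β z i)) (t : ℝ) := by
  have im_segment : (Path.segment b (logChart A β z) t i).im =
      AffineMap.lineMap Real.pi (argPos (newVar A β z i)) (t : ℝ) := by
    simp [Path.segment_apply, AffineMap.lineMap_apply_module, logChart, hbi, lBranch_zero_im]
  have bounds := lineMap_pi_mem_Ico ⟨argPos_nonneg (newVar A β z i), argPos_lt _⟩ t.2
  change argPos (newVar A β (expChart A β (Path.segment b (logChart A β z) t)) i) = _
  rw [newVar_expChart, argPos_exp (im_segment ▸ bounds.1) (im_segment ▸ bounds.2), im_segment]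

theorem isApproach_chartPath (hT : IsLogConvex T) (hb : (fun i => Complex.exp (b i)) ∈ T)
    (hbi : ∀ i, (b i).im = Real.pi) (hz : newVar A β z ∈ T) :
    IsApproach {z | newVar A β z ∈ T} (fun i z => newVar A β z i)
      (chartPath b (hT.ne_zero _ hz)) where
  mem t := segment_mem_of_isLogConvex hT hb (by rwa [exp_logChart (hT.ne_zero _ hz)]) t
  continuousAt t ht i := by
    refine ContinuousAt.comp (f := fun z => newVar A β z i) (continuousAt_argPos_of_pos ?_)
      ((continuous_apply i).comp continuous_newVar).continuousAt
    rw [ContinuousMap.coe_coe, argPos_newVar_chartPath hbi]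
    exact lineMap_pi_pos (argPos_nonneg _) t.2.1 (lt_of_le_of_ne t.2.2 fun h => ht (Subtype.ext h))
  near := by
    rw [Filter.eventually_all]
    intro i
    simp only [ContinuousMap.coe_coe, argPos_newVar_chartPath hbi, AffineMap.lineMap_apply_ring]
    have continuous_dist : Continuous fun t : unitInterval =>
        |(1 - (t : ℝ)) * Real.pi + t * argPos (newVar A β z i) -
          ((1 - ((1 : unitInterval) : ℝ)) * Real.pi +
            ((1 : unitInterval) : ℝ) * argPos (newVar A β z i))| := by
      fun_prop
    exact continuous_dist.continuousAt.eventually_lt continuousAt_const (by simp [Real.pi_pos])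

theorem isCutStar_of_isLogConvex (hT : IsLogConvex T) (hb : (fun i => Complex.exp (b i)) ∈ T)
    (hbi : ∀ i, (b i).im = Real.pi) :
    IsCutStar {z | newVar A β z ∈ T} (fun i z => newVar A β z i) (expChart A β b) :=
  fun _ hz => ⟨_, isApproach_chartPath hT hb hbi hz⟩

theorem expChart_mem (hb : (fun i => Complex.exp (b i)) ∈ T) :
    expChart A β b ∈ {z | newVar A β z ∈ T} := by
  change newVar A β (expChart A β b) ∈ T
  rwa [newVar_expChart]

theorem exists_germ_expChart (hT : IsLogConvex T) (hR : {z | newVar A β z ∈ T} ⊆ Ω)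
    (hb : (fun i => Complex.exp (b i)) ∈ T) {f : MultiFun n Ω} {ψ : (Fin n → ℂ) → ℂ}
    (hψ : f.IsGermAt (expChart A β b) ψ) :
    ∃ Φ : (Fin n → ℂ) → (Fin n → ℂ) → ℂ, Φ b =ᶠ[𝓝 (expChart A β b)] ψ ∧
      ∀ x, (fun i => Complex.exp (x i)) ∈ T → f.IsGermAt (expChart A β x) (Φ x) ∧
        ∀ᶠ y in 𝓝 x, (fun i => Complex.exp (y i)) ∈ T →
          Φ y =ᶠ[𝓝 (expChart A β y)] Φ x := by
  let P : Set (Fin n → ℂ) := {x | (fun i => Complex.exp (x i)) ∈ T}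
  let Γ : C(P × unitInterval, Fin n → ℂ) :=
    ⟨fun p => expChart A β (Path.segment b p.1 p.2), continuous_expChart.comp <| by
      simp only [Path.segment_apply, AffineMap.lineMap_apply_module]
      fun_prop⟩
  have Γ_zero (s : P) : Γ (s, 0) = expChart A β b :=
    congrArg (expChart A β) (Path.segment b s.1).source
  have Γ_one (s : P) : Γ (s, 1) = expChart A β s :=
    congrArg (expChart A β) (Path.segment b s.1).target
  have Γ_mem (p : P × unitInterval) : Γ p ∈ Ω :=
    hR (segment_mem_of_isLogConvex hT hb p.1.2 p.2)
  obtain ⟨Φ, hΦ, continuation⟩ := (f.rebase _ ψ hψ).exists_isGermFamily Γ_mem Γ_zero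
  have extend_apply (s : P) : Function.extend Subtype.val Φ 0 s.1 = Φ s :=
    Subtype.val_injective.extend_apply Φ 0 s
  refine ⟨Function.extend Subtype.val Φ 0, ?_, fun x hx => ⟨?_, ?_⟩⟩
  · rw [extend_apply ⟨b, hb⟩]
    have constant : IsContinuationAlong (Γ.comp (.prodMk (.const _ ⟨b, hb⟩) (.id _))) ψ ψ :=
      isContinuationAlong_iff.mpr ⟨_, .const fun t => by simpa [Γ] using hψ.analyticAt, .rfl, .rfl⟩
    simpa [Γ] using (continuation ⟨b, hb⟩).unique constant .rfl
  · rw [extend_apply ⟨x, hx⟩, ← isGermAt_rebase_iff (h := hψ)]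
    exact ⟨_, Γ_zero _, Γ_one _, fun t => Γ_mem _, continuation ⟨x, hx⟩⟩
  · have locally_const := hΦ.locally_const ⟨x, hx⟩
    rw [nhds_subtype_eq_comap, Filter.eventually_comap] at locally_const
    filter_upwards [locally_const] with y h hy
    rw [extend_apply ⟨x, hx⟩, extend_apply ⟨y, hy⟩]
    simpa [Γ_one] using h ⟨y, hy⟩ rfl

theorem exists_isBranchOn (hT : IsLogConvex T) (hR : {z | newVar A β z ∈ T} ⊆ Ω)
    (hb : (fun i => Complex.exp (b i)) ∈ T) (hbi : ∀ i, (b i).im = Real.pi) {f : MultiFun n Ω}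
    {ψ : (Fin n → ℂ) → ℂ} (hψ : f.IsGermAt (expChart A β b) ψ) :
    ∃ F, f.IsBranchOn {z | newVar A β z ∈ T} (fun i z => newVar A β z i) F ∧
      F =ᶠ[𝓝 (expChart A β b)] ψ := by
  obtain ⟨Φ, hΦb, hΦ⟩ := exists_germ_expChart hT hR hb hψ
  have logChart_mem {z : Fin n → ℂ} (hz : newVar A β z ∈ T) :
      (fun i => Complex.exp (logChart A β z i)) ∈ T := by
    rwa [exp_logChart (hT.ne_zero _ hz)]
  have agree (z : Fin n → ℂ) (hz : newVar A β z ∈ T) : ∀ᶠ z' in 𝓝 z,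
      (∀ i, |argPos (newVar A β z' i) - argPos (newVar A β z i)| < Real.pi) →
        Φ (logChart A β z') z' = Φ (logChart A β z) z' := by
    filter_upwards [eventually_nhdsWithin_iff.mp ((tendsto_logChart (hT.ne_zero _ hz)).eventually
      (hΦ _ (logChart_mem hz)).2), (hT.isOpen.preimage continuous_newVar).mem_nhds hz]
      with z' locally_const hz' near
    have germ_eq := locally_const near (logChart_mem hz')
    rw [expChart_logChart (hT.ne_zero _ hz')] at germ_eq
    exact germ_eq.self_of_nhds
  refine ⟨fun z => Φ (logChart A β z) z, fun z hz => ⟨_, ?_, agree z hz⟩, ?_⟩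
  · simpa only [expChart_logChart (hT.ne_zero _ hz)] using (hΦ _ (logChart_mem hz)).1
  · have base_mem := expChart_mem (A := A) (β := β) hb
    have continuousAt := (isCutStar_of_isLogConvex hT hb hbi).continuousAt base_mem
    have logChart_base : logChart A β (expChart A β b) = b := by
      funext i
      rw [logChart, newVar_expChart, lBranch_zero_exp] <;> linarith [hbi i, Real.pi_pos]
    filter_upwards [agree _ base_mem, hΦb, eventually_abs_argPos_sub_lt
      (y := fun i => argPos (newVar A β (expChart A β b) i)) continuousAt
      (by simp [Real.pi_pos])] with z agree_z hψz near
    rw [agree_z near, logChart_base, hψz]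

theorem exists_isBranchOn_split (hT : IsLogConvex T)
    (hb : (fun i => Complex.exp (b i)) ∈ T) (hbi : ∀ i, (b i).im = Real.pi) {f g : MultiFun n Ω}
    {hfg : f.base = g.base} {F : (Fin n → ℂ) → ℂ}
    (hF : (f.sum g hfg).IsBranchOn {z | newVar A β z ∈ T} (fun i z => newVar A β z i) F) :
    ∃ F₁ F₂, f.IsBranchOn {z | newVar A β z ∈ T} (fun i z => newVar A β z i) F₁ ∧
      g.IsBranchOn {z | newVar A β z ∈ T} (fun i z => newVar A β z i) F₂ ∧
      Set.EqOn F (F₁ + F₂) {z | newVar A β z ∈ T} := by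
  have star : IsCutStar {z | newVar A β z ∈ T} (fun i z => newVar A β z i) (expChart A β b) :=
    isCutStar_of_isLogConvex hT hb hbi
  have base_mem := expChart_mem (A := A) (β := β) hb
  have hR : {z | newVar A β z ∈ T} ⊆ Ω := fun z hz => (hF z hz).choose_spec.1.mem
  obtain ⟨γ, mem, hγ⟩ := isGermAt_iff.mp (hF.isGermAt base_mem (star.continuousAt base_mem))
  obtain ⟨ψ₁, hψ₁⟩ := f.continuable γ γ.source mem
  obtain ⟨ψ₂, hψ₂⟩ := g.continuable γ (γ.source.trans hfg) mem
  have F_eq : F =ᶠ[𝓝 (expChart A β b)] ψ₁ + ψ₂ := by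
    simpa using hγ.unique (hψ₁.add hψ₂) .rfl
  obtain ⟨F₁, hF₁, hF₁ψ₁⟩ := exists_isBranchOn hT hR hb hbi (f := f)
    ⟨γ, γ.source, γ.target, mem, hψ₁⟩
  obtain ⟨F₂, hF₂, hF₂ψ₂⟩ := exists_isBranchOn hT hR hb hbi (f := g)
    ⟨γ, γ.source.trans hfg, γ.target, mem, hψ₂⟩
  obtain ⟨_, _, hF₁₂⟩ := exists_isBranchOn_add star hR base_mem hF₁ hF₂
  exact ⟨F₁, F₂, hF₁, hF₂, hF.eqOn star hF₁₂ (F_eq.trans (hF₁ψ₁.add hF₂ψ₂).symm)⟩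

end MultiFun

namespace MultiFun

variable {n : ℕ} {Ω : Set (Fin n → ℂ)} {A : GL (Fin n) ℂ} {β : Fin n → ℂ}

/-! ### Reinhardt regions -/

/-- The region of `(ℂ^×)^n` cut out by conditions on the logarithms of the absolute values of the
coordinates. Both the punctured polydiscs and the regions of convergence of products are of this
form. -/
def reinhardtRegion (L : Set (Fin n → ℝ)) : Set (Fin n → ℂ) :=
  {ζ | (∀ i, ζ i ≠ 0) ∧ (fun i => Real.log ‖ζ i‖) ∈ L}

theorem exp_mem_reinhardtRegion {L : Set (Fin n → ℝ)} {x : Fin n → ℂ} :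
    (fun i => Complex.exp (x i)) ∈ reinhardtRegion L ↔ (fun i => (x i).re) ∈ L := by
  simp [reinhardtRegion, Complex.norm_exp]

theorem isLogConvex_reinhardtRegion {L : Set (Fin n → ℝ)} (isOpen : IsOpen L)
    (convex : Convex ℝ L) : IsLogConvex (reinhardtRegion L) where
  isOpen := by
    have isOpen_ne_zero : IsOpen {ζ : Fin n → ℂ | ∀ i, ζ i ≠ 0} := by
      simp only [Set.ofPred_forall]
      exact isOpen_iInter_of_finite fun i => isOpen_ne_fun (continuous_apply i) continuous_const
    refine ContinuousOn.isOpen_inter_preimage ?_ isOpen_ne_zero isOpen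
    exact continuousOn_pi.mpr fun i => (by fun_prop : Continuous fun ζ : Fin n → ℂ => ‖ζ i‖)
      |>.continuousOn.log fun ζ hζ => norm_ne_zero_iff.mpr (hζ i)
  ne_zero _ hζ := hζ.1
  convex := by
    simp only [exp_mem_reinhardtRegion]
    exact convex.is_linear_preimage ⟨fun x y => by ext i; simp, fun c x => by ext i; simp⟩

theorem exists_exp_mem_reinhardtRegion {L : Set (Fin n → ℝ)} (h : L.Nonempty) :
    ∃ b : Fin n → ℂ, (fun i => Complex.exp (b i)) ∈ reinhardtRegion L ∧
      ∀ i, (b i).im = Real.pi := by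
  obtain ⟨y, hy⟩ := h
  exact ⟨fun i => ⟨y i, Real.pi⟩, exp_mem_reinhardtRegion.mpr hy, fun i => rfl⟩

/-! ### Sums of functions with regular singularities -/

/-- The logarithms of the absolute values of the coordinates of points of a punctured polydisc. -/
def logPolydisc (δ : Fin n → Bool) (r : Fin n → ℝ) : Set (Fin n → ℝ) :=
  {y | ∀ i, if δ i then Real.log (r i) < y i else y i < Real.log (r i)}

theorem logPolydisc_eq_pi (δ : Fin n → Bool) (r : Fin n → ℝ) :
    logPolydisc δ r = Set.univ.pi fun i =>
      if δ i then Set.Ioi (Real.log (r i)) else Set.Iio (Real.log (r i)) := by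
  ext y
  simp only [logPolydisc, Set.mem_ofPred_eq, Set.mem_univ_pi]
  refine forall_congr' fun i => ?_
  split_ifs <;> rfl

theorem isOpen_logPolydisc (δ : Fin n → Bool) (r : Fin n → ℝ) : IsOpen (logPolydisc δ r) := by
  rw [logPolydisc_eq_pi]
  refine isOpen_set_pi Set.finite_univ fun i _ => ?_
  split_ifs
  exacts [isOpen_Ioi, isOpen_Iio]

theorem convex_logPolydisc (δ : Fin n → Bool) (r : Fin n → ℝ) : Convex ℝ (logPolydisc δ r) := by
  rw [logPolydisc_eq_pi]
  refine convex_pi fun i _ => ?_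
  split_ifs
  exacts [convex_Ioi _, convex_Iio _]

theorem logPolydisc_nonempty (δ : Fin n → Bool) (r : Fin n → ℝ) : (logPolydisc δ r).Nonempty :=
  ⟨fun i => if δ i then Real.log (r i) + 1 else Real.log (r i) - 1, fun i => by
    dsimp only
    split_ifs <;> linarith⟩

theorem puncturedPolydisc_eq {δ : Fin n → Bool} {r : Fin n → ℝ} (hr : ∀ i, 0 < r i) :
    puncturedPolydisc A β δ r = {z | newVar A β z ∈ reinhardtRegion (logPolydisc δ r)} := by
  ext z
  simp only [puncturedPolydisc, reinhardtRegion, logPolydisc, Set.mem_ofPred_eq, ← forall_and]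
  refine forall_congr' fun i => ?_
  rcases eq_or_ne (newVar A β z i) 0 with h | h
  · simp [h, (hr i).le]
  · cases δ i <;> simp [h, Real.log_lt_log_iff (hr i) (norm_pos_iff.mpr h),
      Real.log_lt_log_iff (norm_pos_iff.mpr h) (hr i)]

theorem exponents_mono {E E' : Finset ℂ} (h : E ⊆ E') (d : Bool) :
    exponents E d ⊆ exponents E' d :=
  fun _ ⟨e, he, m, hm⟩ => ⟨e, h he, m, hm⟩

theorem hasSum_extend_exponents {δ : Fin n → Bool} {K K' : ℕ} {E E' : Fin n → Finset ℂ}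
    (hK : K ≤ K') (hE : ∀ i, E i ⊆ E' i)
    (α : (∀ i, exponents (E i) (δ i)) × (Fin n → Fin (K + 1)) → ℂ) :
    ∃ α' : (∀ i, exponents (E' i) (δ i)) × (Fin n → Fin (K' + 1)) → ℂ,
      ∀ (ζ : Fin n → ℂ) (y : ℂ),
        HasSum (fun q : (∀ i, exponents (E i) (δ i)) × (Fin n → Fin (K + 1)) =>
          α q * ∏ i, (Complex.exp ((q.1 i : ℂ) * lBranch 0 (ζ i)) *
            lBranch 0 (ζ i) ^ (q.2 i : ℕ))) y →
        HasSum (fun q : (∀ i, exponents (E' i) (δ i)) × (Fin n → Fin (K' + 1)) =>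
          α' q * ∏ i, (Complex.exp ((q.1 i : ℂ) * lBranch 0 (ζ i)) *
            lBranch 0 (ζ i) ^ (q.2 i : ℕ))) y := by
  let e : (∀ i, exponents (E i) (δ i)) × (Fin n → Fin (K + 1)) →
      (∀ i, exponents (E' i) (δ i)) × (Fin n → Fin (K' + 1)) :=
    Prod.map (fun a i => Set.inclusion (exponents_mono (hE i) _) (a i))
      (fun s i => Fin.castLE (Nat.succ_le_succ hK) (s i))
  have e_injective : Function.Injective e :=
    Function.Injective.prodMap
      (fun a a' h => funext fun i => Set.inclusion_injective _ (congrFun h i))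
      (fun s s' h => funext fun i => Fin.castLE_injective _ (congrFun h i))
  refine ⟨Function.extend e α 0, fun ζ y h => ?_⟩
  rw [← e_injective.hasSum_iff]
  · simp only [Function.comp_def, e_injective.extend_apply]
    exact h
  · intro q hq
    rw [Function.extend_apply' _ _ _ hq, Pi.zero_apply, zero_mul]

theorem puncturedPolydisc_mono {δ : Fin n → Bool} {r r' : Fin n → ℝ}
    (h : ∀ i, if δ i then r' i ≤ r i else r i ≤ r' i) :
    puncturedPolydisc A β δ r ⊆ puncturedPolydisc A β δ r' := by
  intro z hz i
  have hzi := hz i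
  have hi := h i
  split_ifs at hzi hi ⊢
  · exact hi.trans_lt hzi
  · exact ⟨hzi.1, hzi.2.trans_le hi⟩

theorem exists_puncturedPolydisc_subset_inter {δ : Fin n → Bool} {r r' : Fin n → ℝ}
    (hr : ∀ i, 0 < r i) (hr' : ∀ i, 0 < r' i) :
    ∃ s : Fin n → ℝ, (∀ i, 0 < s i) ∧
      puncturedPolydisc A β δ s ⊆ puncturedPolydisc A β δ r ∩ puncturedPolydisc A β δ r' := by
  refine ⟨fun i => if δ i then max (r i) (r' i) else min (r i) (r' i), fun i => ?_,
    Set.subset_inter (puncturedPolydisc_mono fun i => ?_) (puncturedPolydisc_mono fun i => ?_)⟩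
  all_goals
    beta_reduce
    split_ifs <;> simp [hr i, hr' i]

theorem IsRegularSingularity.sum {f g : MultiFun n Ω} {hfg : f.base = g.base}
    {δ : Fin n → Bool} (hf : f.IsRegularSingularity A β δ)
    (hg : g.IsRegularSingularity A β δ) : (f.sum g hfg).IsRegularSingularity A β δ := by
  obtain ⟨K₁, E₁, expand₁⟩ := hf
  obtain ⟨K₂, E₂, expand₂⟩ := hg
  refine ⟨max K₁ K₂, fun i => E₁ i ∪ E₂ i, fun F ⟨r, hr, hF⟩ => ?_⟩
  obtain ⟨F₁, F₂, hF₁, hF₂, hadd⟩ : ∃ F₁ F₂,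
      f.IsBranchOn (puncturedPolydisc A β δ r) (fun i z => newVar A β z i) F₁ ∧
      g.IsBranchOn (puncturedPolydisc A β δ r) (fun i z => newVar A β z i) F₂ ∧
      Set.EqOn F (F₁ + F₂) (puncturedPolydisc A β δ r) := by
    obtain ⟨b, hb, hbi⟩ := exists_exp_mem_reinhardtRegion (logPolydisc_nonempty δ r)
    rw [puncturedPolydisc_eq hr] at hF ⊢
    exact exists_isBranchOn_split (isLogConvex_reinhardtRegion (isOpen_logPolydisc δ r)
      (convex_logPolydisc δ r)) hb hbi hF
  obtain ⟨r₁, α₁, hr₁, hsum₁⟩ := expand₁ F₁ ⟨r, hr, hF₁⟩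
  obtain ⟨r₂, α₂, hr₂, hsum₂⟩ := expand₂ F₂ ⟨r, hr, hF₂⟩
  obtain ⟨α₁', extend₁⟩ := hasSum_extend_exponents (le_max_left K₁ K₂)
    (fun i => Finset.subset_union_left (s₁ := E₁ i) (s₂ := E₂ i)) α₁
  obtain ⟨α₂', extend₂⟩ := hasSum_extend_exponents (le_max_right K₁ K₂)
    (fun i => Finset.subset_union_right (s₁ := E₁ i) (s₂ := E₂ i)) α₂
  obtain ⟨t, ht, ht_sub⟩ := exists_puncturedPolydisc_subset_inter (A := A) (β := β) (δ := δ) hr₁ hr₂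
  obtain ⟨s, hs, hs_sub⟩ := exists_puncturedPolydisc_subset_inter (A := A) (β := β) (δ := δ) ht hr
  refine ⟨s, α₁' + α₂', hs, fun z hz => ?_⟩
  rw [hadd (hs_sub hz).2]
  simp only [Pi.add_apply, add_mul]
  exact (extend₁ _ _ (hsum₁ z (ht_sub (hs_sub hz).1).1)).add
    (extend₂ _ _ (hsum₂ z (ht_sub (hs_sub hz).1).2))

/-! ### The regions of convergence of products -/

/-- The region `|z_1| > ⋯ > |z_{r+1}| > 0`. -/
def radialRegion (r : ℕ) : Set (Fin (r + 1) → ℂ) :=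
  {z | StrictAnti (fun i => ‖z i‖) ∧ 0 < ‖z (Fin.last r)‖}

theorem radialRegion_subset (r : ℕ) : radialRegion r ⊆ Mspace (r + 1) := by
  rintro z ⟨anti, last_pos⟩
  refine ⟨fun i => ?_, fun i j hij h => hij (anti.injective (congrArg norm h))⟩
  exact norm_pos_iff.mp (last_pos.trans_le (anti.antitone (Fin.le_last i)))

theorem radialRegion_eq (r : ℕ) : radialRegion r = reinhardtRegion {y | StrictAnti y} := by
  ext z
  constructor
  · intro hz
    have ne_zero := (radialRegion_subset r hz).1
    exact ⟨ne_zero, fun i j hij =>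
      Real.log_lt_log (norm_pos_iff.mpr (ne_zero j)) (hz.1 hij)⟩
  · rintro ⟨ne_zero, anti⟩
    exact ⟨fun i j hij => (Real.log_lt_log_iff (norm_pos_iff.mpr (ne_zero j))
      (norm_pos_iff.mpr (ne_zero i))).mp (anti hij), norm_pos_iff.mpr (ne_zero _)⟩

theorem isLogConvex_radialRegion (r : ℕ) : IsLogConvex (radialRegion r) := by
  rw [radialRegion_eq]
  refine isLogConvex_reinhardtRegion ?_ fun y hy y' hy' a b ha hb hab i j hij => ?_
  · simp only [StrictAnti, Set.ofPred_forall]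
    refine isOpen_iInter_of_finite fun i => isOpen_iInter_of_finite fun j =>
      isOpen_iInter_of_finite fun _ => isOpen_lt (continuous_apply j) (continuous_apply i)
  · have := convex_Ioi (0 : ℝ) (sub_pos.mpr (hy hij)) (sub_pos.mpr (hy' hij)) ha hb hab
    simp only [smul_eq_mul, Set.mem_Ioi, Pi.add_apply, Pi.smul_apply] at this ⊢
    linarith

theorem newVar_one_zero (z : Fin n → ℂ) : newVar 1 0 z = z := by
  simp [newVar]

theorem exists_isCutStar_radialRegion (r : ℕ) :
    ∃ b ∈ radialRegion r, IsCutStar (radialRegion r) (fun i z => z i) b := by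
  obtain ⟨b, hb, hbi⟩ := exists_exp_mem_reinhardtRegion (n := r + 1) (L := {y | StrictAnti y})
    ⟨fun i => -(i : ℝ), fun i j hij => neg_lt_neg (Nat.cast_lt.mpr hij)⟩
  rw [← radialRegion_eq] at hb
  have isCutStar := isCutStar_of_isLogConvex (A := 1) (β := 0) (isLogConvex_radialRegion r) hb hbi
  have mem := expChart_mem (A := 1) (β := 0) hb
  simp only [newVar_one_zero] at isCutStar mem
  exact ⟨_, mem, isCutStar⟩

/-! ### The cut space `M^2` -/

/-- A path from `-a` to `c` that avoids the cut `ℝ_+` except perhaps at its end point, provided that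
the bulge `s` into the upper half plane is small. -/
noncomputable def cutPath (c : ℂ) (a s t : ℝ) : ℂ :=
  t * c - (1 - t) * a + s * a * t * (1 - t) * Complex.I

variable {c : ℂ} {a s t : ℝ}

theorem cutPath_re (c : ℂ) (a s t : ℝ) : (cutPath c a s t).re = t * c.re - (1 - t) * a := by
  simp [cutPath]

theorem cutPath_im (c : ℂ) (a s t : ℝ) :
    (cutPath c a s t).im = t * (c.im + s * a * (1 - t)) := by
  simp only [cutPath, Complex.add_im, Complex.sub_im, Complex.mul_im, Complex.mul_re,
    Complex.ofReal_re, Complex.ofReal_im, Complex.I_re, Complex.I_im, Complex.sub_re,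
    Complex.one_re, Complex.one_im]
  ring

theorem cutPath_zero (c : ℂ) (a s : ℝ) : cutPath c a s 0 = -a := by
  simp [cutPath]

theorem cutPath_one (c : ℂ) (a s : ℝ) : cutPath c a s 1 = c := by
  simp [cutPath]

theorem continuous_cutPath (c : ℂ) (a s : ℝ) : Continuous (cutPath c a s) := by
  unfold cutPath
  fun_prop

theorem neg_cutPath_mem_slitPlane (ha : 0 < a) (hs : 0 < s) (hsc : c.im < 0 → s * a < -c.im)
    (ht₀ : 0 ≤ t) (ht₁ : t < 1) : -cutPath c a s t ∈ Complex.slitPlane := by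
  rw [Complex.mem_slitPlane_iff, Complex.neg_re, Complex.neg_im, neg_ne_zero, cutPath_re,
    cutPath_im]
  rcases ht₀.eq_or_lt with rfl | ht
  · left
    simpa using ha
  · right
    have bulge_pos : 0 < s * a * (1 - t) := mul_pos (mul_pos hs ha) (sub_pos.mpr ht₁)
    have bulge_le : s * a * (1 - t) ≤ s * a :=
      mul_le_of_le_one_right (mul_pos hs ha).le (by linarith)
    refine mul_ne_zero ht.ne' ?_
    rcases lt_or_ge c.im 0 with him | him
    · linarith [hsc him]
    · linarith

theorem eventually_abs_argPos_cutPath_sub_lt (ha : 0 < a) (hs : 0 < s) :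
    ∀ᶠ t : unitInterval in 𝓝 1, |argPos (cutPath c a s t) - argPos c| < Real.pi := by
  by_cases h : -c ∈ Complex.slitPlane
  · have continuousAt_dist :
        ContinuousAt (fun t : ℝ => |argPos (cutPath c a s t) - argPos c|) 1 := by
      have continuousAt_end : ContinuousAt argPos (cutPath c a s 1) := by
        rw [cutPath_one]
        exact continuousAt_argPos h
      exact ((continuousAt_end.comp (continuous_cutPath c a s).continuousAt).sub
        continuousAt_const).abs
    have eventually_lt : ∀ᶠ t : ℝ in 𝓝 1, |argPos (cutPath c a s t) - argPos c| < Real.pi :=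
      continuousAt_dist.eventually_lt continuousAt_const (by simp [cutPath_one, Real.pi_pos])
    exact (continuous_subtype_val.tendsto (1 : unitInterval)).eventually eventually_lt
  · have im_eq : c.im = 0 := by
      rw [Complex.mem_slitPlane_iff] at h
      simpa using (not_or.mp h).2
    rw [argPos_eq_zero_of_neg_notMem_slitPlane h]
    have eventually_pos : ∀ᶠ t : unitInterval in 𝓝 1, (0 : ℝ) < t :=
      continuousAt_const.eventually_lt continuous_subtype_val.continuousAt (by norm_num)
    filter_upwards [eventually_pos] with t ht
    rcases t.2.2.eq_or_lt with ht₁ | ht₁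
    · rw [ht₁, cutPath_one, argPos_eq_zero_of_neg_notMem_slitPlane h]
      simp [Real.pi_pos]
    · have im_pos : 0 < (cutPath c a s t).im := by
        rw [cutPath_im, im_eq, zero_add]
        exact mul_pos ht (mul_pos (mul_pos hs ha) (sub_pos.mpr ht₁))
      rw [sub_zero, argPos_of_im_nonneg im_pos.le,
        abs_of_nonneg (Complex.arg_nonneg_iff.mpr im_pos.le)]
      exact Complex.arg_lt_pi_iff.mpr (Or.inr im_pos.ne')

theorem mem_mspace_two_iff {z : Fin 2 → ℂ} : z ∈ Mspace 2 ↔ ∀ i, cutsM2 i z ≠ 0 := by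
  simp only [Mspace, cutsM2, Fin.forall_fin_succ, Set.mem_ofPred_eq]
  simp [sub_eq_zero]
  tauto

theorem continuous_cutsM2 (i : Fin 3) : Continuous (cutsM2 i) := by
  match i with
  | 0 => exact continuous_apply 0
  | 1 => exact continuous_apply 1
  | 2 => exact (continuous_apply 0).sub (continuous_apply 1)

theorem mem_mspace_two : (![-2, -1] : Fin 2 → ℂ) ∈ Mspace 2 := by
  rw [mem_mspace_two_iff]
  intro i
  fin_cases i <;> norm_num [cutsM2]

/-- `cutsM2 i ![-2, -1] = -cutScale i`. -/
def cutScale : Fin 3 → ℝ :=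
  ![2, 1, 1]

theorem cutScale_pos (i : Fin 3) : 0 < cutScale i := by
  fin_cases i <;> simp [cutScale]

theorem exists_bulge {ι : Type*} [Finite ι] (c : ι → ℂ) {a : ι → ℝ} (ha : ∀ i, 0 < a i) :
    ∃ s : ℝ, 0 < s ∧ ∀ i, (c i).im < 0 → s * a i < -(c i).im := by
  have small (i : ι) : ∀ᶠ s : ℝ in 𝓝[>] 0, (c i).im < 0 → s * a i < -(c i).im := by
    by_cases him : (c i).im < 0
    · filter_upwards [Ioo_mem_nhdsGT (div_pos (neg_pos.mpr him) (ha i))] with s hs _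
      exact (lt_div_iff₀ (ha i)).mp hs.2
    · exact Filter.Eventually.of_forall fun s h => absurd h him
  have pos : ∀ᶠ s : ℝ in 𝓝[>] 0, 0 < s := self_mem_nhdsWithin
  exact (pos.and (Filter.eventually_all.mpr small)).exists

/-- The path `(cutPath z₁ 2, cutPath z₂ 1)` from `(-2, -1)` to `z`; the difference of its
coordinates is again a `cutPath`. -/
noncomputable def cutPathM2 (z : Fin 2 → ℂ) (s : ℝ) : Path (![-2, -1] : Fin 2 → ℂ) z where
  toFun t := ![cutPath (z 0) 2 s t, cutPath (z 1) 1 s t]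
  continuous_toFun := by
    refine continuous_pi fun i => ?_
    fin_cases i <;> exact (continuous_cutPath _ _ _).comp continuous_subtype_val
  source' := by simp [cutPath_zero]
  target' := by
    ext i
    fin_cases i <;> simp [cutPath_one]

theorem cutsM2_cutPathM2 (z : Fin 2 → ℂ) (s : ℝ) (t : unitInterval) (i : Fin 3) :
    cutsM2 i (cutPathM2 z s t) = cutPath (cutsM2 i z) (cutScale i) s t := by
  change cutsM2 i ![cutPath (z 0) 2 s t, cutPath (z 1) 1 s t] = _
  fin_cases i
  · simp [cutsM2, cutScale]
  · simp [cutsM2, cutScale]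
  · simp [cutsM2, cutScale, cutPath]
    ring

theorem isCutStar_mspace_two : IsCutStar (Mspace 2) cutsM2 ![-2, -1] := by
  intro z hz
  obtain ⟨s, hs, hsc⟩ := exists_bulge (fun i => cutsM2 i z) cutScale_pos
  have neg_cuts_mem (t : unitInterval) (ht : t ≠ 1) (i : Fin 3) :
      -cutsM2 i (cutPathM2 z s t) ∈ Complex.slitPlane := by
    rw [cutsM2_cutPathM2]
    exact neg_cutPath_mem_slitPlane (cutScale_pos i) hs (hsc i) t.2.1
      (lt_of_le_of_ne t.2.2 fun h => ht (Subtype.ext h))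
  refine ⟨cutPathM2 z s, fun t => ?_, fun t ht i => ?_, ?_⟩
  · by_cases ht : t = 1
    · simpa [ht] using hz
    · exact mem_mspace_two_iff.mpr fun i =>
        neg_ne_zero.mp (Complex.slitPlane_ne_zero (neg_cuts_mem t ht i))
  · exact ContinuousAt.comp (f := cutsM2 i) (continuousAt_argPos (neg_cuts_mem t ht i))
      (continuous_cutsM2 i).continuousAt
  · rw [Filter.eventually_all]
    intro i
    simpa [cutsM2_cutPathM2, cutPath_one] using
      eventually_abs_argPos_cutPath_sub_lt (c := cutsM2 i z) (cutScale_pos i) hs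

end MultiFun

/-! ### Graded spaces and their graded duals -/

theorem isInternal_induction {ι R M : Type*} [DecidableEq ι] [Semiring R] [AddCommMonoid M]
    [Module R M] {N : ι → Submodule R M} (hN : DirectSum.IsInternal N) {p : M → Prop}
    (mem : ∀ i, ∀ x ∈ N i, p x) (zero : p 0) (add : ∀ a b, p a → p b → p (a + b)) (x : M) : p x :=
  Submodule.iSup_induction N (motive := p)
    (hN.submodule_iSup_eq_top ▸ Submodule.mem_top : x ∈ ⨆ i, N i) mem zero add

theorem isInternal_bilinear_induction {ι κ R M N Q : Type*} [DecidableEq ι] [DecidableEq κ]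
    [CommSemiring R] [AddCommMonoid M] [AddCommMonoid N] [AddCommMonoid Q] [Module R M] [Module R N]
    [Module R Q] {M' : ι → Submodule R M} {N' : κ → Submodule R N} (hM : DirectSum.IsInternal M')
    (hN : DirectSum.IsInternal N') {p : Q → Prop} {B : M →ₗ[R] N →ₗ[R] Q}
    (mem : ∀ i, ∀ x ∈ M' i, ∀ j, ∀ y ∈ N' j, p (B x y)) (zero : p 0)
    (add : ∀ a b, p a → p b → p (a + b)) (x : M) (y : N) : p (B x y) := by
  induction x using isInternal_induction hM with
  | mem i x hx =>
    induction y using isInternal_induction hN with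
    | mem j y hy => exact mem i x hx j y hy
    | zero => rwa [map_zero]
    | add a b ha hb => rw [map_add]; exact add _ _ ha hb
  | zero => rwa [map_zero, LinearMap.zero_apply]
  | add a b ha hb => rw [map_add, LinearMap.add_apply]; exact add _ _ ha hb

namespace VOA

variable {V : Type u} [AddCommGroup V] [Module ℂ V] (𝒱 : VOA V)

theorem wt_eq_bot_of_lt_lowest {n : ℤ} (hn : n < 𝒱.lowest) : 𝒱.wt n = ⊥ :=
  Classical.choose_spec 𝒱.lower_bounded n hn

theorem L_one_pow_eq_zero {h : ℤ} {v : V} (hv : v ∈ 𝒱.wt h) {j : ℕ}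
    (hj : h - 𝒱.lowest < j) : (𝒱.L 1 ^ j) v = 0 := by
  have mem := 𝒱.L_one_pow_mem h v hv j
  rwa [𝒱.wt_eq_bot_of_lt_lowest (by omega), Submodule.mem_bot] at mem

end VOA

namespace VData

variable {V : Type u} [AddCommGroup V] [Module ℂ V] {𝒱 : VOA V}

section Proj

variable {W : VData.{u, w} 𝒱}

theorem proj_of_mem (hW : DirectSum.IsInternal W.wt) {n : ℂ} {x : W} (hx : x ∈ W.wt n) :
    (W.proj n x : W) = x := by
  have bijective : Function.Bijective (DirectSum.coeLinearMap W.wt) := hW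
  have symm_apply : (LinearEquiv.ofBijective (DirectSum.coeLinearMap W.wt) bijective).symm x =
      DirectSum.of (fun n => W.wt n) n ⟨x, hx⟩ := by
    rw [LinearEquiv.symm_apply_eq, LinearEquiv.ofBijective_apply]
    exact (DirectSum.coeLinearMap_of W.wt n ⟨x, hx⟩).symm
  rw [proj, dif_pos bijective, LinearMap.comp_apply, LinearEquiv.coe_coe, symm_apply]
  change ((DirectSum.of (fun n => W.wt n) n ⟨x, hx⟩ : ⨁ n, W.wt n) n : W) = x
  rw [DirectSum.of_eq_same]

theorem proj_coe (hW : DirectSum.IsInternal W.wt) {n : ℂ} (x : W.wt n) :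
    W.proj n (x : W) = x :=
  Subtype.ext (proj_of_mem hW x.2)

theorem eq_zero_of_proj_eq_zero (hW : DirectSum.IsInternal W.wt) {x : W}
    (hx : ∀ n, W.proj n x = 0) : x = 0 := by
  have bijective : Function.Bijective (DirectSum.coeLinearMap W.wt) := hW
  refine (LinearEquiv.map_eq_zero_iff
    (LinearEquiv.ofBijective (DirectSum.coeLinearMap W.wt) bijective).symm).mp ?_
  ext n
  have hxn := hx n
  rw [proj, dif_pos bijective] at hxn
  exact congrArg Subtype.val hxn

theorem mem_wt_of_proj_eq_zero (hW : DirectSum.IsInternal W.wt) {x : W} {n : ℂ}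
    (h : ∀ m, m ≠ n → W.proj m x = 0) : x ∈ W.wt n := by
  suffices x = W.proj n x from this ▸ (W.proj n x).2
  rw [← sub_eq_zero]
  refine eq_zero_of_proj_eq_zero hW fun m => ?_
  rcases eq_or_ne m n with rfl | hm
  · rw [map_sub, proj_coe hW, sub_self]
  · rw [map_sub, h m hm, W.proj_of_ne hm.symm _ (W.proj n x).2, sub_self]

theorem dualWt_apply_proj (hW : DirectSum.IsInternal W.wt) {n : ℂ} {φ : Module.Dual ℂ W}
    (hφ : φ ∈ W.dualWt n) (x : W) : φ (W.proj n x : W) = φ x := by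
  induction x using isInternal_induction hW with
  | mem m x hx =>
    rcases eq_or_ne m n with rfl | hmn
    · rw [proj_of_mem hW hx]
    · rw [W.proj_of_ne hmn x hx, hφ m hmn x hx, Submodule.coe_zero, map_zero]
  | zero => simp
  | add a b ha hb => simp only [map_add, Submodule.coe_add, ha, hb]

theorem comp_proj_mem_dualWt (n : ℂ) (f : Module.Dual ℂ (W.wt n)) :
    f.comp (W.proj n) ∈ W.dualWt n := by
  intro m hm x hx
  rw [LinearMap.comp_apply, W.proj_of_ne hm x hx, map_zero]

variable (W) in
/-- The identification of `(W_[n])^*` with a subspace of `W'` by extension by zero. -/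
noncomputable def extendDual (n : ℂ) : Module.Dual ℂ (W.wt n) →ₗ[ℂ] W.gdual where
  toFun f := ⟨f.comp (W.proj n), Submodule.mem_iSup_of_mem n (comp_proj_mem_dualWt n f)⟩
  map_add' _ _ := rfl
  map_smul' _ _ := rfl

theorem extendDual_apply (n : ℂ) (f : Module.Dual ℂ (W.wt n)) (x : W) :
    (W.extendDual n f : Module.Dual ℂ W) x = f (W.proj n x) := rfl

theorem extendDual_mem (n : ℂ) (f : Module.Dual ℂ (W.wt n)) :
    W.extendDual n f ∈ W.contra.wt n :=
  comp_proj_mem_dualWt n f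

theorem extendDual_injective (hW : DirectSum.IsInternal W.wt) (n : ℂ) :
    Function.Injective (W.extendDual n) := by
  intro f g hfg
  ext x
  have apply_eq := congrArg (fun φ : W.gdual => (φ : Module.Dual ℂ W) (x : W)) hfg
  simpa only [extendDual_apply, proj_coe hW] using apply_eq

theorem eq_zero_of_dualWt_apply_eq_zero (hW : DirectSum.IsInternal W.wt) {x : W}
    (hx : ∀ n, ∀ φ ∈ W.dualWt n, φ x = 0) : x = 0 := by
  refine eq_zero_of_proj_eq_zero hW fun n => ?_
  rw [← Module.forall_dual_apply_eq_zero_iff ℂ]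
  exact fun f => hx n _ (comp_proj_mem_dualWt n f)

theorem ext_gdual (hW : DirectSum.IsInternal W.wt) {x y : W}
    (h : ∀ φ : W.gdual, (φ : Module.Dual ℂ W) x = (φ : Module.Dual ℂ W) y) : x = y := by
  rw [← sub_eq_zero]
  refine eq_zero_of_dualWt_apply_eq_zero hW fun n φ hφ => ?_
  rw [map_sub, h ⟨φ, Submodule.mem_iSup_of_mem n hφ⟩, sub_self]

theorem mem_wt_of_dualWt_apply_eq_zero (hW : DirectSum.IsInternal W.wt) {x : W} {n : ℂ}
    (h : ∀ m, m ≠ n → ∀ φ ∈ W.dualWt m, φ x = 0) : x ∈ W.wt n := by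
  refine mem_wt_of_proj_eq_zero hW fun m hm => ?_
  rw [← Module.forall_dual_apply_eq_zero_iff ℂ]
  exact fun f => h m hm _ (comp_proj_mem_dualWt m f)

theorem gdual_induction {p : W.gdual → Prop}
    (mem : ∀ n (φ : W.gdual), φ ∈ W.contra.wt n → p φ)
    (zero : p 0) (add : ∀ a b, p a → p b → p (a + b)) (φ : W.gdual) : p φ := by
  obtain ⟨φ, hφ⟩ := φ
  induction hφ using Submodule.iSup_induction' with
  | mem n φ hφ => exact mem n _ hφ
  | zero => exact zero
  | add φ ψ hφ hψ ihφ ihψ => exact add ⟨φ, hφ⟩ ⟨ψ, hψ⟩ ihφ ihψ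

theorem pairing_of_mem {n : ℂ} {φ : W.gdual} (hφ : φ ∈ W.contra.wt n) (y : W.Completion) :
    W.pairing φ y = (φ : Module.Dual ℂ W) (y n : W) :=
  finsum_eq_single _ n fun m hm => hφ m hm _ (y m).2

theorem pairing_add (φ ψ : W.gdual) (y : W.Completion) :
    W.pairing (φ + ψ) y = W.pairing φ y + W.pairing ψ y :=
  finsum_add_distrib (W.pairing_finite φ y) (W.pairing_finite ψ y)

theorem pairing_smul (c : ℂ) (φ : W.gdual) (y : W.Completion) :
    W.pairing (c • φ) y = c * W.pairing φ y :=
  (mul_finsum' _ c (W.pairing_finite φ y)).symm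

theorem pairing_zero (y : W.Completion) : W.pairing 0 y = 0 :=
  finsum_eq_zero_of_forall_eq_zero fun _ => rfl

end Proj

section LocallyFinite

variable {W : VData.{u, w} 𝒱} {s t : LogSeries W}

/-- Each weight component of the formal series `s` has finitely many terms, so that `W.eval ℓ s` is
not a junk value. -/
def IsLocallyFinite (s : LogSeries W) : Prop :=
  ∀ m : ℂ, {q : ℂ × ℕ | W.proj m (s q.1 q.2) ≠ 0}.Finite

theorem isLocallyFinite_zero : IsLocallyFinite (0 : LogSeries W) := by
  intro m
  simp

theorem IsLocallyFinite.add (hs : IsLocallyFinite s) (ht : IsLocallyFinite t) :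
    IsLocallyFinite (s + t) := by
  intro m
  refine ((hs m).union (ht m)).subset fun q hq => ?_
  by_contra hne
  simp only [Set.mem_union, Set.mem_ofPred_eq, not_or, not_not] at hne
  exact hq (by rw [Pi.add_apply, Pi.add_apply, map_add, hne.1, hne.2, add_zero])

theorem isLocallyFinite_of_homog {e : ℂ} (hs : ∀ n k, s n k ∈ W.wt (e - n - 1))
    (hlog : ∀ n, ∃ K : ℕ, ∀ k, K < k → s n k = 0) : IsLocallyFinite s := by
  intro m
  obtain ⟨K, hK⟩ := hlog (e - m - 1)
  refine ((Set.finite_singleton (e - m - 1)).prod (Set.finite_Iic K)).subset ?_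
  rintro ⟨n, k⟩ hq
  obtain rfl : n = e - m - 1 := by
    by_contra hne
    refine hq (W.proj_of_ne (fun h => hne ?_) _ (hs n k))
    rw [← h]
    ring
  refine ⟨rfl, ?_⟩
  by_contra hk
  exact hq (by rw [hK k (not_le.mp hk), map_zero])

theorem isLocallyFinite_Y (hW : DirectSum.IsInternal W.wt)
    (hlog : ∀ (v : V) (x : W), ∃ K : ℕ, ∀ (n : ℂ) (k : ℕ), K < k → W.Y v x n k = 0)
    (v : V) (x : W) : IsLocallyFinite (W.Y v x) := by
  refine isInternal_bilinear_induction 𝒱.internal hW (B := W.Y) (fun h v hv m x hx => ?_)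
    isLocallyFinite_zero (fun _ _ => .add) v x
  obtain ⟨K, hK⟩ := hlog v x
  exact isLocallyFinite_of_homog (W.homog h v hv m x hx) fun n => ⟨K, hK n⟩

end LocallyFinite

section Graded

variable {P W : VData.{u, w} 𝒱} {f : P →ₗ[ℂ] W}

/-- `f` preserves the weights. -/
def IsGraded (f : P →ₗ[ℂ] W) : Prop :=
  ∀ n, ∀ x ∈ P.wt n, f x ∈ W.wt n

/-- The extension of a map that preserves the weights to the completions. -/
def IsGraded.completion (hf : IsGraded f) (y : P.Completion) : W.Completion :=
  fun n => ⟨f (y n), hf n _ (y n).2⟩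

theorem IsGraded.map_proj (hf : IsGraded f) (hP : DirectSum.IsInternal P.wt)
    (hW : DirectSum.IsInternal W.wt) (n : ℂ) (x : P) : f (P.proj n x) = W.proj n (f x) := by
  induction x using isInternal_induction hP with
  | mem m x hx =>
    rcases eq_or_ne m n with rfl | hmn
    · rw [proj_of_mem hP hx, proj_of_mem hW (hf m x hx)]
    · rw [P.proj_of_ne hmn x hx, W.proj_of_ne hmn _ (hf m x hx), Submodule.coe_zero, map_zero,
        Submodule.coe_zero]
  | zero => simp
  | add a b ha hb => simp only [map_add, Submodule.coe_add, ha, hb]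

theorem IsGraded.map_eval (hf : IsGraded f) (hP : DirectSum.IsInternal P.wt)
    (hW : DirectSum.IsInternal W.wt) (ℓ : ℂ) {s : LogSeries P} (hs : IsLocallyFinite s) :
    hf.completion (P.eval ℓ s) = W.eval ℓ (fun n k => f (s n k)) := by
  funext m
  let fₘ : P.wt m →ₗ[ℂ] W.wt m := f.restrict fun x hx => hf m x hx
  have map_proj (x : P) : fₘ (P.proj m x) = W.proj m (f x) := Subtype.ext (hf.map_proj hP hW m x)
  change fₘ (P.eval ℓ s m) = _
  rw [eval, eval, ← LinearMap.toAddMonoidHom_coe, AddMonoidHom.map_finsum]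
  · simp only [LinearMap.toAddMonoidHom_coe, map_smul, map_proj]
  · exact (hs m).subset fun q hq proj_eq_zero => hq (by simp only [proj_eq_zero, smul_zero])

/-- The functional `φ ∘ f` on the source of a map `f` that preserves the weights. -/
def IsGraded.pullback (hf : IsGraded f) (φ : W.gdual) : P.gdual :=
  ⟨(φ : Module.Dual ℂ W).comp f, by
    induction φ using gdual_induction with
    | mem n φ hφ => exact Submodule.mem_iSup_of_mem n fun m hm x hx => hφ m hm _ (hf m x hx)
    | zero => exact zero_mem _
    | add a b ha hb => exact add_mem ha hb⟩

theorem IsGraded.pairing_pullback (hf : IsGraded f) (φ : W.gdual) (y : P.Completion) :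
    P.pairing (hf.pullback φ) y = W.pairing φ (hf.completion y) := rfl

end Graded
end VData

/-! ### The double contragredient -/

theorem sum_neg_one_pow_div_factorial {K : Type*} [Field K] [CharZero K] (m : ℕ) :
    ∑ j ∈ Finset.range (m + 1), (-1 : K) ^ j / ((j.factorial : K) * ((m - j).factorial : K)) =
      if m = 0 then 1 else 0 := by
  have alternating_sum : ∑ j ∈ Finset.range (m + 1), (-1 : K) ^ j * (m.choose j : K) =
      if m = 0 then 1 else 0 := by
    exact_mod_cast congrArg (Int.cast : ℤ → K) Int.alternating_sum_range_choose
  calc _ = ∑ j ∈ Finset.range (m + 1), (m.factorial : K)⁻¹ * ((-1 : K) ^ j * (m.choose j : K)) := by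
        refine Finset.sum_congr rfl fun j hj => ?_
        have factorial_ne_zero : (m.factorial : K) ≠ 0 := Nat.cast_ne_zero.mpr m.factorial_ne_zero
        rw [Nat.cast_choose K (Finset.mem_range_succ_iff.mp hj)]
        field_simp
    _ = (m.factorial : K)⁻¹ * if m = 0 then 1 else 0 := by rw [← Finset.mul_sum, alternating_sum]
    _ = if m = 0 then 1 else 0 := by split_ifs with h <;> simp [h]

/-- The power series identity `e^{-x} e^x = 1`, truncated at order `N`. -/
theorem sum_sum_neg_one_pow_div_factorial_mul {K : Type*} [Field K] [CharZero K] {N : ℕ}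
    (hN : 0 < N) (F : ℕ → K) :
    ∑ j ∈ Finset.range N, ∑ i ∈ Finset.range (N - j),
      (-1 : K) ^ j / ((j.factorial : K) * (i.factorial : K)) * F (j + i) = F 0 := by
  calc _ = ∑ m ∈ Finset.range N, ∑ j ∈ Finset.range (m + 1),
        (-1 : K) ^ j / ((j.factorial : K) * ((m - j).factorial : K)) * F (j + (m - j)) :=
        (Finset.sum_range_diag_flip N fun j i =>
          (-1 : K) ^ j / ((j.factorial : K) * (i.factorial : K)) * F (j + i)).symm
    _ = ∑ m ∈ Finset.range N, if m = 0 then F m else 0 := by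
        refine Finset.sum_congr rfl fun m _ => ?_
        trans (if m = 0 then 1 else 0) * F m
        · rw [← sum_neg_one_pow_div_factorial m, Finset.sum_mul]
          refine Finset.sum_congr rfl fun j hj => ?_
          rw [Nat.add_sub_cancel' (Finset.mem_range_succ_iff.mp hj)]
        · rw [ite_mul, one_mul, zero_mul]
    _ = F 0 := by simp [hN]

theorem neg_one_zpow_mul_neg_one_zpow_sub {K : Type*} [Field K] (h : ℤ) (j : ℕ) :
    (-1 : K) ^ h * (-1) ^ (h - j) = (-1) ^ j := by
  have neg_one_ne_zero : (-1 : K) ≠ 0 := neg_ne_zero.mpr one_ne_zero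
  rw [← zpow_add₀ neg_one_ne_zero, show h + (h - j) = 2 * (h - j) + j by ring,
    zpow_add₀ neg_one_ne_zero, zpow_natCast, (even_two_mul _).neg_one_zpow, one_mul]

namespace VData

variable {V : Type u} [AddCommGroup V] [Module ℂ V] {𝒱 : VOA V} {W : VData.{u, w} 𝒱}

theorem contraY_apply {h : ℤ} {v : V} (hv : v ∈ 𝒱.wt h) {N : ℕ}
    (hN : (h - 𝒱.lowest).toNat + 1 ≤ N) (φ : W.gdual) (n : ℂ) (k : ℕ) (x : W) :
    (W.contraY v φ n k : Module.Dual ℂ W) x = ∑ j ∈ Finset.range N,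
      ((-1 : ℂ) ^ h * (-1 : ℂ) ^ k / (j.factorial : ℂ)) *
        (φ : Module.Dual ℂ W) (W.Y ((𝒱.L 1 ^ j) v) x (2 * h - n - 2 - j) k) := by
  have contraY_eq : W.contraY v φ n k = ∑ j ∈ Finset.range N,
      ((-1 : ℂ) ^ h * (-1 : ℂ) ^ k / (j.factorial : ℂ)) •
        W.adj ((𝒱.L 1 ^ j) v) φ (2 * h - n - 2 - j) k := by
    rw [W.contraY_of_mem h v hv]
    refine Finset.sum_subset (Finset.range_mono hN) fun j _ hj => ?_
    rw [Finset.mem_range, not_lt] at hj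
    rw [𝒱.L_one_pow_eq_zero hv (by omega)]
    ext x
    simp [adj, adjFun]
  rw [contraY_eq]
  simp [adj, adjFun]

/-- The formula defining the contragredient vertex operators is an involution. -/
theorem sum_contraY_apply {h : ℤ} {v : V} (hv : v ∈ 𝒱.wt h) (φ : W.gdual) (n : ℂ) (k : ℕ)
    (x : W) : ∑ j ∈ Finset.range ((h - 𝒱.lowest).toNat + 1),
      ((-1 : ℂ) ^ h * (-1 : ℂ) ^ k / (j.factorial : ℂ)) *
        (W.contraY ((𝒱.L 1 ^ j) v) φ (2 * h - n - 2 - j) k : Module.Dual ℂ W) x =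
      (φ : Module.Dual ℂ W) (W.Y v x n k) := by
  set N := (h - 𝒱.lowest).toNat + 1
  let F (m : ℕ) : ℂ := (φ : Module.Dual ℂ W) (W.Y ((𝒱.L 1 ^ m) v) x (n - m) k)
  suffices ∀ j ∈ Finset.range N, ((-1 : ℂ) ^ h * (-1 : ℂ) ^ k / (j.factorial : ℂ)) *
        (W.contraY ((𝒱.L 1 ^ j) v) φ (2 * h - n - 2 - j) k : Module.Dual ℂ W) x =
      ∑ i ∈ Finset.range (N - j),
        (-1 : ℂ) ^ j / ((j.factorial : ℂ) * (i.factorial : ℂ)) * F (j + i) by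
    rw [Finset.sum_congr rfl this, sum_sum_neg_one_pow_div_factorial_mul (by omega)]
    simp [F]
  intro j hj
  rw [Finset.mem_range] at hj
  rw [contraY_apply (𝒱.L_one_pow_mem h v hv j) (N := N - j) (by omega), Finset.mul_sum]
  refine Finset.sum_congr rfl fun i _ => ?_
  have pow_apply : (𝒱.L 1 ^ i) ((𝒱.L 1 ^ j) v) = (𝒱.L 1 ^ (j + i)) v := by
    rw [← Module.End.mul_apply, ← pow_add, add_comm]
  have index_eq :
      2 * ((h - j : ℤ) : ℂ) - (2 * h - n - 2 - j) - 2 - i = n - ((j + i : ℕ) : ℂ) := by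
    push_cast
    ring
  have log_sign : (-1 : ℂ) ^ k * (-1) ^ k = 1 := by simp [← mul_pow]
  rw [pow_apply, index_eq, ← neg_one_zpow_mul_neg_one_zpow_sub h j]
  linear_combination ((-1 : ℂ) ^ h / (j.factorial : ℂ) *
    ((-1 : ℂ) ^ (h - j) / (i.factorial : ℂ)) * F (j + i)) * log_sign

end VData

namespace VData

variable {V : Type u} [AddCommGroup V] [Module ℂ V] {𝒱 : VOA V}

section LZero

variable {W W' : VData.{u, w} 𝒱} {g g' : V ≃ₗ[ℂ] V}

theorem L_zero_mem {m : ℂ} {x : W} (hx : x ∈ W.wt m) : W.L 0 x ∈ W.wt m := by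
  have coeff_mem := W.homog 2 𝒱.ω 𝒱.ω_mem m x hx ((0 : ℤ) + 1) 0
  rwa [show m + ((2 : ℤ) : ℂ) - ((0 : ℤ) + 1) - 1 = m by push_cast; ring] at coeff_mem

theorem isGraded_pow_L_zero_sub (n : ℂ) (K : ℕ) :
    IsGraded ((W.L 0 - n • (1 : Module.End ℂ W)) ^ K) := by
  intro m x hx
  induction K with
  | zero => simpa using hx
  | succ K ih =>
    rw [pow_succ', Module.End.mul_apply, LinearMap.sub_apply]
    exact sub_mem (L_zero_mem ih) (Submodule.smul_mem _ n ih)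

/-- Generalized eigenspaces of `L(0)` for distinct eigenvalues are disjoint, so all components of
`x` except the one of weight `n` vanish. -/
theorem mem_wt_of_pow_L_zero_sub_eq_zero (hW : IsTwistedModule g W) {n : ℂ} {K : ℕ} {x : W}
    (hx : ((W.L 0 - n • (1 : Module.End ℂ W)) ^ K) x = 0) : x ∈ W.wt n := by
  refine mem_wt_of_proj_eq_zero hW.internal fun m hm => ?_
  have killed := (isGraded_pow_L_zero_sub n K).map_proj hW.internal hW.internal m x
  rw [hx, map_zero, Submodule.coe_zero] at killed
  obtain ⟨K', -, killed'⟩ := hW.L_zero_grading m _ (W.proj m x).2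
  exact Subtype.ext <| Submodule.disjoint_def.mp ((W.L 0).disjoint_genEigenspace hm K' K) _
    (Module.End.mem_genEigenspace_nat.mpr killed') (Module.End.mem_genEigenspace_nat.mpr killed)

theorem map_pow_L_zero_sub {f : W →ₗ[ℂ] W'} (hf : IsModuleMap W W' f) (n : ℂ) (K : ℕ) (x : W) :
    f (((W.L 0 - n • (1 : Module.End ℂ W)) ^ K) x) =
      ((W'.L 0 - n • (1 : Module.End ℂ W')) ^ K) (f x) := by
  have comm : f ∘ₗ (W.L 0 - n • (1 : Module.End ℂ W)) =
      (W'.L 0 - n • (1 : Module.End ℂ W')) ∘ₗ f := by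
    ext y
    change f (W.L 0 y - n • y) = W'.L 0 (f y) - n • f y
    rw [map_sub, map_smul]
    exact congrArg (· - n • f y) (hf 𝒱.ω y _ 0)
  exact LinearMap.congr_fun (Module.End.commute_pow_left_of_commute comm.symm K).symm x

theorem isGraded_of_isModuleMap (hW : IsTwistedModule g W) (hW' : IsTwistedModule g' W')
    {f : W →ₗ[ℂ] W'} (hf : IsModuleMap W W' f) : IsGraded f := by
  intro n x hx
  obtain ⟨K, -, hK⟩ := hW.L_zero_grading n x hx
  exact mem_wt_of_pow_L_zero_sub_eq_zero hW' (by rw [← map_pow_L_zero_sub hf, hK, map_zero])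

end LZero

section FiniteDimensional

theorem rank_dual_wt_le_rank_contra_wt {W : VData.{u, w} 𝒱} (hW : DirectSum.IsInternal W.wt)
    (n : ℂ) : Module.rank ℂ (Module.Dual ℂ (W.wt n)) ≤ Module.rank ℂ (W.contra.wt n) :=
  LinearMap.rank_le_of_injective
    (LinearMap.codRestrict (W.contra.wt n) (W.extendDual n) (extendDual_mem n))
    fun _ _ hab => extendDual_injective hW n (congrArg Subtype.val hab)

theorem rank_wt_le_of_isEquivalent {W W' : VData.{u, w} 𝒱} {g g' : V ≃ₗ[ℂ] V}
    (hW : IsTwistedModule g W) (hW' : IsTwistedModule g' W') (h : IsEquivalent W W') (n : ℂ) :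
    Module.rank ℂ (W'.wt n) ≤ Module.rank ℂ (W.wt n) := by
  obtain ⟨e, he⟩ := h
  have isModuleMap_symm : IsModuleMap W' W e.symm.toLinearMap := by
    intro v x n k
    apply e.injective
    simpa using (he v (e.symm x) n k).symm
  exact LinearMap.rank_le_of_injective
    (e.symm.toLinearMap.restrict (isGraded_of_isModuleMap hW' hW isModuleMap_symm n))
    fun _ _ hab => Subtype.ext (e.symm.injective (congrArg Subtype.val hab))

/-- The dimension of an infinite-dimensional weight space would increase strictly with each
contragredient. -/
theorem finiteDimensional_wt {W : VData.{u, w} 𝒱} {g g' g'' : V ≃ₗ[ℂ] V}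
    (hW : IsTwistedModule g W) (hW' : IsTwistedModule g' W.contra)
    (hW'' : IsTwistedModule g'' W.contra.contra) (h : IsEquivalent W W.contra.contra) (n : ℂ) :
    FiniteDimensional ℂ (W.wt n) := by
  have rank_lt : ∀ {U : VData.{u, w} 𝒱}, DirectSum.IsInternal U.wt →
      Cardinal.aleph0 ≤ Module.rank ℂ (U.wt n) →
      Module.rank ℂ (U.wt n) < Module.rank ℂ (U.contra.wt n) := fun hU infinite =>
    lt_of_lt_of_le (by simpa using lift_rank_lt_rank_dual infinite)
      (rank_dual_wt_le_rank_contra_wt hU n)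
  by_contra infinite
  replace infinite : Cardinal.aleph0 ≤ Module.rank ℂ (W.wt n) := by
    rwa [← not_lt, Module.rank_lt_aleph0_iff]
  have contra_lt := rank_lt hW.internal infinite
  have contra_contra_lt := rank_lt hW'.internal (infinite.trans contra_lt.le)
  exact (contra_lt.trans contra_contra_lt).not_ge (rank_wt_le_of_isEquivalent hW hW'' h n)

end FiniteDimensional

section Transpose

theorem eq_extendDual {W : VData.{u, w} 𝒱} (hW : DirectSum.IsInternal W.wt) {n : ℂ} {φ : W.gdual}
    (hφ : φ ∈ W.contra.wt n) :
    φ = W.extendDual n ((φ : Module.Dual ℂ W).comp (W.wt n).subtype) := by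
  apply Subtype.ext
  ext x
  rw [extendDual_apply]
  exact (dualWt_apply_proj hW hφ x).symm

/-- Evaluation at `x`, as a functional on the contragredient. -/
noncomputable def evalDual (W : VData.{u, w} 𝒱) : W →ₗ[ℂ] Module.Dual ℂ W.contra :=
  LinearMap.flip (show W.gdual →ₗ[ℂ] Module.Dual ℂ W from W.gdual.subtype)

theorem evalDual_mem_dualWt {W : VData.{u, w} 𝒱} {n : ℂ} {x : W} (hx : x ∈ W.wt n) :
    W.evalDual x ∈ W.contra.dualWt n :=
  fun _ hm _ hφ => hφ n (Ne.symm hm) x hx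

theorem evalDual_mem_gdual {W : VData.{u, w} 𝒱} (hW : DirectSum.IsInternal W.wt) (x : W) :
    W.evalDual x ∈ W.contra.gdual := by
  induction x using isInternal_induction hW with
  | mem n x hx => exact Submodule.mem_iSup_of_mem n (evalDual_mem_dualWt hx)
  | zero => rw [map_zero]; exact zero_mem _
  | add a b ha hb => rw [map_add]; exact add_mem ha hb

/-- The canonical map from `W` to its double graded dual. -/
noncomputable def evalGdual {W : VData.{u, w} 𝒱} (hW : DirectSum.IsInternal W.wt) :
    W →ₗ[ℂ] W.contra.gdual :=
  W.evalDual.codRestrict W.contra.gdual (evalDual_mem_gdual hW)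

theorem exists_evalDual_eq_of_mem_dualWt {W : VData.{u, w} 𝒱} (hW : DirectSum.IsInternal W.wt)
    {n : ℂ} (hfd : FiniteDimensional ℂ (W.wt n)) {θ : Module.Dual ℂ W.contra}
    (hθ : θ ∈ W.contra.dualWt n) : ∃ x ∈ W.wt n, W.evalDual x = θ := by
  obtain ⟨x, hx⟩ := (Module.bijective_dual_eval ℂ (W.wt n)).2 (θ.comp (W.extendDual n))
  refine ⟨x, x.2, LinearMap.ext fun (φ : W.gdual) => ?_⟩
  induction φ using gdual_induction with
  | mem m φ hφ =>
    by_cases h : m = n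
    · subst h
      have eval_eq : (φ : Module.Dual ℂ W) x = θ (W.extendDual m _) :=
        LinearMap.congr_fun hx ((φ : Module.Dual ℂ W).comp (W.wt m).subtype)
      rw [← eq_extendDual hW hφ] at eval_eq
      exact eval_eq
    · exact (evalDual_mem_dualWt x.2 m h φ hφ).trans (hθ m h φ hφ).symm
  | zero => exact (map_zero (W.evalDual x)).trans (map_zero θ).symm
  | add a b ha hb =>
    exact (map_add (W.evalDual x) _ _).trans
      ((congrArg₂ (· + ·) ha hb).trans (map_add θ _ _).symm)

theorem evalGdual_bijective {W : VData.{u, w} 𝒱} (hW : DirectSum.IsInternal W.wt)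
    (hfd : ∀ n, FiniteDimensional ℂ (W.wt n)) : Function.Bijective (evalGdual hW) := by
  refine ⟨fun x y hxy => ext_gdual hW fun φ => ?_, fun θ => ?_⟩
  · exact LinearMap.congr_fun (congrArg Subtype.val hxy) φ
  · induction θ using gdual_induction with
    | mem n θ hθ =>
      obtain ⟨x, -, hx⟩ := exists_evalDual_eq_of_mem_dualWt hW (hfd n) hθ
      exact ⟨x, Subtype.ext hx⟩
    | zero => exact ⟨0, map_zero _⟩
    | add a b ha hb =>
      obtain ⟨x, rfl⟩ := ha
      obtain ⟨y, rfl⟩ := hb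
      exact ⟨x + y, map_add _ x y⟩

variable {W X : VData.{u, w} 𝒱}

/-- `f : X' → W` is the transpose of `Λ : W' → X`. -/
def IsTranspose (Λ : W.contra →ₗ[ℂ] X) (f : X.contra →ₗ[ℂ] W) : Prop :=
  ∀ (ψ : X.gdual) (φ : W.gdual), (φ : Module.Dual ℂ W) (f ψ) = (ψ : Module.Dual ℂ X) (Λ φ)

variable {Λ : W.contra →ₗ[ℂ] X} {f : X.contra →ₗ[ℂ] W}

theorem exists_isTranspose (hW : DirectSum.IsInternal W.wt)
    (hfd : ∀ n, FiniteDimensional ℂ (W.wt n)) (hΛ : IsGraded Λ) :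
    ∃ f : X.contra →ₗ[ℂ] W, IsTranspose Λ f := by
  let e := LinearEquiv.ofBijective (evalGdual hW) (evalGdual_bijective hW hfd)
  let pullback : X.gdual →ₗ[ℂ] W.contra.gdual :=
    { toFun := hΛ.pullback
      map_add' := fun _ _ => rfl
      map_smul' := fun _ _ => rfl }
  refine ⟨e.symm.toLinearMap.comp pullback, fun ψ φ => ?_⟩
  exact LinearMap.congr_fun (congrArg Subtype.val (e.apply_symm_apply (pullback ψ))) φ

theorem IsTranspose.isGraded (hf : IsTranspose Λ f) (hW : DirectSum.IsInternal W.wt)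
    (hΛ : IsGraded Λ) : IsGraded f := by
  intro n ψ hψ
  refine mem_wt_of_dualWt_apply_eq_zero hW fun m hm φ hφ => ?_
  exact (hf ψ ⟨φ, Submodule.mem_iSup_of_mem m hφ⟩).trans (hψ m hm _ (hΛ m _ hφ))

theorem IsTranspose.isModuleMap (hf : IsTranspose Λ f) (hW : DirectSum.IsInternal W.wt)
    (hΛ : IsModuleMap W.contra X Λ) : IsModuleMap X.contra W f := by
  intro v (ψ : X.gdual) n k
  change f (X.contraY v ψ n k) = W.Y v (f ψ) n k
  induction v using isInternal_induction 𝒱.internal with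
  | mem h v hv =>
    refine ext_gdual hW fun φ => ?_
    rw [hf, contraY_apply hv le_rfl, ← sum_contraY_apply hv φ n k (f ψ)]
    refine Finset.sum_congr rfl fun j _ => ?_
    rw [hf]
    exact congrArg (fun y => _ * (ψ : Module.Dual ℂ X) y) (hΛ _ φ _ _).symm
  | zero =>
    simp only [map_zero, LinearMap.zero_apply, Pi.zero_apply]
    exact map_zero f
  | add a b ha hb =>
    simp only [map_add, LinearMap.add_apply, Pi.add_apply]
    rw [← ha, ← hb]
    exact map_add f _ _

end Transpose
end VData

/-! ### The universal map out of the tensor product -/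

section BoxLift

variable {V : Type u} [AddCommGroup V] [Module ℂ V] {𝒱 : VOA V} {C : TwClass.{u, w} 𝒱} {z : ℂ}
  {g₁ g₂ : V ≃ₗ[ℂ] V} {W₁ W₂ W₃ : VData.{u, w} 𝒱} {I : W₁ ⊗[ℂ] W₂ →ₗ[ℂ] W₃.Completion}

theorem lamFun_mem_hboxSpace (hI : IsPzProduct C z g₁ g₂ W₁ W₂ W₃ I) (φ : W₃.gdual) :
    lamFun I φ ∈ hboxSpace C z g₁ g₂ W₁ W₂ :=
  Submodule.subset_span ⟨W₃, I, φ, hI, rfl⟩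

/-- The map `w₃' ↦ λ_{I, w₃'}` from `W₃'` to `W₁ ⊠̃ W₂`. -/
noncomputable def lamMap (hI : IsPzProduct C z g₁ g₂ W₁ W₂ W₃ I) :
    W₃.contra →ₗ[ℂ] hbox C z g₁ g₂ W₁ W₂ :=
  show W₃.gdual →ₗ[ℂ] hboxSpace C z g₁ g₂ W₁ W₂ from
  { toFun := fun φ => ⟨lamFun I φ, lamFun_mem_hboxSpace hI φ⟩
    map_add' := fun φ ψ => Subtype.ext <| LinearMap.ext fun _ => VData.pairing_add φ ψ _
    map_smul' := fun c φ => Subtype.ext <| LinearMap.ext fun _ => VData.pairing_smul c φ _ }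

theorem isGraded_lamMap (hI : IsPzProduct C z g₁ g₂ W₁ W₂ W₃ I) : VData.IsGraded (lamMap hI) :=
  fun _ φ hφ => Submodule.subset_span ⟨W₃, I, φ, hI, hφ, rfl⟩

theorem isHboxY_hboxY {g : V ≃ₗ[ℂ] V} (hX : IsTwistedModule g (hbox C z g₁ g₂ W₁ W₂)) :
    IsHboxY C z g₁ g₂ W₁ W₂ (hboxY C z g₁ g₂ W₁ W₂) := by
  by_cases h : ∃ T, IsHboxY C z g₁ g₂ W₁ W₂ T
  · unfold hboxY
    rw [dif_pos h]
    exact Classical.choose_spec h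
  · have hboxY_eq_zero : hboxY C z g₁ g₂ W₁ W₂ = 0 := dif_neg h
    have eq_zero (x : hboxSpace C z g₁ g₂ W₁ W₂) : x = 0 := by
      have identity : hboxY C z g₁ g₂ W₁ W₂ 𝒱.vac x (-1) 0 = x :=
        (hX.identity x (-1) 0).trans (if_pos ⟨rfl, rfl⟩)
      rw [hboxY_eq_zero] at identity
      exact identity.symm
    refine absurd ⟨0, fun W₃ I φ hI y _ v n k => ?_⟩ h
    exact (congrArg Subtype.val (eq_zero ⟨_, lamFun_mem_hboxSpace hI (W₃.contraY v φ n k)⟩)).symm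

theorem isModuleMap_lamMap {g : V ≃ₗ[ℂ] V} (hX : IsTwistedModule g (hbox C z g₁ g₂ W₁ W₂))
    (hI : IsPzProduct C z g₁ g₂ W₁ W₂ W₃ I) :
    IsModuleMap W₃.contra (hbox C z g₁ g₂ W₁ W₂) (lamMap hI) := fun v φ n k =>
  Subtype.ext (isHboxY_hboxY hX W₃ I φ hI (lamMap hI φ) rfl v n k).symm

@[elab_as_elim]
theorem hbox_induction {p : hbox C z g₁ g₂ W₁ W₂ → Prop}
    (lam : ∀ (W₃ : VData.{u, w} 𝒱) (I : W₁ ⊗[ℂ] W₂ →ₗ[ℂ] W₃.Completion)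
      (hI : IsPzProduct C z g₁ g₂ W₁ W₂ W₃ I) (φ : W₃.gdual), p (lamMap hI φ))
    (zero : p 0) (add : ∀ a b, p a → p b → p (a + b)) (x : hbox C z g₁ g₂ W₁ W₂) : p x := by
  obtain ⟨x, hx⟩ := x
  unfold hboxSpace at hx
  induction hx using Submodule.closure_induction with
  | zero => exact zero
  | add a b _ _ ha hb => exact add _ _ ha hb
  | smul_mem c y hy =>
    obtain ⟨W₃, I, φ, hI, rfl⟩ := hy
    have scaled := lam W₃ I hI (c • φ)
    rwa [show lamMap hI (c • φ : W₃.gdual) = c • lamMap hI φ from map_smul (lamMap hI) c _]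
      at scaled

theorem TensorAssumption.finiteDimensional (hT : TensorAssumption C z)
    (hC : ∀ g W, C g W → IsTwistedModule g W) {g : V ≃ₗ[ℂ] V} {W : VData.{u, w} 𝒱} (hW : C g W)
    (n : ℂ) : FiniteDimensional ℂ (W.wt n) :=
  VData.finiteDimensional_wt (hC g W hW) (hC _ _ (hT.contra_mem g W hW))
    (hC _ _ (hT.contra_mem _ _ (hT.contra_mem g W hW))) (hT.double_contra g W hW) n

/-- `f` is the graded module map from `W₁ ⊠ W₂` to `W₃` dual to `w₃' ↦ λ_{I, w₃'}`, i.e. the map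
through which the product `(W₃, I)` factors. -/
structure IsBoxLift (hI : IsPzProduct C z g₁ g₂ W₁ W₂ W₃ I)
    (f : boxProd C z g₁ g₂ W₁ W₂ →ₗ[ℂ] W₃) : Prop where
  isModuleMap : IsModuleMap (boxProd C z g₁ g₂ W₁ W₂) W₃ f
  isGraded : VData.IsGraded f
  isTranspose : VData.IsTranspose (lamMap hI) f

variable (C z g₁ g₂ W₁ W₂) in
/-- Every `P(z)`-product of `W₁` and `W₂` admits a factorization through `W₁ ⊠ W₂`. -/
def HasBoxLifts : Prop :=
  ∀ ⦃W₃ : VData.{u, w} 𝒱⦄ ⦃I : W₁ ⊗[ℂ] W₂ →ₗ[ℂ] W₃.Completion⦄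
    (hI : IsPzProduct C z g₁ g₂ W₁ W₂ W₃ I), ∃ f, IsBoxLift hI f

theorem TensorAssumption.hasBoxLifts (hT : TensorAssumption C z)
    (hC : ∀ g W, C g W → IsTwistedModule g W) (h₁ : C g₁ W₁) (h₂ : C g₂ W₂) :
    HasBoxLifts C z g₁ g₂ W₁ W₂ := by
  intro W₃ I hI
  have hW₃ := (hC _ _ hI.1).internal
  obtain ⟨f, hf⟩ :=
    VData.exists_isTranspose hW₃ (hT.finiteDimensional hC hI.1) (isGraded_lamMap hI)
  exact ⟨f, hf.isModuleMap hW₃ (isModuleMap_lamMap (hC _ _ (hT.hbox_mem _ _ _ _ h₁ h₂)) hI),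
    hf.isGraded hW₃ (isGraded_lamMap hI), hf⟩

theorem boxFun_apply_of_mem (hX : DirectSum.IsInternal (hbox C z g₁ g₂ W₁ W₂).wt)
    (t : W₁ ⊗[ℂ] W₂) {n : ℂ} {x : hboxSpace C z g₁ g₂ W₁ W₂}
    (hx : x ∈ (hbox C z g₁ g₂ W₁ W₂).wt n) :
    boxFun C z g₁ g₂ W₁ W₂ n t x = (x : Module.Dual ℂ (W₁ ⊗[ℂ] W₂)) t :=
  congrArg (fun y : hboxSpace C z g₁ g₂ W₁ W₂ => (y : Module.Dual ℂ (W₁ ⊗[ℂ] W₂)) t)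
    (VData.proj_of_mem hX hx)

theorem IsBoxLift.map_boxMap {hI : IsPzProduct C z g₁ g₂ W₁ W₂ W₃ I}
    {f : boxProd C z g₁ g₂ W₁ W₂ →ₗ[ℂ] W₃} (hf : IsBoxLift hI f)
    (hX : DirectSum.IsInternal (hbox C z g₁ g₂ W₁ W₂).wt) (hW : DirectSum.IsInternal W₃.wt)
    (t : W₁ ⊗[ℂ] W₂) (n : ℂ) :
    f (boxMap C z g₁ g₂ W₁ W₂ t n : boxProd C z g₁ g₂ W₁ W₂) = (I t n : W₃) := by
  refine VData.ext_gdual hW fun φ => ?_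
  induction φ using VData.gdual_induction with
  | mem m φ hφ =>
    refine (hf.isTranspose _ φ).trans ?_
    change boxFun C z g₁ g₂ W₁ W₂ n t (lamMap hI φ) = _
    have lamMap_mem := isGraded_lamMap hI m φ hφ
    by_cases h : m = n
    · subst h
      rw [boxFun_apply_of_mem hX t lamMap_mem]
      exact VData.pairing_of_mem hφ _
    · exact (boxFun_mem C z g₁ g₂ W₁ W₂ n t m h _ lamMap_mem).trans
        (hφ n (Ne.symm h) _ (I t n).2).symm
  | zero => rfl
  | add a b ha hb =>
    rw [Submodule.coe_add, LinearMap.add_apply, LinearMap.add_apply, ha, hb]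

/-- `W₁ ⊗ W₂` separates the points of the weight spaces of `W₁ ⊠̃ W₂`, so by finite dimensionality
it maps onto their duals. -/
theorem exists_boxMap_eq (hX : DirectSum.IsInternal (hbox C z g₁ g₂ W₁ W₂).wt) {n : ℂ}
    (hfd : FiniteDimensional ℂ ((hbox C z g₁ g₂ W₁ W₂).wt n))
    {ψ : boxProd C z g₁ g₂ W₁ W₂} (hψ : ψ ∈ (boxProd C z g₁ g₂ W₁ W₂).wt n) :
    ∃ t : W₁ ⊗[ℂ] W₂, (boxMap C z g₁ g₂ W₁ W₂ t n : boxProd C z g₁ g₂ W₁ W₂) = ψ := by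
  let incl : (hbox C z g₁ g₂ W₁ W₂).wt n →ₗ[ℂ] Module.Dual ℂ (W₁ ⊗[ℂ] W₂) :=
    (hboxSpace C z g₁ g₂ W₁ W₂).subtype.comp ((hbox C z g₁ g₂ W₁ W₂).wt n).subtype
  have incl_injective : Function.Injective incl := fun _ _ hab => Subtype.ext (Subtype.ext hab)
  obtain ⟨t, ht⟩ := LinearMap.flip_surjective_iff₁.mpr incl_injective
    ((Subtype.val ψ : Module.Dual ℂ (hbox C z g₁ g₂ W₁ W₂)).comp
      ((hbox C z g₁ g₂ W₁ W₂).wt n).subtype)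
  refine ⟨t, Eq.symm ((VData.eq_extendDual hX hψ).trans ?_)⟩
  rw [← ht]
  rfl

theorem boxProd_hom_ext (hX : DirectSum.IsInternal (hbox C z g₁ g₂ W₁ W₂).wt)
    (hfd : ∀ n, FiniteDimensional ℂ ((hbox C z g₁ g₂ W₁ W₂).wt n))
    {f f' : boxProd C z g₁ g₂ W₁ W₂ →ₗ[ℂ] W₃}
    (h : ∀ (t : W₁ ⊗[ℂ] W₂) (n : ℂ),
      f (boxMap C z g₁ g₂ W₁ W₂ t n : boxProd C z g₁ g₂ W₁ W₂) =
        f' (boxMap C z g₁ g₂ W₁ W₂ t n : boxProd C z g₁ g₂ W₁ W₂)) : f = f' := by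
  refine LinearMap.ext fun (ψ : (hbox C z g₁ g₂ W₁ W₂).gdual) => ?_
  induction ψ using VData.gdual_induction with
  | mem n ψ hψ =>
    obtain ⟨t, ht⟩ := exists_boxMap_eq hX (hfd n) hψ
    rw [← ht]
    exact h t n
  | zero => exact (map_zero f).trans (map_zero f').symm
  | add a b ha hb =>
    exact (map_add f _ _).trans ((congrArg₂ (· + ·) ha hb).trans (map_add f' _ _).symm)

theorem HasBoxLifts.gdual_induction (hlift : HasBoxLifts C z g₁ g₂ W₁ W₂)
    (hX : DirectSum.IsInternal (hbox C z g₁ g₂ W₁ W₂).wt)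
    (hfd : ∀ n, FiniteDimensional ℂ ((hbox C z g₁ g₂ W₁ W₂).wt n))
    {p : (boxProd C z g₁ g₂ W₁ W₂).gdual → Prop}
    (pullback : ∀ (W₃ : VData.{u, w} 𝒱) (I : W₁ ⊗[ℂ] W₂ →ₗ[ℂ] W₃.Completion)
      (hI : IsPzProduct C z g₁ g₂ W₁ W₂ W₃ I) (f : boxProd C z g₁ g₂ W₁ W₂ →ₗ[ℂ] W₃)
      (hf : IsBoxLift hI f) (φ : W₃.gdual), p (hf.isGraded.pullback φ))
    (zero : p 0) (add : ∀ a b, p a → p b → p (a + b))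
    (θ : (boxProd C z g₁ g₂ W₁ W₂).gdual) : p θ := by
  obtain ⟨x, rfl⟩ := (VData.evalGdual_bijective hX hfd).2 θ
  induction x using hbox_induction with
  | lam W₃ I hI φ =>
    obtain ⟨f, hf⟩ := hlift hI
    have eq_pullback : VData.evalGdual hX (lamMap hI φ) = hf.isGraded.pullback φ :=
      Subtype.ext <| LinearMap.ext fun ψ => (hf.isTranspose ψ φ).symm
    rw [eq_pullback]
    exact pullback W₃ I hI f hf φ
  | zero => rw [map_zero]; exact zero
  | add a b ha hb => rw [map_add]; exact add _ _ ha hb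

theorem HasBoxLifts.ext (hlift : HasBoxLifts C z g₁ g₂ W₁ W₂)
    {y y' : boxProd C z g₁ g₂ W₁ W₂}
    (h : ∀ (W₃ : VData.{u, w} 𝒱) (I : W₁ ⊗[ℂ] W₂ →ₗ[ℂ] W₃.Completion)
      (hI : IsPzProduct C z g₁ g₂ W₁ W₂ W₃ I) (f : boxProd C z g₁ g₂ W₁ W₂ →ₗ[ℂ] W₃),
      IsBoxLift hI f → f y = f y') : y = y' := by
  refine Subtype.ext <| LinearMap.ext fun x => ?_
  induction x using hbox_induction with
  | lam W₃ I hI φ =>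
    obtain ⟨f, hf⟩ := hlift hI
    exact (hf.isTranspose y φ).symm.trans
      ((congrArg (φ : Module.Dual ℂ W₃) (h W₃ I hI f hf)).trans (hf.isTranspose y' φ))
  | zero => exact (map_zero (Subtype.val y)).trans (map_zero (Subtype.val y')).symm
  | add a b ha hb =>
    exact (map_add (Subtype.val y) a b).trans
      ((congrArg₂ (· + ·) ha hb).trans (map_add (Subtype.val y') a b).symm)

end BoxLift

/-! ### Recovering the coefficients of an intertwining operator from its values at one point -/

section LogPolynomial

open Polynomial

/-- If `x ^ (-n - 1) p(log x)` is a term of a formal series, then the corresponding term of its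
`j`-th derivative is `x ^ (-n - j - 1) q(log x)` with `q = logPolyDeriv n j p`. -/
noncomputable def logPolyDeriv (n : ℂ) : ℕ → ℂ[X] →ₗ[ℂ] ℂ[X]
  | 0 => LinearMap.id
  | j + 1 => (derivative - (n + j + 1) • LinearMap.id) ∘ₗ logPolyDeriv n j

theorem logPolyDeriv_succ_apply (n : ℂ) (j : ℕ) (p : ℂ[X]) :
    logPolyDeriv n (j + 1) p =
      derivative (logPolyDeriv n j p) - (n + j + 1) • logPolyDeriv n j p := rfl

theorem eq_zero_of_forall_eval_iterate_derivative {R : Type*} [CommRing R] [IsDomain R] [CharZero R]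
    {p : R[X]} {t : R} (h : ∀ i, (derivative^[i] p).eval t = 0) : p = 0 := by
  by_contra hp
  exact lt_irrefl _ ((lt_rootMultiplicity_iff_isRoot_iterate_derivative hp).mpr fun i _ => h i)

theorem eval_iterate_derivative_logPolyDeriv {n ℓ : ℂ} {p : ℂ[X]}
    (h : ∀ j, (logPolyDeriv n j p).eval ℓ = 0) (i j : ℕ) :
    (derivative^[i] (logPolyDeriv n j p)).eval ℓ = 0 := by
  induction i generalizing j with
  | zero => exact h j
  | succ i ih =>
    have derivative_eq : derivative (logPolyDeriv n j p) =
        logPolyDeriv n (j + 1) p + (n + j + 1) • logPolyDeriv n j p := by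
      rw [logPolyDeriv_succ_apply, sub_add_cancel]
    rw [Function.iterate_succ_apply, derivative_eq, iterate_map_add,
      iterate_derivative_smul, eval_add, eval_smul, ih, ih, smul_zero, add_zero]

/-- The values at the point with logarithm `ℓ` of `x ^ (-n - 1) p(log x)` and its derivatives. -/
noncomputable def logJet (n ℓ : ℂ) : ℂ[X] →ₗ[ℂ] ℕ → ℂ :=
  LinearMap.pi fun j => Complex.exp ((-(n + j) - 1) * ℓ) • leval ℓ ∘ₗ logPolyDeriv n j

theorem logJet_apply (n ℓ : ℂ) (p : ℂ[X]) (j : ℕ) :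
    logJet n ℓ p j = Complex.exp ((-(n + j) - 1) * ℓ) * (logPolyDeriv n j p).eval ℓ := rfl

theorem logJet_injective (n ℓ : ℂ) : Function.Injective (logJet n ℓ) := by
  rw [injective_iff_map_eq_zero]
  intro p hp
  refine eq_zero_of_forall_eval_iterate_derivative (t := ℓ) fun i =>
    eval_iterate_derivative_logPolyDeriv (n := n) (fun j => ?_) i 0
  have value_eq_zero := congrFun hp j
  rw [logJet_apply] at value_eq_zero
  exact (mul_eq_zero.mp value_eq_zero).resolve_left (Complex.exp_ne_zero _)

theorem exists_polynomial_coeff {R : Type*} [Semiring R] {s : ℕ → R} {K : ℕ}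
    (hs : ∀ k, K < k → s k = 0) : ∃ p : R[X], ∀ k, p.coeff k = s k := by
  refine ⟨∑ k ∈ Finset.range (K + 1), monomial k (s k), fun k => ?_⟩
  simp only [finsetSum_coeff, coeff_monomial, Finset.sum_ite_eq', Finset.mem_range]
  split_ifs with h
  · rfl
  · exact (hs k (by omega)).symm

end LogPolynomial

section PairingEval

variable {V : Type u} [AddCommGroup V] [Module ℂ V] {𝒱 : VOA V}

theorem VData.pairing_eval_of_mem {W : VData.{u, w} 𝒱} (hW : DirectSum.IsInternal W.wt)
    {s : LogSeries W} (hs : VData.IsLocallyFinite s) (ℓ : ℂ) {m : ℂ} {φ : W.gdual}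
    (hφ : φ ∈ W.contra.wt m) : W.pairing φ (W.eval ℓ s) =
      ∑ᶠ q : ℂ × ℕ,
        Complex.exp ((-q.1 - 1) * ℓ) * ℓ ^ q.2 * (φ : Module.Dual ℂ W) (s q.1 q.2) := by
  let φₘ : Module.Dual ℂ (W.wt m) := (φ : Module.Dual ℂ W).comp (W.wt m).subtype
  have apply_proj (x : W) : φₘ (W.proj m x) = (φ : Module.Dual ℂ W) x :=
    VData.dualWt_apply_proj hW hφ x
  rw [VData.pairing_of_mem hφ]
  change φₘ (W.eval ℓ s m) = _
  rw [VData.eval, ← LinearMap.toAddMonoidHom_coe, AddMonoidHom.map_finsum]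
  · simp only [LinearMap.toAddMonoidHom_coe, map_smul, apply_proj, smul_eq_mul]
  · exact (hs m).subset fun q hq proj_eq_zero => hq (by simp only [proj_eq_zero, smul_zero])

theorem VData.pairing_eval_of_homog {W : VData.{u, w} 𝒱} (hW : DirectSum.IsInternal W.wt)
    {s : LogSeries W} {e : ℂ} (hs : ∀ n k, s n k ∈ W.wt (e - n - 1))
    (hlog : ∀ n, ∃ K : ℕ, ∀ k, K < k → s n k = 0) (ℓ : ℂ) {n : ℂ} {φ : W.gdual}
    (hφ : φ ∈ W.contra.wt (e - n - 1)) {p : Polynomial ℂ}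
    (hp : ∀ k, p.coeff k = (φ : Module.Dual ℂ W) (s n k)) :
    W.pairing φ (W.eval ℓ s) = Complex.exp ((-n - 1) * ℓ) * p.eval ℓ := by
  rw [VData.pairing_eval_of_mem hW (VData.isLocallyFinite_of_homog hs hlog) ℓ hφ,
    finsum_eq_sum_of_support_subset (s := p.support.map (.sectR n ℕ)), Finset.sum_map,
    Polynomial.eval_eq_sum, Polynomial.sum, Finset.mul_sum]
  · refine Finset.sum_congr rfl fun k _ => ?_
    simp only [Function.Embedding.sectR_apply, hp]
    ring
  · rintro ⟨n', k⟩ hq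
    have apply_ne_zero : (φ : Module.Dual ℂ W) (s n' k) ≠ 0 := right_ne_zero_of_mul hq
    obtain rfl : n' = n := by
      by_contra hn
      refine apply_ne_zero (hφ _ (fun h => hn ?_) _ (hs n' k))
      linear_combination -h
    simpa [hp] using apply_ne_zero

theorem VData.L_neg_one_pow_mem {W : VData.{u, w} 𝒱} {m : ℂ} {x : W} (hx : x ∈ W.wt m) (j : ℕ) :
    (W.L (-1) ^ j) x ∈ W.wt (m + j) := by
  induction j with
  | zero => simpa using hx
  | succ j ih =>
    have coeff_mem := W.homog 2 𝒱.ω 𝒱.ω_mem _ _ ih ((-1 : ℤ) + 1) 0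
    rw [show m + j + ((2 : ℤ) : ℂ) - ((-1 : ℤ) + 1) - 1 = m + ((j + 1 : ℕ) : ℂ) by
      push_cast; ring] at coeff_mem
    rwa [pow_succ', Module.End.mul_apply]

variable {W₁ W₂ W₃ : VData.{u, w} 𝒱} {𝒴 : W₁ →ₗ[ℂ] W₂ →ₗ[ℂ] LogSeries W₃}

theorem IsTwistedIntertwiningOperator.coeff_logPolyDeriv
    (h𝒴 : IsTwistedIntertwiningOperator W₁ W₂ W₃ 𝒴) {n : ℂ} {x₁ : W₁} {x₂ : W₂}
    {φ : Module.Dual ℂ W₃} {p : Polynomial ℂ} (hp : ∀ k, p.coeff k = φ (𝒴 x₁ x₂ n k)) (j k : ℕ) :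
    (logPolyDeriv n j p).coeff k = φ (𝒴 ((W₁.L (-1) ^ j) x₁) x₂ (n + j) k) := by
  induction j generalizing k with
  | zero => simpa [logPolyDeriv] using hp k
  | succ j ih =>
    rw [logPolyDeriv_succ_apply, Polynomial.coeff_sub, Polynomial.coeff_derivative,
      Polynomial.coeff_smul, ih, ih, pow_succ', Module.End.mul_apply, h𝒴.L_neg_one_derivative,
      show n + ((j + 1 : ℕ) : ℂ) - 1 = n + j by push_cast; ring, map_add, map_smul, map_smul,
      smul_eq_mul, smul_eq_mul, smul_eq_mul]
    push_cast
    ring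

theorem IsTwistedIntertwiningOperator.pairing_eval_L_neg_one_pow
    (hW : DirectSum.IsInternal W₃.wt) (h𝒴 : IsTwistedIntertwiningOperator W₁ W₂ W₃ 𝒴)
    {m₁ m₂ n : ℂ} {x₁ : W₁} {x₂ : W₂} (hx₁ : x₁ ∈ W₁.wt m₁) (hx₂ : x₂ ∈ W₂.wt m₂) {φ : W₃.gdual}
    (hφ : φ ∈ W₃.contra.wt (m₁ + m₂ - n - 1)) {p : Polynomial ℂ}
    (hp : ∀ k, p.coeff k = (φ : Module.Dual ℂ W₃) (𝒴 x₁ x₂ n k)) (ℓ : ℂ) (j : ℕ) :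
    W₃.pairing φ (W₃.eval ℓ (𝒴 ((W₁.L (-1) ^ j) x₁) x₂)) = logJet n ℓ p j := by
  rw [← show m₁ + j + m₂ - (n + j) - 1 = m₁ + m₂ - n - 1 by ring] at hφ
  exact VData.pairing_eval_of_homog hW
    (h𝒴.homog _ _ _ (VData.L_neg_one_pow_mem hx₁ j) _ hx₂) (h𝒴.log_finite _ _) ℓ hφ
    (h𝒴.coeff_logPolyDeriv hp j)

end PairingEval

section BoxOperator

open Polynomial (lcoeff)

variable {V : Type u} [AddCommGroup V] [Module ℂ V] {𝒱 : VOA V}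

/-- `𝒴` is a twisted intertwining operator whose value at `z` is the map `I`, so that it witnesses
that `I` is a `P(z)`-intertwining map. -/
structure IsPzOperator (z : ℂ) {W₁ W₂ W₃ : VData.{u, w} 𝒱} (I : W₁ ⊗[ℂ] W₂ →ₗ[ℂ] W₃.Completion)
    (𝒴 : W₁ →ₗ[ℂ] W₂ →ₗ[ℂ] LogSeries W₃) : Prop where
  isTwistedIntertwiningOperator : IsTwistedIntertwiningOperator W₁ W₂ W₃ 𝒴
  apply_tmul : ∀ (x₁ : W₁) (x₂ : W₂), I (x₁ ⊗ₜ[ℂ] x₂) = W₃.eval (lBranch 0 z) (𝒴 x₁ x₂)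

/-- The values of a functional at `L(-1) ^ j x₁ ⊗ x₂`. On `λ_{I, w₃'}` these are the values at `z`
of the derivatives of the intertwining operator behind `I`. -/
noncomputable def descendantValues {W₁ W₂ : VData.{u, w} 𝒱} (x₁ : W₁) (x₂ : W₂) :
    Module.Dual ℂ (W₁ ⊗[ℂ] W₂) →ₗ[ℂ] ℕ → ℂ :=
  LinearMap.pi fun j => Module.Dual.eval ℂ (W₁ ⊗[ℂ] W₂) (((W₁.L (-1) ^ j) x₁) ⊗ₜ[ℂ] x₂)

variable {C : TwClass.{u, w} 𝒱} {z : ℂ} {g₁ g₂ : V ≃ₗ[ℂ] V} {W₁ W₂ W₃ : VData.{u, w} 𝒱}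
  {m₁ m₂ n : ℂ} {x₁ : W₁} {x₂ : W₂}

theorem IsPzOperator.exists_logJet_eq {I : W₁ ⊗[ℂ] W₂ →ₗ[ℂ] W₃.Completion}
    {𝒴 : W₁ →ₗ[ℂ] W₂ →ₗ[ℂ] LogSeries W₃} (h : IsPzOperator z I 𝒴)
    (hW : DirectSum.IsInternal W₃.wt) (hx₁ : x₁ ∈ W₁.wt m₁) (hx₂ : x₂ ∈ W₂.wt m₂) {φ : W₃.gdual}
    (hφ : φ ∈ W₃.contra.wt (m₁ + m₂ - n - 1)) :
    ∃ p, logJet n (lBranch 0 z) p = descendantValues x₁ x₂ (lamFun I φ) ∧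
      ∀ k, p.coeff k = (φ : Module.Dual ℂ W₃) (𝒴 x₁ x₂ n k) := by
  have h𝒴 := h.isTwistedIntertwiningOperator
  obtain ⟨K, hK⟩ := h𝒴.log_finite x₁ x₂ n
  obtain ⟨p, hp⟩ := exists_polynomial_coeff (K := K)
    (s := fun k => (φ : Module.Dual ℂ W₃) (𝒴 x₁ x₂ n k)) (fun k hk => by rw [hK k hk, map_zero])
  refine ⟨p, funext fun j => ?_, hp⟩
  rw [← h𝒴.pairing_eval_L_neg_one_pow hW hx₁ hx₂ hφ hp, ← h.apply_tmul]
  rfl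

theorem hboxWtSpan_le_comap_range_logJet (hC : ∀ g W, C g W → IsTwistedModule g W)
    (hx₁ : x₁ ∈ W₁.wt m₁) (hx₂ : x₂ ∈ W₂.wt m₂) :
    hboxWtSpan C z g₁ g₂ W₁ W₂ (m₁ + m₂ - n - 1) ≤
      (LinearMap.range (logJet n (lBranch 0 z))).comap (descendantValues x₁ x₂) := by
  refine Submodule.span_le.mpr ?_
  rintro _ ⟨W₃, I, φ, hI, hφ, rfl⟩
  obtain ⟨𝒴, h𝒴, hI𝒴⟩ := hI.2
  obtain ⟨p, hp, -⟩ :=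
    IsPzOperator.exists_logJet_eq ⟨h𝒴, hI𝒴⟩ (hC _ _ hI.1).internal hx₁ hx₂ hφ
  exact ⟨p, hp⟩

theorem exists_logJet_eq_descendantValues (hC : ∀ g W, C g W → IsTwistedModule g W)
    (hx₁ : x₁ ∈ W₁.wt m₁) (hx₂ : x₂ ∈ W₂.wt m₂) :
    ∃ T : (hbox C z g₁ g₂ W₁ W₂).wt (m₁ + m₂ - n - 1) →ₗ[ℂ] Polynomial ℂ,
      ∀ x (hx : x ∈ (hbox C z g₁ g₂ W₁ W₂).wt (m₁ + m₂ - n - 1)),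
        logJet n (lBranch 0 z) (T ⟨x, hx⟩) =
          descendantValues x₁ x₂ (Subtype.val x : Module.Dual ℂ (W₁ ⊗[ℂ] W₂)) := by
  let values : (hbox C z g₁ g₂ W₁ W₂).wt (m₁ + m₂ - n - 1) →ₗ[ℂ]
      LinearMap.range (logJet n (lBranch 0 z)) :=
    (descendantValues x₁ x₂ ∘ₗ (hboxSpace C z g₁ g₂ W₁ W₂).subtype ∘ₗ
      ((hbox C z g₁ g₂ W₁ W₂).wt (m₁ + m₂ - n - 1)).subtype).codRestrict _
      fun x => hboxWtSpan_le_comap_range_logJet hC hx₁ hx₂ x.2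
  let jetEquiv := LinearEquiv.ofInjective _ (logJet_injective n (lBranch 0 z))
  exact ⟨jetEquiv.symm.toLinearMap ∘ₗ values, fun x hx =>
    congrArg Subtype.val (jetEquiv.apply_symm_apply (values ⟨x, hx⟩))⟩

theorem exists_lcoeff_comp_eq_zero {R M : Type*} [CommRing R] [AddCommGroup M] [Module R M]
    [Module.Finite R M] (T : M →ₗ[R] Polynomial R) : ∃ N, ∀ k, N ≤ k → lcoeff R k ∘ₗ T = 0 := by
  obtain ⟨S, hS⟩ := Module.Finite.fg_top (R := R) (M := M)
  refine ⟨S.sup fun x => (T x).natDegree + 1, fun k hk => LinearMap.ext_on hS fun x hx => ?_⟩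
  exact Polynomial.coeff_eq_zero_of_natDegree_lt
    (Nat.lt_of_succ_le ((Finset.le_sup (f := fun x => (T x).natDegree + 1) hx).trans hk))

variable (C z g₁ g₂) in
/-- For every `P(z)`-product `(W₃, I)`, each intertwining operator `𝒴` behind `I` and all `k`, the
map from `W₁ ⊠ W₂` to `W₃` sends `Y k` to the coefficient of `x ^ (-n - 1) (log x) ^ k` in
`𝒴(x₁, x) x₂`. -/
def IsBoxCoeff (x₁ : W₁) (x₂ : W₂) (n : ℂ) (Y : ℕ →₀ boxProd C z g₁ g₂ W₁ W₂) : Prop :=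
  ∀ (W₃ : VData.{u, w} 𝒱) (I : W₁ ⊗[ℂ] W₂ →ₗ[ℂ] W₃.Completion)
    (hI : IsPzProduct C z g₁ g₂ W₁ W₂ W₃ I) (f : boxProd C z g₁ g₂ W₁ W₂ →ₗ[ℂ] W₃),
    IsBoxLift hI f → ∀ 𝒴, IsPzOperator z I 𝒴 → ∀ k, f (Y k) = 𝒴 x₁ x₂ n k

theorem isBoxCoeff_of_extendDual (hC : ∀ g W, C g W → IsTwistedModule g W)
    (hX : DirectSum.IsInternal (hbox C z g₁ g₂ W₁ W₂).wt)
    (hx₁ : x₁ ∈ W₁.wt m₁) (hx₂ : x₂ ∈ W₂.wt m₂)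
    {T : (hbox C z g₁ g₂ W₁ W₂).wt (m₁ + m₂ - n - 1) →ₗ[ℂ] Polynomial ℂ}
    (hT : ∀ x (hx : x ∈ (hbox C z g₁ g₂ W₁ W₂).wt (m₁ + m₂ - n - 1)),
      logJet n (lBranch 0 z) (T ⟨x, hx⟩) =
        descendantValues x₁ x₂ (Subtype.val x : Module.Dual ℂ (W₁ ⊗[ℂ] W₂)))
    {Y : ℕ →₀ boxProd C z g₁ g₂ W₁ W₂}
    (hY : ∀ k, Y k = (hbox C z g₁ g₂ W₁ W₂).extendDual _ (lcoeff ℂ k ∘ₗ T)) :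
    IsBoxCoeff C z g₁ g₂ x₁ x₂ n Y := by
  intro W₃ I hI f hf 𝒴 h𝒴 k
  have hW := (hC _ _ hI.1).internal
  refine VData.ext_gdual hW fun φ => ?_
  refine (hf.isTranspose (Y k) φ).trans ?_
  rw [hY k]
  induction φ using VData.gdual_induction with
  | mem m φ hφ =>
    have lam_mem := isGraded_lamMap hI m φ hφ
    by_cases h : m = m₁ + m₂ - n - 1
    · subst h
      obtain ⟨p, hp, coeff_p⟩ := h𝒴.exists_logJet_eq hW hx₁ hx₂ hφ
      rw [← coeff_p, ← logJet_injective n (lBranch 0 z) ((hT _ lam_mem).trans hp.symm)]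
      exact congrArg (fun x => (T x).coeff k) (VData.proj_coe hX ⟨_, lam_mem⟩)
    · exact (VData.extendDual_mem _ _ m h _ lam_mem).trans
        (hφ _ (Ne.symm h) _ (h𝒴.isTwistedIntertwiningOperator.homog _ _ _ hx₁ _ hx₂ n k)).symm
  | zero => exact (congrArg _ (map_zero (lamMap hI))).trans (map_zero (Subtype.val _))
  | add a b ha hb =>
    rw [Submodule.coe_add, LinearMap.add_apply, ← ha, ← hb]
    exact (congrArg _ (map_add (lamMap hI) a b)).trans (map_add (Subtype.val _) _ _)

theorem exists_isBoxCoeff_of_mem (hC : ∀ g W, C g W → IsTwistedModule g W)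
    (hX : DirectSum.IsInternal (hbox C z g₁ g₂ W₁ W₂).wt)
    (hfd : ∀ n, FiniteDimensional ℂ ((hbox C z g₁ g₂ W₁ W₂).wt n))
    (hx₁ : x₁ ∈ W₁.wt m₁) (hx₂ : x₂ ∈ W₂.wt m₂) (n : ℂ) :
    ∃ Y, IsBoxCoeff C z g₁ g₂ x₁ x₂ n Y := by
  obtain ⟨T, hT⟩ :=
    exists_logJet_eq_descendantValues (z := z) (g₁ := g₁) (g₂ := g₂) (n := n) hC hx₁ hx₂
  have := hfd (m₁ + m₂ - n - 1)
  obtain ⟨N, hN⟩ := exists_lcoeff_comp_eq_zero T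
  let coeffs (k : ℕ) : boxProd C z g₁ g₂ W₁ W₂ :=
    (hbox C z g₁ g₂ W₁ W₂).extendDual _ (lcoeff ℂ k ∘ₗ T)
  have mem_range_of_ne_zero (k : ℕ) (hk : coeffs k ≠ 0) : k ∈ Finset.range N := by
    rw [Finset.mem_range]
    by_contra! hNk
    exact hk ((congrArg _ (hN k hNk)).trans (map_zero _))
  exact ⟨Finsupp.onFinset (Finset.range N) coeffs mem_range_of_ne_zero,
    isBoxCoeff_of_extendDual hC hX hx₁ hx₂ hT fun _ => rfl⟩

namespace IsBoxCoeff

variable {x₁' : W₁} {x₂' : W₂} {Y Y' : ℕ →₀ boxProd C z g₁ g₂ W₁ W₂}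

theorem zero_left : IsBoxCoeff C z g₁ g₂ (0 : W₁) x₂ n 0 := by
  intro _ _ _ _ _ _ _ _
  simp

theorem zero_right : IsBoxCoeff C z g₁ g₂ x₁ (0 : W₂) n 0 := by
  intro _ _ _ _ _ _ _ _
  simp

theorem add_left (h : IsBoxCoeff C z g₁ g₂ x₁ x₂ n Y) (h' : IsBoxCoeff C z g₁ g₂ x₁' x₂ n Y') :
    IsBoxCoeff C z g₁ g₂ (x₁ + x₁') x₂ n (Y + Y') := by
  intro W₃ I hI f hf 𝒴 h𝒴 k
  rw [Finsupp.add_apply, map_add, map_add, h W₃ I hI f hf 𝒴 h𝒴, h' W₃ I hI f hf 𝒴 h𝒴]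
  rfl

theorem add_right (h : IsBoxCoeff C z g₁ g₂ x₁ x₂ n Y) (h' : IsBoxCoeff C z g₁ g₂ x₁ x₂' n Y') :
    IsBoxCoeff C z g₁ g₂ x₁ (x₂ + x₂') n (Y + Y') := by
  intro W₃ I hI f hf 𝒴 h𝒴 k
  rw [Finsupp.add_apply, map_add, map_add, h W₃ I hI f hf 𝒴 h𝒴, h' W₃ I hI f hf 𝒴 h𝒴]
  rfl

theorem smul_left (c : ℂ) (h : IsBoxCoeff C z g₁ g₂ x₁ x₂ n Y) :
    IsBoxCoeff C z g₁ g₂ (c • x₁) x₂ n (c • Y) := by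
  intro W₃ I hI f hf 𝒴 h𝒴 k
  rw [Finsupp.smul_apply, map_smul, map_smul, h W₃ I hI f hf 𝒴 h𝒴]
  rfl

theorem smul_right (c : ℂ) (h : IsBoxCoeff C z g₁ g₂ x₁ x₂ n Y) :
    IsBoxCoeff C z g₁ g₂ x₁ (c • x₂) n (c • Y) := by
  intro W₃ I hI f hf 𝒴 h𝒴 k
  rw [Finsupp.smul_apply, map_smul, map_smul, h W₃ I hI f hf 𝒴 h𝒴]
  rfl

theorem unique (hlift : HasBoxLifts C z g₁ g₂ W₁ W₂) (h : IsBoxCoeff C z g₁ g₂ x₁ x₂ n Y)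
    (h' : IsBoxCoeff C z g₁ g₂ x₁ x₂ n Y') : Y = Y' := by
  ext1 k
  refine hlift.ext fun W₃ I hI f hf => ?_
  obtain ⟨𝒴, h𝒴, hI𝒴⟩ := hI.2
  rw [h W₃ I hI f hf 𝒴 ⟨h𝒴, hI𝒴⟩, h' W₃ I hI f hf 𝒴 ⟨h𝒴, hI𝒴⟩]

end IsBoxCoeff

theorem exists_isBoxCoeff (hC : ∀ g W, C g W → IsTwistedModule g W)
    (hX : DirectSum.IsInternal (hbox C z g₁ g₂ W₁ W₂).wt)
    (hfd : ∀ n, FiniteDimensional ℂ ((hbox C z g₁ g₂ W₁ W₂).wt n))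
    (hW₁ : DirectSum.IsInternal W₁.wt) (hW₂ : DirectSum.IsInternal W₂.wt)
    (x₁ : W₁) (x₂ : W₂) (n : ℂ) : ∃ Y, IsBoxCoeff C z g₁ g₂ x₁ x₂ n Y := by
  induction x₁ using isInternal_induction hW₁ with
  | mem m₁ x₁ hx₁ =>
    induction x₂ using isInternal_induction hW₂ with
    | mem m₂ x₂ hx₂ => exact exists_isBoxCoeff_of_mem hC hX hfd hx₁ hx₂ n
    | zero => exact ⟨0, .zero_right⟩
    | add a b ha hb => exact ⟨_, ha.choose_spec.add_right hb.choose_spec⟩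
  | zero => exact ⟨0, .zero_left⟩
  | add a b ha hb => exact ⟨_, ha.choose_spec.add_left hb.choose_spec⟩

variable (C z g₁ g₂) in
/-- `𝒴` is the operator with values in `W₁ ⊠ W₂` from which all intertwining operators defining
`P(z)`-products arise by composition with the maps from `W₁ ⊠ W₂`. -/
structure IsBoxOperator (𝒴 : W₁ →ₗ[ℂ] W₂ →ₗ[ℂ] LogSeries (boxProd C z g₁ g₂ W₁ W₂)) : Prop where
  log_finite : ∀ x₁ x₂ n, ∃ K : ℕ, ∀ k, K < k → 𝒴 x₁ x₂ n k = 0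
  map_coeff : ∀ ⦃W₃ : VData.{u, w} 𝒱⦄ ⦃I : W₁ ⊗[ℂ] W₂ →ₗ[ℂ] W₃.Completion⦄
    ⦃hI : IsPzProduct C z g₁ g₂ W₁ W₂ W₃ I⦄ ⦃f : boxProd C z g₁ g₂ W₁ W₂ →ₗ[ℂ] W₃⦄,
    IsBoxLift hI f → ∀ ⦃𝒴₃⦄, IsPzOperator z I 𝒴₃ →
      ∀ x₁ x₂ n k, f (𝒴 x₁ x₂ n k) = 𝒴₃ x₁ x₂ n k

theorem exists_isBoxOperator (hC : ∀ g W, C g W → IsTwistedModule g W)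
    (hX : DirectSum.IsInternal (hbox C z g₁ g₂ W₁ W₂).wt)
    (hfd : ∀ n, FiniteDimensional ℂ ((hbox C z g₁ g₂ W₁ W₂).wt n))
    (hlift : HasBoxLifts C z g₁ g₂ W₁ W₂)
    (hW₁ : DirectSum.IsInternal W₁.wt) (hW₂ : DirectSum.IsInternal W₂.wt) :
    ∃ 𝒴, IsBoxOperator C z g₁ g₂ (W₁ := W₁) (W₂ := W₂) 𝒴 := by
  choose Y hY using fun (x₁ : W₁) (x₂ : W₂) (n : ℂ) =>
    exists_isBoxCoeff hC hX hfd hW₁ hW₂ x₁ x₂ n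
  have unique {x₁ : W₁} {x₂ : W₂} {n : ℂ} {Y'} (h : IsBoxCoeff C z g₁ g₂ x₁ x₂ n Y') (k : ℕ) :
      Y x₁ x₂ n k = Y' k := DFunLike.congr_fun ((hY x₁ x₂ n).unique hlift h) k
  let 𝒴 : W₁ →ₗ[ℂ] W₂ →ₗ[ℂ] LogSeries (boxProd C z g₁ g₂ W₁ W₂) :=
    LinearMap.mk₂ ℂ (fun x₁ x₂ n k => Y x₁ x₂ n k)
      (fun a b x₂ => funext₂ fun n => unique ((hY a x₂ n).add_left (hY b x₂ n)))
      (fun c a x₂ => funext₂ fun n => unique ((hY a x₂ n).smul_left c))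
      (fun x₁ a b => funext₂ fun n => unique ((hY x₁ a n).add_right (hY x₁ b n)))
      (fun c x₁ a => funext₂ fun n => unique ((hY x₁ a n).smul_right c))
  refine ⟨𝒴, fun x₁ x₂ n => ⟨(Y x₁ x₂ n).support.sup id, fun k hk => ?_⟩,
    fun W₃ I hI f hf 𝒴₃ h𝒴₃ x₁ x₂ n => hY x₁ x₂ n W₃ I hI f hf 𝒴₃ h𝒴₃⟩
  exact Finsupp.notMem_support_iff.mp fun hk' => hk.not_ge (Finset.le_sup (f := id) hk')

end BoxOperator

/-! ### Duality and convergence of products for a single functional -/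

theorem MultiFun.IsBranchOn.congr {n : ℕ} {Ω : Set (Fin n → ℂ)} {f : MultiFun n Ω} {ι : Type*}
    {R : Set (Fin n → ℂ)} {c : ι → (Fin n → ℂ) → ℂ} {F F' : (Fin n → ℂ) → ℂ}
    (hF : f.IsBranchOn R c F) (hR : IsOpen R) (h : Set.EqOn F F' R) : f.IsBranchOn R c F' := by
  intro z hz
  obtain ⟨ψ, hψ, eventually_eq⟩ := hF z hz
  refine ⟨ψ, hψ, ?_⟩
  filter_upwards [eventually_eq, hR.mem_nhds hz] with z' eq_of_cut hz' cut
  rw [← h hz', eq_of_cut cut]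

section SingleFunctional

variable {V : Type u} [AddCommGroup V] [Module ℂ V] {𝒱 : VOA V} {W₁ W₂ W₃ : VData.{u, w} 𝒱}

/-- The duality property of `𝒴` for a single functional `φ`: the condition `duality` of
`IsTwistedIntertwiningOperator`, in a form that can be proved by induction on `φ`. -/
def DualityAt (𝒴 : W₁ →ₗ[ℂ] W₂ →ₗ[ℂ] LogSeries W₃) (a : V) (x₁ : W₁) (x₂ : W₂) (φ : W₃.gdual) :
    Prop :=
  ∃ (f : MultiFun 2 (Mspace 2)) (F : (Fin 2 → ℂ) → ℂ),
    f.IsBranchOn (Mspace 2) cutsM2 F ∧ ∀ z₁ z₂ : ℂ,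
    (‖z₂‖ < ‖z₁‖ → 0 < ‖z₂‖ →
      Summable (fun r : ℂ => W₃.pairing φ (W₃.eval (lBranch 0 z₁)
        (W₃.Y a (W₃.eval (lBranch 0 z₂) (𝒴 x₁ x₂) r)))) ∧
      (|argPos (z₁ - z₂) - argPos z₁| < Real.pi / 2 →
        ∑' r : ℂ, W₃.pairing φ (W₃.eval (lBranch 0 z₁)
          (W₃.Y a (W₃.eval (lBranch 0 z₂) (𝒴 x₁ x₂) r))) = F ![z₁, z₂])) ∧
    (‖z₁‖ < ‖z₂‖ → 0 < ‖z₁‖ →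
      Summable (fun r : ℂ => W₃.pairing φ (W₃.eval (lBranch 0 z₂)
        (𝒴 x₁ (W₂.eval (lBranch 0 z₁) (W₂.Y a x₂) r)))) ∧
      (-(3 * Real.pi / 2) < argPos (z₁ - z₂) - argPos z₂ →
        argPos (z₁ - z₂) - argPos z₂ < -(Real.pi / 2) →
        ∑' r : ℂ, W₃.pairing φ (W₃.eval (lBranch 0 z₂)
          (𝒴 x₁ (W₂.eval (lBranch 0 z₁) (W₂.Y a x₂) r))) = F ![z₁, z₂])) ∧
    (‖z₁ - z₂‖ < ‖z₂‖ → 0 < ‖z₁ - z₂‖ →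
      Summable (fun r : ℂ => W₃.pairing φ (W₃.eval (lBranch 0 z₂)
        (𝒴 (W₁.eval (lBranch 0 (z₁ - z₂)) (W₁.Y a x₁) r) x₂))) ∧
      (|argPos z₁ - argPos z₂| < Real.pi / 2 →
        ∑' r : ℂ, W₃.pairing φ (W₃.eval (lBranch 0 z₂)
          (𝒴 (W₁.eval (lBranch 0 (z₁ - z₂)) (W₁.Y a x₁) r) x₂)) = F ![z₁, z₂]))

/-- The convergence and extension property of products for a single functional `φ`: the condition
`products` of `IsTwistedIntertwiningOperator`, in a form that can be proved by induction on `φ`. -/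
def ProductsAt (𝒴 : W₁ →ₗ[ℂ] W₂ →ₗ[ℂ] LogSeries W₃) (r : ℕ) (a : Fin r → V) (x₁ : W₁) (x₂ : W₂)
    (φ : W₃.gdual) : Prop :=
  (∀ z : Fin (r + 1) → ℂ, StrictAnti (fun i => ‖z i‖) → 0 < ‖z (Fin.last r)‖ →
    Summable fun n : Fin r → ℂ => W₃.pairing φ
      (nestedProd W₃ r a (Fin.init z) n (W₃.eval (lBranch 0 (z (Fin.last r))) (𝒴 x₁ x₂)))) ∧
  ∃ f : MultiFun (r + 1) (Mspace (r + 1)),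
    f.IsBranchOn {z | StrictAnti (fun i => ‖z i‖) ∧ 0 < ‖z (Fin.last r)‖} (fun i z => z i)
      (fun z => ∑' n : Fin r → ℂ, W₃.pairing φ (nestedProd W₃ r a (Fin.init z) n
        (W₃.eval (lBranch 0 (z (Fin.last r))) (𝒴 x₁ x₂)))) ∧
    ∀ (A : GL (Fin (r + 1)) ℂ) (β : Fin (r + 1) → ℂ) (δ : Fin (r + 1) → Bool),
      MultiFun.IsComponentIsolated (Mspace (r + 1)) A β δ → f.IsRegularSingularity A β δ

section Add

variable {𝒴 : W₁ →ₗ[ℂ] W₂ →ₗ[ℂ] LogSeries W₃} {x₁ : W₁} {x₂ : W₂} {φ ψ : W₃.gdual}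

theorem dualityAt_zero (a : V) : DualityAt 𝒴 a x₁ x₂ 0 := by
  refine ⟨_, 0, MultiFun.isBranchOn_zero MultiFun.isCutStar_mspace_two subset_rfl
    MultiFun.mem_mspace_two, fun z₁ z₂ => ?_⟩
  simp only [VData.pairing_zero, tsum_zero, Pi.zero_apply, summable_zero, implies_true, and_self]

theorem DualityAt.add {a : V} (hφ : DualityAt 𝒴 a x₁ x₂ φ) (hψ : DualityAt 𝒴 a x₁ x₂ ψ) :
    DualityAt 𝒴 a x₁ x₂ (φ + ψ) := by
  obtain ⟨f, F, hF, hf⟩ := hφ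
  obtain ⟨g, G, hG, hg⟩ := hψ
  obtain ⟨_, _, hFG⟩ := MultiFun.exists_isBranchOn_add MultiFun.isCutStar_mspace_two subset_rfl
    MultiFun.mem_mspace_two hF hG
  refine ⟨_, _, hFG, fun z₁ z₂ => ?_⟩
  obtain ⟨prodF, revProdF, iterateF⟩ := hf z₁ z₂
  obtain ⟨prodG, revProdG, iterateG⟩ := hg z₁ z₂
  simp only [VData.pairing_add, Pi.add_apply]
  refine ⟨fun h h' => ?_, fun h h' => ?_, fun h h' => ?_⟩
  · obtain ⟨summableF, eqF⟩ := prodF h h'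
    obtain ⟨summableG, eqG⟩ := prodG h h'
    exact ⟨summableF.add summableG, fun harg => by
      rw [summableF.tsum_add summableG, eqF harg, eqG harg]⟩
  · obtain ⟨summableF, eqF⟩ := revProdF h h'
    obtain ⟨summableG, eqG⟩ := revProdG h h'
    exact ⟨summableF.add summableG, fun harg harg' => by
      rw [summableF.tsum_add summableG, eqF harg harg', eqG harg harg']⟩
  · obtain ⟨summableF, eqF⟩ := iterateF h h'
    obtain ⟨summableG, eqG⟩ := iterateG h h'
    exact ⟨summableF.add summableG, fun harg => by
      rw [summableF.tsum_add summableG, eqF harg, eqG harg]⟩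

variable {r : ℕ} {a : Fin r → V}

theorem productsAt_zero (a : Fin r → V) : ProductsAt 𝒴 r a x₁ x₂ 0 := by
  obtain ⟨b, hb, hstar⟩ := MultiFun.exists_isCutStar_radialRegion r
  unfold ProductsAt
  simp only [VData.pairing_zero, tsum_zero, summable_zero, implies_true, true_and]
  exact ⟨_, MultiFun.isBranchOn_zero hstar (MultiFun.radialRegion_subset r) hb,
    fun A β δ _ => MultiFun.isRegularSingularity_zero _ A β δ⟩

theorem ProductsAt.add (hφ : ProductsAt 𝒴 r a x₁ x₂ φ) (hψ : ProductsAt 𝒴 r a x₁ x₂ ψ) :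
    ProductsAt 𝒴 r a x₁ x₂ (φ + ψ) := by
  obtain ⟨summableF, f, hF, hf⟩ := hφ
  obtain ⟨summableG, g, hG, hg⟩ := hψ
  obtain ⟨b, hb, hstar⟩ := MultiFun.exists_isCutStar_radialRegion r
  obtain ⟨_, _, hFG⟩ := MultiFun.exists_isBranchOn_add hstar (MultiFun.radialRegion_subset r) hb
    hF hG
  unfold ProductsAt
  simp only [VData.pairing_add]
  refine ⟨fun z h h' => (summableF z h h').add (summableG z h h'), _,
    hFG.congr (MultiFun.isLogConvex_radialRegion r).isOpen fun z hz => ?_, fun A β δ h => ?_⟩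
  · exact ((summableF z hz.1 hz.2).tsum_add (summableG z hz.1 hz.2)).symm
  · exact (MultiFun.isRegularSingularity_rebase_iff.mpr (hf A β δ h)).sum
      (MultiFun.isRegularSingularity_rebase_iff.mpr (hg A β δ h))

end Add

section Pullback

variable {P : VData.{u, w} 𝒱} {f : P →ₗ[ℂ] W₃} {𝒴P : W₁ →ₗ[ℂ] W₂ →ₗ[ℂ] LogSeries P}
  {𝒴 : W₁ →ₗ[ℂ] W₂ →ₗ[ℂ] LogSeries W₃} {x₁ : W₁} {x₂ : W₂} {φ : W₃.gdual}

theorem VData.IsGraded.map_eval_operator (hf : VData.IsGraded f)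
    (hP : DirectSum.IsInternal P.wt) (hW : DirectSum.IsInternal W₃.wt)
    (hloc : VData.IsLocallyFinite (𝒴P x₁ x₂))
    (hf𝒴 : ∀ x₁ x₂ n k, f (𝒴P x₁ x₂ n k) = 𝒴 x₁ x₂ n k) (ℓ : ℂ) :
    hf.completion (P.eval ℓ (𝒴P x₁ x₂)) = W₃.eval ℓ (𝒴 x₁ x₂) := by
  rw [hf.map_eval hP hW ℓ hloc]
  simp only [hf𝒴]

variable {g : V ≃ₗ[ℂ] V}

theorem VData.IsGraded.map_eval_Y (hf : VData.IsGraded f) (hfm : IsModuleMap P W₃ f)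
    (hP : IsTwistedModule g P) (hW : DirectSum.IsInternal W₃.wt) (ℓ : ℂ) (a : V) (y : P) :
    hf.completion (P.eval ℓ (P.Y a y)) = W₃.eval ℓ (W₃.Y a (f y)) := by
  rw [hf.map_eval hP.internal hW ℓ (VData.isLocallyFinite_Y hP.internal hP.log_bounded a y)]
  simp only [hfm a y]

theorem VData.IsGraded.map_nestedProd (hf : VData.IsGraded f) (hfm : IsModuleMap P W₃ f)
    (hP : IsTwistedModule g P) (hW : DirectSum.IsInternal W₃.wt) (r : ℕ) (a : Fin r → V)
    (z n : Fin r → ℂ) (y : P.Completion) :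
    hf.completion (nestedProd P r a z n y) = nestedProd W₃ r a z n (hf.completion y) := by
  induction r with
  | zero => rfl
  | succ r ih =>
    rw [nestedProd, nestedProd, hf.map_eval_Y hfm hP hW, ← ih]
    rfl

variable (hf : VData.IsGraded f) (hfm : IsModuleMap P W₃ f) (hP : IsTwistedModule g P)
  (hW : DirectSum.IsInternal W₃.wt) (hloc : ∀ x₁ x₂, VData.IsLocallyFinite (𝒴P x₁ x₂))
  (hf𝒴 : ∀ x₁ x₂ n k, f (𝒴P x₁ x₂ n k) = 𝒴 x₁ x₂ n k)
include hfm hP hW hloc hf𝒴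

theorem DualityAt.pullback {a : V} (h : DualityAt 𝒴 a x₁ x₂ φ) :
    DualityAt 𝒴P a x₁ x₂ (hf.pullback φ) := by
  have map_eval (ℓ : ℂ) (x₁ : W₁) (x₂ : W₂) :
      hf.completion (P.eval ℓ (𝒴P x₁ x₂)) = W₃.eval ℓ (𝒴 x₁ x₂) :=
    hf.map_eval_operator hP.internal hW (hloc x₁ x₂) hf𝒴 ℓ
  have map_eval_apply (ℓ r : ℂ) (x₁ : W₁) (x₂ : W₂) :
      f (P.eval ℓ (𝒴P x₁ x₂) r : P) = (W₃.eval ℓ (𝒴 x₁ x₂) r : W₃) :=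
    congrArg Subtype.val (congrFun (map_eval ℓ x₁ x₂) r)
  unfold DualityAt
  simp only [hf.pairing_pullback, hf.map_eval_Y hfm hP hW, map_eval, map_eval_apply]
  exact h

theorem ProductsAt.pullback {r : ℕ} {a : Fin r → V} (h : ProductsAt 𝒴 r a x₁ x₂ φ) :
    ProductsAt 𝒴P r a x₁ x₂ (hf.pullback φ) := by
  unfold ProductsAt
  simp only [hf.pairing_pullback, hf.map_nestedProd hfm hP hW,
    hf.map_eval_operator hP.internal hW (hloc x₁ x₂) hf𝒴]
  exact h

end Pullback

end SingleFunctional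

/-! ### The canonical map is an intertwining map -/

section Homogeneous

variable {V : Type u} [AddCommGroup V] [Module ℂ V] {𝒱 : VOA V} {W₁ W₂ P : VData.{u, w} 𝒱}
  {𝒴 : W₁ →ₗ[ℂ] W₂ →ₗ[ℂ] LogSeries P} (hW₁ : DirectSum.IsInternal W₁.wt)
  (hW₂ : DirectSum.IsInternal W₂.wt)
  (homog : ∀ m₁ m₂ : ℂ, ∀ x₁ ∈ W₁.wt m₁, ∀ x₂ ∈ W₂.wt m₂, ∀ (n : ℂ) (k : ℕ),
    𝒴 x₁ x₂ n k ∈ P.wt (m₁ + m₂ - n - 1))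
include hW₁ hW₂ homog

theorem isLocallyFinite_operator
    (hlog : ∀ (x₁ : W₁) (x₂ : W₂) (n : ℂ), ∃ K : ℕ, ∀ k : ℕ, K < k → 𝒴 x₁ x₂ n k = 0)
    (x₁ : W₁) (x₂ : W₂) : VData.IsLocallyFinite (𝒴 x₁ x₂) :=
  isInternal_bilinear_induction hW₁ hW₂ (B := 𝒴)
    (fun m₁ x₁ hx₁ m₂ x₂ hx₂ =>
      VData.isLocallyFinite_of_homog (homog m₁ m₂ x₁ hx₁ x₂ hx₂) (hlog x₁ x₂))
    VData.isLocallyFinite_zero (fun _ _ => .add) x₁ x₂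

theorem lower_truncation_operator
    (hP : ∀ n : ℂ, ∃ R : ℝ, ∀ l : ℝ, l < R → P.wt (n + l) = ⊥) (x₁ : W₁) (x₂ : W₂) (n : ℂ)
    (k : ℕ) : ∃ N : ℕ, ∀ l : ℕ, N ≤ l → 𝒴 x₁ x₂ (n + l) k = 0 := by
  refine isInternal_bilinear_induction hW₁ hW₂ (B := 𝒴)
    (p := fun s : LogSeries P => ∃ N : ℕ, ∀ l : ℕ, N ≤ l → s (n + l) k = 0)
    (fun m₁ x₁ hx₁ m₂ x₂ hx₂ => ?_) ⟨0, fun _ _ => rfl⟩ ?_ x₁ x₂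
  · obtain ⟨R, hR⟩ := hP (m₁ + m₂ - n - 1)
    obtain ⟨N, hN⟩ := exists_nat_gt (-R)
    refine ⟨N, fun l hl => ?_⟩
    have mem_wt := homog m₁ m₂ x₁ hx₁ x₂ hx₂ (n + l) k
    have weight_eq : m₁ + m₂ - (n + l) - 1 = m₁ + m₂ - n - 1 + ((-l : ℝ) : ℂ) := by
      push_cast
      ring
    have weight_lt : (-l : ℝ) < R := neg_lt.mp (hN.trans_le (Nat.cast_le.mpr hl))
    rwa [weight_eq, hR _ weight_lt, Submodule.mem_bot] at mem_wt
  · rintro s t ⟨N, hN⟩ ⟨M, hM⟩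
    refine ⟨max N M, fun l hl => ?_⟩
    rw [Pi.add_apply, Pi.add_apply, hN l ((le_max_left _ _).trans hl),
      hM l ((le_max_right _ _).trans hl), add_zero]

end Homogeneous

section Main

variable {V : Type u} [AddCommGroup V] [Module ℂ V] {𝒱 : VOA V} {C : TwClass.{u, w} 𝒱} {z : ℂ}
  {g₁ g₂ : V ≃ₗ[ℂ] V} {W₁ W₂ : VData.{u, w} 𝒱}

namespace IsBoxOperator

variable {𝒴 : W₁ →ₗ[ℂ] W₂ →ₗ[ℂ] LogSeries (boxProd C z g₁ g₂ W₁ W₂)}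
  (h𝒴 : IsBoxOperator C z g₁ g₂ 𝒴) (hlift : HasBoxLifts C z g₁ g₂ W₁ W₂)
include h𝒴 hlift

theorem L_neg_one_derivative (x₁ : W₁) (x₂ : W₂) (n : ℂ) (k : ℕ) :
    𝒴 (W₁.L (-1) x₁) x₂ n k =
      -n • 𝒴 x₁ x₂ (n - 1) k + ((k : ℂ) + 1) • 𝒴 x₁ x₂ (n - 1) (k + 1) := by
  refine hlift.ext fun W₃ I hI f hf => ?_
  obtain ⟨𝒴₃, h𝒴₃, hI𝒴⟩ := hI.2
  have map_coeff := h𝒴.map_coeff hf ⟨h𝒴₃, hI𝒴⟩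
  rw [map_add, map_smul, map_smul, map_coeff, map_coeff, map_coeff, h𝒴₃.L_neg_one_derivative]

variable (hC : ∀ g W, C g W → IsTwistedModule g W)
include hC

theorem homog (hP : DirectSum.IsInternal (boxProd C z g₁ g₂ W₁ W₂).wt) (m₁ m₂ : ℂ) (x₁ : W₁)
    (hx₁ : x₁ ∈ W₁.wt m₁) (x₂ : W₂) (hx₂ : x₂ ∈ W₂.wt m₂) (n : ℂ) (k : ℕ) :
    𝒴 x₁ x₂ n k ∈ (boxProd C z g₁ g₂ W₁ W₂).wt (m₁ + m₂ - n - 1) := by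
  suffices 𝒴 x₁ x₂ n k = (boxProd C z g₁ g₂ W₁ W₂).proj (m₁ + m₂ - n - 1) (𝒴 x₁ x₂ n k) by
    rw [this]
    exact Subtype.property _
  refine hlift.ext fun W₃ I hI f hf => ?_
  obtain ⟨𝒴₃, h𝒴₃, hI𝒴⟩ := hI.2
  have hW := (hC _ _ hI.1).internal
  rw [hf.isGraded.map_proj hP hW, h𝒴.map_coeff hf ⟨h𝒴₃, hI𝒴⟩,
    VData.proj_of_mem hW (h𝒴₃.homog m₁ m₂ x₁ hx₁ x₂ hx₂ n k)]

variable (hX : DirectSum.IsInternal (hbox C z g₁ g₂ W₁ W₂).wt)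
  (hloc : ∀ x₁ x₂, VData.IsLocallyFinite (𝒴 x₁ x₂))
include hX hloc

theorem boxMap_tmul (hP : DirectSum.IsInternal (boxProd C z g₁ g₂ W₁ W₂).wt) (x₁ : W₁) (x₂ : W₂) :
    boxMap C z g₁ g₂ W₁ W₂ (x₁ ⊗ₜ[ℂ] x₂) =
      (boxProd C z g₁ g₂ W₁ W₂).eval (lBranch 0 z) (𝒴 x₁ x₂) := by
  funext n
  refine Subtype.ext (hlift.ext fun W₃ I hI f hf => ?_)
  obtain ⟨𝒴₃, h𝒴₃, hI𝒴⟩ := hI.2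
  have hW := (hC _ _ hI.1).internal
  have map_eval := hf.isGraded.map_eval_operator hP hW (hloc x₁ x₂)
    (h𝒴.map_coeff hf ⟨h𝒴₃, hI𝒴⟩) (lBranch 0 z)
  rw [hf.map_boxMap hX hW, hI𝒴, ← map_eval]
  rfl

variable (hfd : ∀ n, FiniteDimensional ℂ ((hbox C z g₁ g₂ W₁ W₂).wt n)) {g : V ≃ₗ[ℂ] V}
  (hP : IsTwistedModule g (boxProd C z g₁ g₂ W₁ W₂)) {x₁ : W₁} {x₂ : W₂}
include hfd hP

theorem dualityAt (a : V) (φ : (boxProd C z g₁ g₂ W₁ W₂).gdual) : DualityAt 𝒴 a x₁ x₂ φ := by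
  induction φ using hlift.gdual_induction hX hfd with
  | pullback W₃ I hI f hf φ =>
    obtain ⟨𝒴₃, h𝒴₃, hI𝒴⟩ := hI.2
    exact DualityAt.pullback hf.isGraded hf.isModuleMap hP (hC _ _ hI.1).internal hloc
      (h𝒴.map_coeff hf ⟨h𝒴₃, hI𝒴⟩) (h𝒴₃.duality a x₁ x₂ φ)
  | zero => exact dualityAt_zero a
  | add φ ψ hφ hψ => exact hφ.add hψ

theorem productsAt {r : ℕ} (hr : 2 ≤ r) (a : Fin r → V)
    (φ : (boxProd C z g₁ g₂ W₁ W₂).gdual) : ProductsAt 𝒴 r a x₁ x₂ φ := by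
  induction φ using hlift.gdual_induction hX hfd with
  | pullback W₃ I hI f hf φ =>
    obtain ⟨𝒴₃, h𝒴₃, hI𝒴⟩ := hI.2
    exact ProductsAt.pullback hf.isGraded hf.isModuleMap hP (hC _ _ hI.1).internal hloc
      (h𝒴.map_coeff hf ⟨h𝒴₃, hI𝒴⟩) (h𝒴₃.products r hr a x₁ x₂ φ)
  | zero => exact productsAt_zero a
  | add φ ψ hφ hψ => exact hφ.add hψ

end IsBoxOperator

theorem isPzIntertwiningMap_boxMap (hC : ∀ g W, C g W → IsTwistedModule g W)
    (hT : TensorAssumption C z) (h₁ : C g₁ W₁) (h₂ : C g₂ W₂) {g : V ≃ₗ[ℂ] V}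
    (hP : IsTwistedModule g (boxProd C z g₁ g₂ W₁ W₂)) :
    IsPzIntertwiningMap z W₁ W₂ (boxProd C z g₁ g₂ W₁ W₂) (boxMap C z g₁ g₂ W₁ W₂) := by
  have hXC := hT.hbox_mem g₁ g₂ W₁ W₂ h₁ h₂
  have hX := (hC _ _ hXC).internal
  have hfd := hT.finiteDimensional hC hXC
  have hW₁ := (hC _ _ h₁).internal
  have hW₂ := (hC _ _ h₂).internal
  have hlift := hT.hasBoxLifts hC h₁ h₂
  obtain ⟨𝒴, h𝒴⟩ := exists_isBoxOperator hC hX hfd hlift hW₁ hW₂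
  have homog := h𝒴.homog hlift hC hP.internal
  have hloc := isLocallyFinite_operator hW₁ hW₂ homog h𝒴.log_finite
  exact ⟨𝒴,
    { homog := homog
      log_finite := h𝒴.log_finite
      lower_truncation := lower_truncation_operator hW₁ hW₂ homog hP.lower_bounded
      duality := fun a _ _ φ => h𝒴.dualityAt hlift hC hX hloc hfd hP a φ
      products := fun _ hr a _ _ φ => h𝒴.productsAt hlift hC hX hloc hfd hP hr a φ
      L_neg_one_derivative := h𝒴.L_neg_one_derivative hlift },
    h𝒴.boxMap_tmul hlift hC hX hloc hP.internal⟩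

end Main

theorem mainTheorem4_general {V : Type u} [AddCommGroup V] [Module ℂ V] {𝒱 : VOA V} {z : ℂ}
    (_hz : z ≠ 0) {C : TwClass.{u, w} 𝒱} (hC : ∀ g W, C g W → IsTwistedModule g W)
    (hT : TensorAssumption C z) {g₁ g₂ : V ≃ₗ[ℂ] V} {W₁ W₂ : VData.{u, w} 𝒱} (h₁ : C g₁ W₁)
    (h₂ : C g₂ W₂) :
    IsPzTensorProduct C z g₁ g₂ W₁ W₂ (boxProd C z g₁ g₂ W₁ W₂) (boxMap C z g₁ g₂ W₁ W₂) := by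
  have hXC := hT.hbox_mem g₁ g₂ W₁ W₂ h₁ h₂
  have hX := (hC _ _ hXC).internal
  have hPC := hT.contra_mem _ _ hXC
  rw [inv_inv] at hPC
  refine ⟨⟨hPC, isPzIntertwiningMap_boxMap hC hT h₁ h₂ (hC _ _ hPC)⟩, fun W₃ I hI => ?_⟩
  obtain ⟨f, hf⟩ := hT.hasBoxLifts hC h₁ h₂ hI
  have map_boxMap := hf.map_boxMap hX (hC _ _ hI.1).internal
  exact ⟨f, ⟨hf.isModuleMap, map_boxMap⟩, fun f' ⟨_, map_boxMap'⟩ =>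
    boxProd_hom_ext hX (hT.finiteDimensional hC hXC) fun t n =>
      (map_boxMap' t n).trans (map_boxMap t n).symm⟩

theorem mainTheorem4 {V : Type u} [AddCommGroup V] [Module ℂ V] (𝒱 : VOA V)
    (G : Subgroup (V ≃ₗ[ℂ] V)) (hG : G ≤ 𝒱.Aut) (z : ℂ) (hz : z ≠ 0) :
    (∀ C : TwClass.{u, w} 𝒱, IsCategoryWithoutAction G C → TensorAssumption C z →
      ∀ (g₁ g₂ : V ≃ₗ[ℂ] V) (W₁ W₂ : VData.{u, w} 𝒱), C g₁ W₁ → C g₂ W₂ →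
        IsPzTensorProduct C z g₁ g₂ W₁ W₂ (boxProd C z g₁ g₂ W₁ W₂)
          (boxMap C z g₁ g₂ W₁ W₂)) ∧
    (∀ C : TwClassWithAction.{u, w} 𝒱 G, IsCategoryWithAction G C →
      TensorAssumption C.underlying z →
      ∀ (g₁ g₂ : G) (W₁ W₂ : VData.{u, w} 𝒱) (ρ₁ : Representation ℂ G W₁)
        (ρ₂ : Representation ℂ G W₂), C g₁ W₁ ρ₁ → C g₂ W₂ ρ₂ →
        IsPzTensorProduct C.underlying z g₁ g₂ W₁ W₂ (boxProd C.underlying z g₁ g₂ W₁ W₂)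
          (boxMap C.underlying z g₁ g₂ W₁ W₂)) :=
  ⟨fun _ hC hT _ _ _ _ h₁ h₂ => mainTheorem4_general hz (fun g W h => (hC g W h).2) hT h₁ h₂,
    fun _ hC hT g₁ g₂ _ _ ρ₁ ρ₂ h₁ h₂ => mainTheorem4_general hz
      (fun g W ⟨hg, ρ, h⟩ => (hC ⟨g, hg⟩ W ρ h).1) hT ⟨g₁.2, ρ₁, h₁⟩ ⟨g₂.2, ρ₂, h₂⟩⟩
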